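/- Let $\alpha>0$, $K>0$. A pair $(q,r)$ is $\alpha$-admissible if $2\le q,r\le\infty$, $(q,r,\alpha)\ne(2,\infty,1)$ and $\frac1q=\alpha\left(\frac12-\frac1r\right)$; $p'$ denotes the conjugate exponent of $p$. Let $(X,dx)$ be a measure space and let $A:D(A)\to L^2(X)$, $B:D(B)\to L^2(X)$ be two linear m-dissipative operators on the complex Hilbert space $L^2(X)$, with $D(A)\hookrightarrow D(B)$ continuously (for the graph norms) and $AB=BA$ (equality of unbounded operators, domains included). Let $(S_A(t))_{t\ge0}$, $(S_B(t))_{t\ge0}$ be the strongly continuous semigroups generated by $A$ and $B$, and assume that $S=S_A$ and $S=S_B$ both satisfy, for all $t,s\ge 0$, $$\|S(t)\varphi\|_{L^2(X)}\le K\|\varphi\|_{L^2(X)}\quad(\varphi\in L^2(X)),$$ $$\|S(t)S(s)^*g\|_{L^\infty(X)}\le K|t-s|^{-\alpha}\|g\|_{L^1(X)}\quad(t\neq s,\ g\in L^1(X)\cap L^2(X)).$$ Then for any $\alpha$-admissible pairs $(q,r)$, $(\tilde q,\tilde r)$ the following hold, for all $T>0$ and $I=(0,T)$ (so $|I|=T$).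 i) There is a constant $C>0$ depending only on $\alpha$, $K$, $q$ such that for all $\varphi\in D(A)\cap D(B)$ $$\|S_A(t)\varphi-S_B(t)\varphi\|_{L^q(I,L^r(X))}\le C\min\{\|\varphi\|_{L^2(X)},\ |I|\,\|(A-B)\varphi\|_{L^2(X)}\}.$$ ii) There is a constant $C>0$ depending only on $\alpha$, $K$, $q$, $\tilde q$ such that for all (strongly measurable, $L^2(X)$-valued) $f\in L^{\tilde q'}(I,L^{\tilde r'}(X))$ with $f(s)\in D(A)\cap D(B)$ for almost every $s\in I$ and $(A-B)f\in L^{\tilde q'}(I,L^{\tilde r'}(X))$, the integrals $\int_0^tS_A(t-s)f(s)\,ds$ and $\int_0^tS_B(t-s)f(s)\,ds$ exist in $L^2(X)$ for all $t\in I$ as weak integrals, are strongly measurable in $t$, and satisfy $$\Big\|\int_0^tS_A(t-s)f(s)\,ds-\int_0^tS_B(t-s)f(s)\,ds\Big\|_{L^q(I,L^r(X))}\le C\min\Big\{\|f\|_{L^{\tilde q'}(I,L^{\tilde r'}(X))},\ |I|\,\|(A-B)f\|_{L^{\tilde q'}(I,L^{\tilde r'}(X))}\Big\}.$$ Here $w\in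 L^2(X)$ is the weak integral $\int_0^tS(t-s)f(s)\,ds$ if for every $h\in L^2(X)$ the function $s\mapsto\langle h,S(t-s)f(s)\rangle$ is integrable on $(0,t)$ with integral $\langle h,w\rangle$. -/

import Mathlib

universe u

open MeasureTheory Set Filter Topology
open scoped ENNReal

/-! ### Unbounded operators and semigroups on a Hilbert space -/

namespace DispersiveSemigroups

section Operators

variable {H : Type*} [NormedAddCommGroup H] [InnerProductSpace ℂ H]

/-- `A` is m-dissipative: `Re ⟨u, A u⟩ ≤ 0` on `D(A)` and `u - λ A u = f` is solvable in `D(A)` for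
all `λ > 0` and all `f`. (In a Hilbert space the first condition is equivalent to
`‖u - λ A u‖ ≥ ‖u‖` for all `λ > 0`.) -/
def IsMDissipative (A : H →ₗ.[ℂ] H) : Prop :=
  (∀ u : A.domain, (inner ℂ (u : H) (A u)).re ≤ 0) ∧
    ∀ l : ℝ, 0 < l → ∀ f : H, ∃ u : A.domain, (u : H) - (l : ℂ) • A u = f

/-- `D(A) ↪ D(B)` continuously, the domains being endowed with their graph norms. -/
def DomainEmbeds (A B : H →ₗ.[ℂ] H) : Prop :=
  ∃ hle : A.domain ≤ B.domain, ∃ c : ℝ, ∀ u : A.domain,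
    ‖(u : H)‖ + ‖B ⟨u, hle u.2⟩‖ ≤ c * (‖(u : H)‖ + ‖A u‖)

/-- The product `A B` of two unbounded operators, with its maximal domain
`D(AB) = {u ∈ D(B) | B u ∈ D(A)}`. -/
def opProd (A B : H →ₗ.[ℂ] H) : H →ₗ.[ℂ] H where
  domain :=
    { carrier := {u | ∃ hu : u ∈ B.domain, B ⟨u, hu⟩ ∈ A.domain}
      add_mem' := by
        rintro u v ⟨hu, hu'⟩ ⟨hv, hv'⟩
        refine ⟨B.domain.add_mem hu hv, ?_⟩
        have h : B ⟨u + v, B.domain.add_mem hu hv⟩ = B ⟨u, hu⟩ + B ⟨v, hv⟩ :=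
          B.map_add ⟨u, hu⟩ ⟨v, hv⟩
        rw [h]
        exact A.domain.add_mem hu' hv'
      zero_mem' := ⟨B.domain.zero_mem, by
        have h : B ⟨0, B.domain.zero_mem⟩ = 0 := B.map_zero
        rw [h]
        exact A.domain.zero_mem⟩
      smul_mem' := by
        rintro c u ⟨hu, hu'⟩
        refine ⟨B.domain.smul_mem c hu, ?_⟩
        have h : B ⟨c • u, B.domain.smul_mem c hu⟩ = c • B ⟨u, hu⟩ := B.map_smul c ⟨u, hu⟩
        rw [h]
        exact A.domain.smul_mem c hu' }
  toFun :=
    { toFun := fun u => A ⟨B ⟨u, u.2.1⟩, u.2.2⟩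
      map_add' := by
        rintro ⟨u, hu, hu'⟩ ⟨v, hv, hv'⟩
        rw [← A.map_add]
        congr 1
        exact Subtype.ext (B.map_add ⟨u, hu⟩ ⟨v, hv⟩)
      map_smul' := by
        rintro c ⟨u, hu, hu'⟩
        rw [← A.map_smul]
        congr 1
        exact Subtype.ext (B.map_smul c ⟨u, hu⟩) }

/-- `(S t)` for `t ≥ 0` is a strongly continuous semigroup of bounded operators. The values of `S`
at negative times play no role. -/
structure IsC0Semigroup (S : ℝ → H →L[ℂ] H) : Prop where
  map_zero : S 0 = ContinuousLinearMap.id ℂ H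
  map_add : ∀ s t : ℝ, 0 ≤ s → 0 ≤ t → S (s + t) = (S s).comp (S t)
  tendsto_zero : ∀ x : H, Tendsto (fun t => S t x) (𝓝[>] 0) (𝓝 x)

/-- `S` is the semigroup generated by `A`: it is a strongly continuous semigroup whose
infinitesimal generator (with its maximal domain) is `A`. -/
def IsSemigroupGeneratedBy (S : ℝ → H →L[ℂ] H) (A : H →ₗ.[ℂ] H) : Prop :=
  IsC0Semigroup S ∧
    ∀ x y : H, (x, y) ∈ A.graph ↔
      Tendsto (fun t : ℝ => ((t : ℂ)⁻¹) • (S t x - x)) (𝓝[>] 0) (𝓝 y)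

/-- `w` is the integral `∫₀ᵗ S(t - s) f(s) ds`, as a weak integral in the Hilbert space: for every
`h` the scalar function `s ↦ ⟨h, S(t - s) f(s)⟩` is integrable on `(0, t)` with integral `⟨h, w⟩`.
Such a `w` is unique, and it is the Bochner integral whenever that integral exists. -/
def IsDuhamelIntegral (S : ℝ → H →L[ℂ] H) (f : ℝ → H) (t : ℝ) (w : H) : Prop :=
  ∀ h : H, IntegrableOn (fun s => inner ℂ h (S (t - s) (f s))) (Ioo 0 t) ∧
    ∫ s in Ioo 0 t, inner ℂ h (S (t - s) (f s)) = inner ℂ h w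

end Operators

/-! ### Exponents and mixed norms -/

/-- `(q, r)` is `α`-admissible: `2 ≤ q, r ≤ ∞`, `(q, r, α) ≠ (2, ∞, 1)` and
`1/q = α (1/2 - 1/r)`. -/
def Admissible (α : ℝ) (q r : ℝ≥0∞) : Prop :=
  2 ≤ q ∧ 2 ≤ r ∧ (q, r, α) ≠ (2, ∞, 1) ∧ (q⁻¹).toReal = α * (1 / 2 - (r⁻¹).toReal)

section Lp

variable {X : Type*} [MeasurableSpace X] {μ : Measure X}

/-- The norm of `L^q(I, L^r(X))`, of a function of time with values in `L²(X)`; it is `∞` outside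
that space. -/
noncomputable def mixedNorm (q r : ℝ≥0∞) (I : Set ℝ) (u : ℝ → Lp ℂ 2 μ) : ℝ≥0∞ :=
  eLpNorm (fun t => eLpNorm (u t) r μ) q (volume.restrict I)

/-- The energy estimate `‖S(t) φ‖_{L²} ≤ K ‖φ‖_{L²}`, `t ≥ 0`. -/
def EnergyEstimate (K : ℝ) (S : ℝ → Lp ℂ 2 μ →L[ℂ] Lp ℂ 2 μ) : Prop :=
  ∀ t : ℝ, 0 ≤ t → ∀ φ : Lp ℂ 2 μ, ‖S t φ‖ ≤ K * ‖φ‖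

/-- The decay estimate `‖S(t) S(s)* g‖_{L^∞} ≤ K |t - s|^{-α} ‖g‖_{L¹}` for `t, s ≥ 0`, `t ≠ s`,
and `g ∈ L¹ ∩ L²`. -/
def DecayEstimate (α K : ℝ) (S : ℝ → Lp ℂ 2 μ →L[ℂ] Lp ℂ 2 μ) : Prop :=
  ∀ t s : ℝ, 0 ≤ t → 0 ≤ s → t ≠ s → ∀ g : Lp ℂ 2 μ, MemLp g 1 μ →
    eLpNorm (S t (ContinuousLinearMap.adjoint (S s) g)) ∞ μ ≤
      ENNReal.ofReal (K * |t - s| ^ (-α)) * eLpNorm g 1 μ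

end Lp

end DispersiveSemigroups

open DispersiveSemigroups

/-! Because `A` and `B` commute, so do their resolvents, hence `S_B(s)` commutes with the resolvent
of `A` and preserves `D(A)`. The curve `s ↦ S_A(t-s) S_B(s) φ` can therefore be differentiated, and
integration gives `S_A(t)φ - S_B(t)φ = ∫₀ᵗ S_A(t-s) S_B(s) (A-B)φ ds` (`sub_eq_integral_of_comm`).
By Fubini the two Duhamel integrals of `f` differ by the `S_A`-Duhamel integral of the `S_B`-Duhamel
integral of `(A-B)f` (`duhamel_sub_duhamel`). Both differences are thus Duhamel integrals whose
source lies in `L^∞(I, L²)`, and so in `L¹(I, L²)` with a factor `|I|`; the retarded Strichartz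
estimate from the dual of the pair `(∞, 2)` gives the second entry of each minimum. The first entry
is the triangle inequality and the Strichartz estimates of each semigroup.

What remains is Strichartz theory for semigroups that are only contractive. The decay hypothesis is
used at `s = 0` alone, where it says that `S(t)` maps `L¹` to `L^∞`. Since `S(t)S(s)*` is not
`S(t-s)`, the `TT*` argument is replaced by an energy inequality: if `w` is the Duhamel integral of
`F`, then `‖w(b)‖² ≤ 2 Re ∫ ⟨F, w⟩` (`IsContractionSemigroup.energy_inequality`). So a bound for the
retarded form `∬_{s<t} ⟨G(t), S(t-s)F(s)⟩` on one dual admissible space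
(`exists_enorm_windowForm_le`) controls the Duhamel integral in `L^∞(L²)` as well as, by duality, in
the admissible space itself. The homogeneous estimate follows by pairing with the adjoint semigroup,
which satisfies the same hypotheses. Interpolating with `L^∞(L²)` reaches all larger time exponents,
and transposition the smaller ones (`exists_mixedNorm_duhamel_le`).

The retarded form is bounded by the triangle inequality when `q = ∞`. When `2 < q < ∞`,
interpolating between `L¹ → L^∞` and `L² → L²` gives the kernel `|t-s|^{-2/q}`, to which
Hardy-Littlewood-Sobolev applies. When `q = 2` this fails logarithmically, and the argument of Keel
and Tao is used: dyadic time windows `t-s ∼ 2^j`, dyadic heights `2^k`, `2^l` of `F` and `G`, and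
three bounds per window, at least one of which decays exponentially in each direction of the indices
(`exists_enorm_windowForm_le_endpoint`). The one-sided bounds in a window come again from the energy
inequality.

All estimates are first proved for bounded sources. General sources are truncated; the Duhamel
integrals of the truncations are Cauchy in `L²` at each time, their limit is the weak integral, and
the norms are lower semicontinuous. -/

namespace DispersiveSemigroups

/-! ### Contraction semigroups and the energy inequality. -/

section ContractionSemigroup

variable {H : Type*} [NormedAddCommGroup H] [InnerProductSpace ℂ H]

/-- A strongly continuous semigroup of contractions, extended by the identity to negative times. -/
structure IsContractionSemigroup (S : ℝ → H →L[ℂ] H) : Prop where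
  map_nonpos : ∀ t ≤ 0, S t = ContinuousLinearMap.id ℂ H
  map_add : ∀ s t : ℝ, 0 ≤ s → 0 ≤ t → S (s + t) = (S s).comp (S t)
  norm_le : ∀ t x, ‖S t x‖ ≤ ‖x‖
  tendsto_zero : ∀ x : H, Tendsto (fun t => S t x) (𝓝[>] 0) (𝓝 x)

/-- A bounded strongly measurable function of time. -/
structure IsBddMeas (F : ℝ → H) : Prop where
  meas : StronglyMeasurable F
  bdd : ∃ M : ℝ, 0 ≤ M ∧ ∀ s, ‖F s‖ ≤ M

/-- The Duhamel integral `∫ₐᵗ S(t - s) F(s) ds`. -/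
noncomputable def duhamel (S : ℝ → H →L[ℂ] H) (F : ℝ → H) (a t : ℝ) : H :=
  ∫ s in a..t, S (t - s) (F s)

namespace IsContractionSemigroup

variable {S : ℝ → H →L[ℂ] H}

theorem map_add_apply (hS : IsContractionSemigroup S) {s t : ℝ} (hs : 0 ≤ s) (ht : 0 ≤ t) (x : H) :
    S (s + t) x = S s (S t x) := by
  rw [hS.map_add s t hs ht]; rfl

theorem tendsto_nhds_zero (hS : IsContractionSemigroup S) (x : H) :
    Tendsto (fun t => S t x) (𝓝 0) (𝓝 x) := by
  have h1 : Tendsto (fun t => S t x) (𝓝[≤] 0) (𝓝 x) := by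
    refine tendsto_const_nhds.congr' ?_
    filter_upwards [self_mem_nhdsWithin] with t ht
    simp [hS.map_nonpos t ht]
  have := h1.sup (hS.tendsto_zero x)
  rwa [← nhdsWithin_union, Iic_union_Ioi, nhdsWithin_univ] at this

theorem map_max (hS : IsContractionSemigroup S) (t : ℝ) : S t = S (max t 0) := by
  rcases le_total t 0 with h | h
  · rw [max_eq_right h, hS.map_nonpos t h, hS.map_nonpos 0 le_rfl]
  · rw [max_eq_left h]

theorem norm_sub_le (hS : IsContractionSemigroup S) (s t : ℝ) (x : H) :
    ‖S t x - S s x‖ ≤ ‖S |max t 0 - max s 0| x - x‖ := by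
  wlog h : s ≤ t generalizing s t
  · rw [norm_sub_rev, abs_sub_comm]
    exact this t s (le_of_not_ge h)
  have h' : max s 0 ≤ max t 0 := max_le_max_right 0 h
  rw [hS.map_max t, hS.map_max s, abs_of_nonneg (sub_nonneg.2 h')]
  have : S (max t 0) x = S (max s 0) (S (max t 0 - max s 0) x) := by
    rw [← hS.map_add_apply (le_max_right _ _) (sub_nonneg.2 h')]
    congr 2; ring
  rw [this, ← map_sub]
  exact hS.norm_le _ _

theorem continuous_apply (hS : IsContractionSemigroup S) (x : H) : Continuous fun t => S t x := by
  refine continuous_iff_continuousAt.2 fun t₀ => ?_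
  rw [ContinuousAt, tendsto_iff_norm_sub_tendsto_zero]
  refine squeeze_zero (fun _ => norm_nonneg _) (fun t => hS.norm_sub_le t₀ t x) ?_
  have h1 : Tendsto (fun t : ℝ => |max t 0 - max t₀ 0|) (𝓝 t₀) (𝓝 0) := by
    have : Continuous fun t : ℝ => |max t 0 - max t₀ 0| := by fun_prop
    simpa using this.tendsto t₀
  have h2 := (hS.tendsto_nhds_zero x).comp h1
  simpa using (h2.sub_const x).norm

/-- Strong continuity becomes joint continuity because the operators are uniformly bounded. This is
what makes `s ↦ S(t - s) F(s)` measurable for every strongly measurable `F`. -/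
theorem continuous_uncurry (hS : IsContractionSemigroup S) :
    Continuous fun p : ℝ × H => S p.1 p.2 := by
  refine continuous_iff_continuousAt.2 fun ⟨t₀, x₀⟩ => ?_
  rw [ContinuousAt, tendsto_iff_norm_sub_tendsto_zero]
  have hb : ∀ p : ℝ × H, ‖S p.1 p.2 - S t₀ x₀‖ ≤ ‖p.2 - x₀‖ + ‖S p.1 x₀ - S t₀ x₀‖ := by
    intro p
    calc ‖S p.1 p.2 - S t₀ x₀‖ = ‖S p.1 (p.2 - x₀) + (S p.1 x₀ - S t₀ x₀)‖ := by
          rw [map_sub]; congr 1; abel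
      _ ≤ ‖p.2 - x₀‖ + ‖S p.1 x₀ - S t₀ x₀‖ :=
          (norm_add_le _ _).trans (by gcongr; exact hS.norm_le _ _)
  refine squeeze_zero (fun _ => norm_nonneg _) hb ?_
  have : Continuous fun p : ℝ × H => ‖p.2 - x₀‖ + ‖S p.1 x₀ - S t₀ x₀‖ := by
    have := (hS.continuous_apply x₀).comp (continuous_fst (X := ℝ) (Y := H))
    simp only [Function.comp_def] at this
    exact (continuous_snd.sub continuous_const).norm.add (this.sub continuous_const).norm
  simpa using this.tendsto (t₀, x₀)

/-- Strong continuity, the only property not immediate for adjoints, comes from contractivity: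
`‖S(t)*x - x‖² ≤ 2(‖x‖² - Re ⟨x, S(t)x⟩)`, and the right side tends to zero. -/
theorem adjoint [CompleteSpace H] (hS : IsContractionSemigroup S) :
    IsContractionSemigroup fun t => ContinuousLinearMap.adjoint (S t) where
  map_nonpos t ht := by
    rw [hS.map_nonpos t ht]
    exact ContinuousLinearMap.adjoint_id
  map_add s t hs ht := by
    rw [add_comm, hS.map_add t s ht hs, ContinuousLinearMap.adjoint_comp]
  norm_le t x := by
    refine (ContinuousLinearMap.le_opNorm _ _).trans ?_
    rw [LinearIsometryEquiv.norm_map]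
    have : ‖S t‖ ≤ 1 := ContinuousLinearMap.opNorm_le_bound _ zero_le_one fun x => by
      simpa using hS.norm_le t x
    nlinarith [norm_nonneg x]
  tendsto_zero x := by
    have hn : ∀ t, ‖ContinuousLinearMap.adjoint (S t) x‖ ≤ ‖x‖ := fun t => by
      refine (ContinuousLinearMap.le_opNorm _ _).trans ?_
      rw [LinearIsometryEquiv.norm_map]
      have : ‖S t‖ ≤ 1 := ContinuousLinearMap.opNorm_le_bound _ zero_le_one fun x => by
        simpa using hS.norm_le t x
      nlinarith [norm_nonneg x]
    rw [tendsto_iff_norm_sub_tendsto_zero]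
    have hb : ∀ t, ‖ContinuousLinearMap.adjoint (S t) x - x‖ ^ 2 ≤
        2 * (‖x‖ ^ 2 - (inner ℂ x (S t x)).re) := fun t => by
      rw [@norm_sub_sq ℂ, ContinuousLinearMap.adjoint_inner_left]
      have := pow_le_pow_left₀ (norm_nonneg _) (hn t) 2
      simp only [RCLike.re_to_complex] at *
      linarith
    have hl : Tendsto (fun t => 2 * (‖x‖ ^ 2 - (inner ℂ x (S t x)).re)) (𝓝[>] 0) (𝓝 0) := by
      have h1 : Tendsto (fun t => inner ℂ x (S t x)) (𝓝[>] 0) (𝓝 (inner ℂ x x)) :=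
        tendsto_const_nhds.inner (hS.tendsto_zero x)
      have h2 := (Complex.continuous_re.tendsto _).comp h1
      have h3 := (h2.const_sub (‖x‖ ^ 2)).const_mul 2
      have h4 : (inner ℂ x x).re = ‖x‖ ^ 2 := by
        simpa using (inner_self_eq_norm_sq (𝕜 := ℂ) x)
      rw [h4] at h3
      simpa [Function.comp_def] using h3
    have h5 := squeeze_zero (fun t => by positivity) hb hl
    have h6 := (Real.continuous_sqrt.tendsto 0).comp h5
    simpa [Function.comp_def, Real.sqrt_sq] using h6

theorem stronglyMeasurable_apply (hS : IsContractionSemigroup S) {X : Type*} [MeasurableSpace X]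
    {τ : X → ℝ} {F : X → H} (hτ : Measurable τ) (hF : StronglyMeasurable F) :
    StronglyMeasurable fun s => S (τ s) (F s) :=
  hS.continuous_uncurry.comp_stronglyMeasurable (hτ.stronglyMeasurable.prodMk hF)

theorem intervalIntegrable (hS : IsContractionSemigroup S) {F : ℝ → H} (hF : IsBddMeas F)
    {τ : ℝ → ℝ} (hτ : Measurable τ) (a b : ℝ) :
    IntervalIntegrable (fun s => S (τ s) (F s)) volume a b := by
  obtain ⟨M, -, hM⟩ := hF.bdd
  refine (intervalIntegrable_const (c := M)).mono_fun
    (hS.stronglyMeasurable_apply hτ hF.meas).aestronglyMeasurable ?_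
  filter_upwards with s
  exact ((hS.norm_le _ _).trans (hM s)).trans (le_abs_self M)

theorem norm_integral_le (hS : IsContractionSemigroup S) {F : ℝ → H} {M : ℝ}
    (hM : ∀ s, ‖F s‖ ≤ M) (τ : ℝ → ℝ) {a b : ℝ} (hab : a ≤ b) :
    ‖∫ s in a..b, S (τ s) (F s)‖ ≤ M * (b - a) := by
  have := intervalIntegral.norm_integral_le_of_norm_le_const (a := a) (b := b)
    (f := fun s => S (τ s) (F s)) (C := M) (fun s _ => (hS.norm_le _ _).trans (hM s))
  rwa [abs_of_nonneg (sub_nonneg.2 hab)] at this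

theorem duhamel_eq_add [CompleteSpace H] (hS : IsContractionSemigroup S) {F : ℝ → H} (hF : IsBddMeas F)
    {a t t' : ℝ} (hat : a ≤ t) (htt' : t ≤ t') :
    duhamel S F a t' = S (t' - t) (duhamel S F a t) + ∫ s in t..t', S (t' - s) (F s) := by
  have hi : ∀ c d e : ℝ, IntervalIntegrable (fun s => S (c - s) (F s)) volume d e := fun c d e =>
    hS.intervalIntegrable hF (by fun_prop) d e
  rw [duhamel, ← intervalIntegral.integral_add_adjacent_intervals (hi t' a t) (hi t' t t'), duhamel,
    ← ContinuousLinearMap.intervalIntegral_comp_comm _ (hi t a t)]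
  congr 1
  refine intervalIntegral.integral_congr fun s hs => ?_
  rw [uIcc_of_le hat] at hs
  rw [← hS.map_add_apply (by linarith) (by linarith [hs.2])]
  congr 2; ring

theorem continuous_duhamel (hS : IsContractionSemigroup S) {F : ℝ → H} (hF : IsBddMeas F)
    (a : ℝ) : Continuous (duhamel S F a) := by
  refine continuous_iff_continuousAt.2 fun t₀ => ?_
  obtain ⟨M, -, hM⟩ := hF.bdd
  have h := intervalIntegral.continuousAt_parametric_primitive_of_dominated (μ := volume)
    (F := fun t s => S (t - s) (F s)) (fun _ => M) (min a t₀ - 1) (max a t₀ + 1)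
    (a₀ := a) (b₀ := t₀) (x₀ := t₀)
    (fun t => (hS.stronglyMeasurable_apply (by fun_prop) hF.meas).aestronglyMeasurable)
    (Eventually.of_forall fun t => Eventually.of_forall fun s => (hS.norm_le _ _).trans (hM s))
    (intervalIntegrable_const) (Eventually.of_forall fun s => by
      exact ((hS.continuous_apply (F s)).comp (continuous_id.sub continuous_const)).continuousAt)
    ⟨by linarith [min_le_left a t₀], by linarith [le_max_left a t₀]⟩
    ⟨by linarith [min_le_right a t₀], by linarith [le_max_right a t₀]⟩ (by simp)
  exact ContinuousAt.comp (f := fun t : ℝ => (t, t))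
    (g := fun p : ℝ × ℝ => ∫ s in a..p.2, S (p.1 - s) (F s)) h (by fun_prop)

/-- Expand the square of `w(t') = S(t'-t)w(t) + ∫ S(t'-s)F(s) ds`. Contractivity bounds the first
square; replacing `S(t'-t)w(t)` by `S(t'-s)w(s)` in the cross term costs `2M²(t'-t)²`, and the last
square costs `M²(t'-t)²`. No derivative of `w` is taken, so the source need not be regular. The
error is quadratic in the step and vanishes when summed over a mesh. -/
theorem energy_step [CompleteSpace H] (hS : IsContractionSemigroup S) {F : ℝ → H} (hF : IsBddMeas F) {M : ℝ}
    (hM0 : 0 ≤ M) (hM : ∀ s, ‖F s‖ ≤ M) {a t t' : ℝ} (hat : a ≤ t) (htt' : t ≤ t') :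
    ‖duhamel S F a t'‖ ^ 2 ≤ ‖duhamel S F a t‖ ^ 2 +
      (∫ s in t..t', 2 * (inner ℂ (S (t' - s) (F s)) (S (t' - s) (duhamel S F a s))).re) +
      3 * M ^ 2 * (t' - t) ^ 2 := by
  set w := duhamel S F a with hw
  have hi := hS.intervalIntegrable hF (τ := fun s => t' - s) (by fun_prop) t t'
  have hmF : StronglyMeasurable fun s => S (t' - s) (F s) :=
    hS.stronglyMeasurable_apply (by fun_prop) hF.meas
  have hmw : StronglyMeasurable fun s => S (t' - s) (w s) :=
    hS.stronglyMeasurable_apply (by fun_prop) (hS.continuous_duhamel hF a).stronglyMeasurable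
  have h1 : ‖w t'‖ ^ 2 = ‖S (t' - t) (w t)‖ ^ 2 +
      2 * (inner ℂ (∫ s in t..t', S (t' - s) (F s)) (S (t' - t) (w t))).re +
      ‖∫ s in t..t', S (t' - s) (F s)‖ ^ 2 := by
    rw [hw, hS.duhamel_eq_add hF hat htt', add_comm, @norm_add_sq ℂ]
    simp only [RCLike.re_to_complex]
    ring
  have h2 := pow_le_pow_left₀ (norm_nonneg _) (hS.norm_le (t' - t) (w t)) 2
  have h3 := pow_le_pow_left₀ (norm_nonneg _)
    (hS.norm_integral_le hM (fun s => t' - s) htt') 2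
  have hre : 2 * (inner ℂ (∫ s in t..t', S (t' - s) (F s)) (S (t' - t) (w t))).re =
      ∫ s in t..t', 2 * (inner ℂ (S (t' - s) (F s)) (S (t' - t) (w t))).re := by
    have e1 : ∀ x y : H, (inner ℂ x y).re = (innerSL ℂ y x).re := fun x y => by
      rw [innerSL_apply_apply, ← inner_conj_symm, Complex.conj_re]
    simp_rw [e1]
    rw [← ContinuousLinearMap.intervalIntegral_comp_comm _ hi]
    have := Complex.reCLM.intervalIntegral_comp_comm
      (f := fun s => innerSL ℂ (S (t' - t) (w t)) (S (t' - s) (F s)))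
      ⟨(innerSL ℂ _).integrable_comp hi.1, (innerSL ℂ _).integrable_comp hi.2⟩
    simp only [Complex.reCLM_apply] at this
    rw [intervalIntegral.integral_const_mul, this]
  have hmu : StronglyMeasurable fun s => inner ℂ (S (t' - s) (F s)) (S (t' - t) (w t)) :=
    hmF.inner stronglyMeasurable_const
  have hmv : StronglyMeasurable fun s => inner ℂ (S (t' - s) (F s)) (S (t' - s) (w s)) :=
    hmF.inner hmw
  have hbw : ∀ s ∈ Icc t t', ‖w s‖ ≤ M * (t' - a) := fun s hs =>
    (hS.norm_integral_le hM (fun r => s - r) (hat.trans hs.1)).trans (by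
      gcongr; exact hs.2)
  have hint1 : IntervalIntegrable
      (fun s => 2 * (inner ℂ (S (t' - s) (F s)) (S (t' - t) (w t))).re) volume t t' := by
    refine (intervalIntegrable_const (c := 2 * (M * ‖w t‖))).mono_fun
      ((Complex.measurable_re.comp hmu.measurable).const_mul 2).aestronglyMeasurable ?_
    filter_upwards with s
    rw [norm_mul, Real.norm_eq_abs, Real.norm_eq_abs, Real.norm_eq_abs, abs_two]
    refine le_trans ?_ (le_abs_self _)
    gcongr
    refine (Complex.abs_re_le_norm _).trans ((norm_inner_le_norm _ _).trans ?_)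
    gcongr
    · exact (hS.norm_le _ _).trans (hM s)
    · exact hS.norm_le _ _
  have hint2 : IntervalIntegrable
      (fun s => 2 * (inner ℂ (S (t' - s) (F s)) (S (t' - s) (w s))).re + 2 * (M * (M * (t' - t))))
      volume t t' := by
    refine IntervalIntegrable.add ?_ intervalIntegrable_const
    refine (intervalIntegrable_const (c := 2 * (M * (M * (t' - a))))).mono_fun
      ((Complex.measurable_re.comp hmv.measurable).const_mul 2).aestronglyMeasurable ?_
    refine (ae_restrict_iff' measurableSet_uIoc).2 (Eventually.of_forall fun s hs => ?_)
    rw [uIoc_of_le htt'] at hs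
    dsimp only
    rw [norm_mul, Real.norm_eq_abs, Real.norm_eq_abs, Real.norm_eq_abs, abs_two]
    refine le_trans ?_ (le_abs_self _)
    gcongr
    refine (Complex.abs_re_le_norm _).trans ((norm_inner_le_norm _ _).trans ?_)
    gcongr
    · exact (hS.norm_le _ _).trans (hM s)
    · exact (hS.norm_le _ _).trans (hbw s ⟨hs.1.le, hs.2⟩)
  have h4 : (∫ s in t..t', 2 * (inner ℂ (S (t' - s) (F s)) (S (t' - t) (w t))).re) ≤
      ∫ s in t..t', (2 * (inner ℂ (S (t' - s) (F s)) (S (t' - s) (w s))).re +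
        2 * (M * (M * (t' - t)))) := by
    refine intervalIntegral.integral_mono_on htt' hint1 hint2 fun s hs => ?_
    have e2 : S (t' - t) (w t) =
        S (t' - s) (w s) - S (t' - s) (∫ r in t..s, S (s - r) (F r)) := by
      rw [← map_sub, hw, hS.duhamel_eq_add hF hat hs.1, add_sub_cancel_right,
        ← hS.map_add_apply (by linarith [hs.2]) (by linarith [hs.1])]
      congr 2; ring
    rw [e2, inner_sub_right, Complex.sub_re]
    have e3 : |(inner ℂ (S (t' - s) (F s)) (S (t' - s) (∫ r in t..s, S (s - r) (F r)))).re| ≤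
        M * (M * (t' - t)) := by
      refine (Complex.abs_re_le_norm _).trans ((norm_inner_le_norm _ _).trans ?_)
      gcongr
      · exact (hS.norm_le _ _).trans (hM s)
      · refine (hS.norm_le _ _).trans ((hS.norm_integral_le hM _ hs.1).trans ?_)
        gcongr
        exact hs.2
    have := neg_abs_le
      (inner ℂ (S (t' - s) (F s)) (S (t' - s) (∫ r in t..s, S (s - r) (F r)))).re
    linarith
  rw [intervalIntegral.integral_add ?_ intervalIntegrable_const,
    intervalIntegral.integral_const, smul_eq_mul] at h4
  · rw [h1, hre]
    nlinarith
  · simpa using hint2.sub (intervalIntegrable_const (c := 2 * (M * (M * (t' - t)))))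

/-- The energy inequality for the inhomogeneous equation driven by a contraction semigroup. -/
theorem energy_inequality [CompleteSpace H] (hS : IsContractionSemigroup S) {F : ℝ → H}
    (hF : IsBddMeas F) {a b : ℝ} (hab : a ≤ b) :
    ‖duhamel S F a b‖ ^ 2 ≤ ∫ s in a..b, 2 * (inner ℂ (F s) (duhamel S F a s)).re := by
  obtain ⟨M, hM0, hM⟩ := hF.bdd
  set w := duhamel S F a with hw
  have hwc : Continuous w := hS.continuous_duhamel hF a
  set h : ℕ → ℝ := fun n => (b - a) / (n + 1) with hh
  have hh0 : ∀ n, 0 ≤ h n := fun n => div_nonneg (sub_nonneg.2 hab) (by positivity)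
  -- The distance from `s` to the next mesh point. It tends to zero with the mesh, so strong
  -- continuity removes both operators from `ψ n` in the limit.
  set σ : ℕ → ℝ → ℝ := fun n s => a + h n * (⌊(s - a) / h n⌋₊ + 1) - s with hσ
  have hσm : ∀ n, Measurable (σ n) := fun n => by
    have : Measurable fun s => ((⌊(s - a) / h n⌋₊ : ℕ) : ℝ) :=
      measurable_from_nat.comp (Nat.measurable_floor.comp (by fun_prop))
    fun_prop
  set ψ : ℕ → ℝ → ℝ := fun n s =>
    2 * (inner ℂ (S (σ n s) (F s)) (S (σ n s) (w s))).re with hψ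
  have hψm : ∀ n, AEStronglyMeasurable (ψ n) (volume.restrict (uIoc a b)) := fun n => by
    have : StronglyMeasurable fun s => inner ℂ (S (σ n s) (F s)) (S (σ n s) (w s)) :=
      (hS.stronglyMeasurable_apply (hσm n) hF.meas).inner
        (hS.stronglyMeasurable_apply (hσm n) hwc.stronglyMeasurable)
    exact ((Complex.measurable_re.comp this.measurable).const_mul 2).aestronglyMeasurable
  have hψb : ∀ n, ∀ s ∈ Ioc a b, ‖ψ n s‖ ≤ 2 * (M * (M * (b - a))) := fun n s hs => by
    rw [hψ, norm_mul, Real.norm_eq_abs, abs_two, Real.norm_eq_abs]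
    gcongr
    refine (Complex.abs_re_le_norm _).trans ((norm_inner_le_norm _ _).trans ?_)
    gcongr
    · exact (hS.norm_le _ _).trans (hM s)
    · refine (hS.norm_le _ _).trans ((hS.norm_integral_le hM _ hs.1.le).trans ?_)
      gcongr
      exact hs.2
  have hψi : ∀ n c d, a ≤ c → c ≤ d → d ≤ b → IntervalIntegrable (ψ n) volume c d := by
    intro n c d hac hcd hdb
    refine (intervalIntegrable_const (c := 2 * (M * (M * (b - a))))).mono_fun
      ((hψm n).mono_measure (Measure.restrict_mono ?_ le_rfl)) ?_
    · rw [uIoc_of_le hcd, uIoc_of_le hab]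
      exact Ioc_subset_Ioc hac hdb
    · refine (ae_restrict_iff' measurableSet_uIoc).2 (Eventually.of_forall fun s hs => ?_)
      rw [uIoc_of_le hcd] at hs
      exact (hψb n s ⟨hac.trans_lt hs.1, hs.2.trans hdb⟩).trans (le_abs_self _)
  rcases hab.eq_or_lt with rfl | hlt
  · simp [hw, duhamel]
  have hhpos : ∀ n, 0 < h n := fun n => div_pos (sub_pos.2 hlt) (by positivity)
  have hmesh : ∀ n : ℕ, ∀ k : ℕ, k ≤ n + 1 → ‖w (a + k * h n)‖ ^ 2 ≤
      (∫ s in a..(a + k * h n), ψ n s) + 3 * M ^ 2 * (h n) ^ 2 * k := by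
    intro n k
    induction k with
    | zero => intro _; simp [hw, duhamel]
    | succ k ih =>
      intro hk
      have hk' : ((k : ℝ) + 1) ≤ n + 1 := by exact_mod_cast hk
      have hle : a + (k + 1) * h n ≤ b := by
        have : ((k : ℝ) + 1) * h n ≤ (n + 1) * h n := by gcongr
        have e : ((n : ℝ) + 1) * h n = b - a := by rw [hh]; field_simp
        linarith
      have h0 := hh0 n
      have h1 : a ≤ a + k * h n := by have := mul_nonneg (Nat.cast_nonneg (α := ℝ) k) h0; linarith
      have h2 : a + k * h n ≤ a + (k + 1) * h n := by linarith
      have h3 := hS.energy_step hF hM0 hM h1 h2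
      have h4 : (∫ s in (a + k * h n)..(a + (k + 1) * h n),
          2 * (inner ℂ (S (a + (k + 1) * h n - s) (F s))
            (S (a + (k + 1) * h n - s) (duhamel S F a s))).re) =
          ∫ s in (a + k * h n)..(a + (k + 1) * h n), ψ n s := by
        -- The cell is opened at its right end, where the floor has already jumped to the next
        -- index.
        rw [intervalIntegral.integral_of_le h2, intervalIntegral.integral_of_le h2,
          integral_Ioc_eq_integral_Ioo, integral_Ioc_eq_integral_Ioo]
        refine setIntegral_congr_fun measurableSet_Ioo fun s hs => ?_
        have : ⌊(s - a) / h n⌋₊ = k := by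
          rw [Nat.floor_eq_iff (div_nonneg (by linarith [hs.1]) h0), le_div_iff₀ (hhpos n),
            div_lt_iff₀ (hhpos n)]
          exact ⟨by linarith [hs.1], by linarith [hs.2]⟩
        simp only [hψ, hσ, this]
        rw [mul_comm ((k : ℝ) + 1)]
      rw [h4] at h3
      push_cast
      rw [← intervalIntegral.integral_add_adjacent_intervals
        (hψi n a _ le_rfl h1 (h2.trans hle)) (hψi n _ _ h1 h2 hle)]
      have := ih (by omega)
      have e : a + (k + 1) * h n - (a + k * h n) = h n := by ring
      rw [e] at h3
      linarith
  have hfin : ∀ n, ‖w b‖ ^ 2 ≤ (∫ s in a..b, ψ n s) + 3 * M ^ 2 * (b - a) * h n := by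
    intro n
    have e : ((n : ℝ) + 1) * h n = b - a := by rw [hh]; field_simp
    have := hmesh n (n + 1) le_rfl
    push_cast at this
    rw [e, add_sub_cancel] at this
    refine this.trans (le_of_eq ?_)
    rw [← e]
    ring
  have hh_lim : Tendsto h atTop (𝓝 0) := by
    have := (tendsto_one_div_add_atTop_nhds_zero_nat (𝕜 := ℝ)).const_mul (b - a)
    simpa [hh, div_eq_mul_inv] using this
  have hlim : Tendsto (fun n => ∫ s in a..b, ψ n s) atTop
      (𝓝 (∫ s in a..b, 2 * (inner ℂ (F s) (w s)).re)) := by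
    refine intervalIntegral.tendsto_integral_filter_of_dominated_convergence
      (fun _ => 2 * (M * (M * (b - a)))) (Eventually.of_forall hψm)
      (Eventually.of_forall fun n => Eventually.of_forall fun s hs => ?_)
      intervalIntegrable_const (Eventually.of_forall fun s hs => ?_)
    · rw [uIoc_of_le hab] at hs
      exact hψb n s hs
    · rw [uIoc_of_le hab] at hs
      have hσ0 : Tendsto (fun n => σ n s) atTop (𝓝 0) := by
        refine squeeze_zero (fun n => ?_) (fun n => ?_) hh_lim
        · have := (Nat.lt_floor_add_one ((s - a) / h n)).le
          rw [div_le_iff₀ (hhpos n)] at this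
          simp only [hσ]; linarith
        · have := Nat.floor_le (a := (s - a) / h n) (div_nonneg (by linarith [hs.1]) (hh0 n))
          rw [le_div_iff₀ (hhpos n)] at this
          simp only [hσ]; linarith
      have h1 := ((hS.tendsto_nhds_zero (F s)).comp hσ0).inner (𝕜 := ℂ)
        ((hS.tendsto_nhds_zero (w s)).comp hσ0)
      exact ((Complex.continuous_re.tendsto _).comp h1).const_mul 2
  have := hlim.add (hh_lim.const_mul (3 * M ^ 2 * (b - a)))
  rw [mul_zero, add_zero] at this
  exact ge_of_tendsto' this hfin

end IsContractionSemigroup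
end ContractionSemigroup

/-! ### Resolvents, generators and the difference formula. -/

section Generators

variable {H : Type*} [NormedAddCommGroup H] [InnerProductSpace ℂ H]

/-- `A` is the infinitesimal generator of `S`. -/
def IsGenerator (S : ℝ → H →L[ℂ] H) (A : H →ₗ.[ℂ] H) : Prop :=
  ∀ x y : H, (x, y) ∈ A.graph ↔
    Tendsto (fun t : ℝ => ((t : ℂ)⁻¹) • (S t x - x)) (𝓝[>] 0) (𝓝 y)

theorem mem_graph_iff_exists {A : H →ₗ.[ℂ] H} {x y : H} :
    (x, y) ∈ A.graph ↔ ∃ h : x ∈ A.domain, A ⟨x, h⟩ = y := by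
  rw [LinearPMap.mem_graph_iff]
  constructor
  · rintro ⟨u, rfl, rfl⟩
    exact ⟨u.2, rfl⟩
  · rintro ⟨h, rfl⟩
    exact ⟨⟨x, h⟩, rfl, rfl⟩

theorem IsMDissipative.re_inner_nonpos {A : H →ₗ.[ℂ] H} (hA : IsMDissipative A) {x y : H}
    (h : (x, y) ∈ A.graph) : (inner ℂ x y).re ≤ 0 := by
  obtain ⟨u, rfl, rfl⟩ := (LinearPMap.mem_graph_iff A).1 h
  exact hA.1 u

theorem IsMDissipative.exists_graph {A : H →ₗ.[ℂ] H} (hA : IsMDissipative A) (f : H) :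
    ∃ u, (u, u - f) ∈ A.graph := by
  obtain ⟨u, hu⟩ := hA.2 1 one_pos f
  refine ⟨u, (LinearPMap.mem_graph_iff A).2 ⟨u, rfl, ?_⟩⟩
  rw [← hu]; simp

theorem IsMDissipative.norm_le_of_graph {A : H →ₗ.[ℂ] H} (hA : IsMDissipative A) {u f : H}
    (h : (u, u - f) ∈ A.graph) : ‖u‖ ≤ ‖f‖ := by
  have h1 := hA.re_inner_nonpos h
  rw [inner_sub_right, Complex.sub_re] at h1
  have h2 : (inner ℂ u u).re = ‖u‖ ^ 2 := by simpa using (inner_self_eq_norm_sq (𝕜 := ℂ) u)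
  have h3 : (inner ℂ u f).re ≤ ‖u‖ * ‖f‖ :=
    (Complex.re_le_norm _).trans (norm_inner_le_norm _ _)
  rcases (norm_nonneg u).eq_or_lt with h0 | h0
  · rw [← h0]; exact norm_nonneg f
  · exact le_of_mul_le_mul_left (by nlinarith) h0

/-- The resolvent `(I - A)⁻¹` of an m-dissipative operator. -/
theorem IsMDissipative.exists_resolvent {A : H →ₗ.[ℂ] H} (hA : IsMDissipative A) :
    ∃ R : H →L[ℂ] H, (∀ f, (R f, R f - f) ∈ A.graph) ∧
      ∀ u v, (u, v) ∈ A.graph → R (u - v) = u := by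
  choose r hr using hA.exists_graph
  have huniq : ∀ u f, (u, u - f) ∈ A.graph → r f = u := fun u f h => by
    have h1 := A.graph.sub_mem (hr f) h
    have h2 : (r f - u, (r f - u) - 0) ∈ A.graph := by
      convert h1 using 1
      ext <;> simp
    have := hA.norm_le_of_graph h2
    rw [norm_zero, norm_le_zero_iff, sub_eq_zero] at this
    exact this
  let L : H →ₗ[ℂ] H :=
    { toFun := r
      map_add' := fun f g => huniq _ _ (by
        convert A.graph.add_mem (hr f) (hr g) using 1
        ext <;> simp; abel)
      map_smul' := fun c f => huniq _ _ (by
        convert A.graph.smul_mem c (hr f) using 1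
        ext <;> simp [smul_sub]) }
  refine ⟨L.mkContinuous 1 fun f => ?_, fun f => hr f, fun u v h => ?_⟩
  · rw [one_mul]
    exact hA.norm_le_of_graph (hr f)
  · exact huniq u (u - v) (by simpa using h)

/-- If `y` is orthogonal to the domain and `u` solves `u - Au = y`, dissipativity at `u` reads `‖u‖²
≤ 0`; so `u = 0` and then `y = 0`. -/
theorem IsMDissipative.dense_domain [CompleteSpace H] {A : H →ₗ.[ℂ] H} (hA : IsMDissipative A) :
    Dense (A.domain : Set H) := by
  rw [Submodule.dense_iff_topologicalClosure_eq_top, Submodule.topologicalClosure_eq_top_iff,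
    Submodule.eq_bot_iff]
  intro y hy
  obtain ⟨u, hu⟩ := hA.exists_graph y
  obtain ⟨hu', -⟩ := mem_graph_iff_exists.1 hu
  have h0 : inner ℂ u y = 0 := (Submodule.mem_orthogonal _ _).1 hy u hu'
  have h1 := hA.re_inner_nonpos hu
  rw [inner_sub_right, h0, sub_zero] at h1
  have h2 : (inner ℂ u u).re = ‖u‖ ^ 2 := by simpa using (inner_self_eq_norm_sq (𝕜 := ℂ) u)
  have h3 : u = 0 := by
    rw [← norm_eq_zero]; nlinarith [norm_nonneg u]
  rw [h3] at hu
  obtain ⟨v, hv, hv'⟩ := (LinearPMap.mem_graph_iff A).1 hu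
  have : v = 0 := Subtype.ext hv
  rw [this, LinearPMap.map_zero] at hv'
  simpa using hv'.symm

/-- Two resolvents commute as soon as the operators do. -/
theorem resolvent_comm {A B : H →ₗ.[ℂ] H} (hAB : A.domain ≤ B.domain)
    (hc : opProd A B = opProd B A) {RA RB : H →L[ℂ] H}
    (hRA : ∀ f, (RA f, RA f - f) ∈ A.graph) (hRA' : ∀ u v, (u, v) ∈ A.graph → RA (u - v) = u)
    (hRB : ∀ f, (RB f, RB f - f) ∈ B.graph) (hRB' : ∀ u v, (u, v) ∈ B.graph → RB (u - v) = u)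
    (x : H) : RB (RA x) = RA (RB x) := by
  set y := RA (RB x) with hy
  have h1 : (y, y - RB x) ∈ A.graph := hRA (RB x)
  obtain ⟨hyA, hAy'⟩ := mem_graph_iff_exists.1 h1
  obtain ⟨hxB, hBz⟩ := mem_graph_iff_exists.1 (hRB x)
  have hyB : y ∈ B.domain := hAB hyA
  -- The inclusion of the domains enters here: `A y = y - RB x` is a difference of elements of
  -- `D(B)`, so `y` lies in `D(BA)`, hence in `D(AB)`.
  have hyp : y ∈ (opProd B A).domain := ⟨hyA, by rw [hAy']; exact B.domain.sub_mem hyB hxB⟩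
  have hyp' : y ∈ (opProd A B).domain := by rw [hc]; exact hyp
  obtain ⟨hb, hBy⟩ := id hyp'
  have e : A ⟨B ⟨y, hyB⟩, hBy⟩ = B ⟨A ⟨y, hyA⟩, hyp.2⟩ := by
    have h2 := (LinearPMap.ext_iff.1 hc).2
    exact h2 (x := y) (hf := hyp') (hg := hyp)
  have hBsub : B ⟨A ⟨y, hyA⟩, hyp.2⟩ = B ⟨y, hyB⟩ - (RB x - x) := by
    rw [← hBz, ← LinearPMap.map_sub]
    congr 1
    ext
    simp [hAy']
  have g1 : (y, y - RB x) ∈ A.graph := h1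
  have g2 : (B ⟨y, hyB⟩, B ⟨y, hyB⟩ - (RB x - x)) ∈ A.graph :=
    (LinearPMap.mem_graph_iff A).2 ⟨⟨_, hBy⟩, rfl, by rw [e, hBsub]⟩
  -- Subtracting the two graph relations gives `(I - A)(y - By) = x`, so that `RA x = (I - B)y`, and
  -- applying `RB` returns `y`.
  have g3 := hRA' _ _ (A.graph.sub_mem g1 g2)
  have g4 : RA x = y - B ⟨y, hyB⟩ := by
    rw [← g3]; congr 1
    simp only
    abel
  rw [g4]
  exact hRB' _ _ ((LinearPMap.mem_graph_iff B).2 ⟨⟨y, hyB⟩, rfl, rfl⟩)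

/-- The right derivative of `‖z‖²` is `2 Re ⟨z, z'⟩ ≤ 0`. One-sided derivatives suffice, which is
all that a generator provides directly. It serves both for contractivity and, with `z 0 = 0`, for
uniqueness. -/
theorem norm_le_of_dissipative_right_deriv {z z' : ℝ → H} {T : ℝ} (hT : 0 ≤ T)
    (hc : ContinuousOn z (Icc 0 T))
    (hd : ∀ t ∈ Ico 0 T, HasDerivWithinAt z (z' t) (Ici t) t)
    (hn : ∀ t ∈ Ico 0 T, (inner ℂ (z t) (z' t)).re ≤ 0) : ‖z T‖ ≤ ‖z 0‖ := by
  have h := image_le_of_deriv_right_le_deriv_boundary (f := fun t => ‖z t‖ ^ 2)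
    (f' := fun t => 2 * (inner ℂ (z t) (z' t)).re) (a := 0) (b := T)
    (B := fun _ => ‖z 0‖ ^ 2) (B' := fun _ => 0) (by fun_prop)
    (fun t ht => by
      let _ := InnerProductSpace.complexToReal (G := H)
      exact HasDerivWithinAt.norm_sq (F := H) (hd t ht)) le_rfl continuousOn_const (fun t _ => hasDerivWithinAt_const _ _ _)
    (fun t ht => by have := hn t ht; linarith) (right_mem_Icc.2 hT)
  exact le_of_sq_le_sq (h) (norm_nonneg _)

theorem hasDerivWithinAt_Ici_of_tendsto {f : ℝ → H} {t : ℝ} {y : H}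
    (h : Tendsto (fun h : ℝ => ((h : ℂ)⁻¹) • (f (t + h) - f t)) (𝓝[>] 0) (𝓝 y)) :
    HasDerivWithinAt f y (Ici t) t := by
  rw [← hasDerivWithinAt_Ioi_iff_Ici, hasDerivWithinAt_iff_tendsto_slope' self_notMem_Ioi]
  have h1 : Tendsto (fun s => s - t) (𝓝[>] t) (𝓝[>] 0) := by
    refine tendsto_nhdsWithin_iff.2 ⟨?_, ?_⟩
    · have : Continuous fun s : ℝ => s - t := by fun_prop
      simpa using (this.tendsto t).mono_left nhdsWithin_le_nhds
    · filter_upwards [self_mem_nhdsWithin] with s hs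
      exact sub_pos.2 (mem_Ioi.1 hs)
  refine (h.comp h1).congr fun s => ?_
  simp only [Function.comp_def, slope, vsub_eq_sub, add_sub_cancel]
  rw [← Complex.ofReal_inv, Complex.coe_smul]

section

variable {S : ℝ → H →L[ℂ] H} {A : H →ₗ.[ℂ] H}

theorem IsGenerator.tendsto_slope (hS : ∀ s t : ℝ, 0 ≤ s → 0 ≤ t → S (s + t) = (S s).comp (S t))
    (hA : IsGenerator S A) {x y : H} (h : (x, y) ∈ A.graph) {t : ℝ} (ht : 0 ≤ t) :
    Tendsto (fun h : ℝ => ((h : ℂ)⁻¹) • (S (t + h) x - S t x)) (𝓝[>] 0) (𝓝 (S t y)) := by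
  refine (((S t).continuous.tendsto y).comp ((hA x y).1 h)).congr' ?_
  filter_upwards [self_mem_nhdsWithin] with h hh
  rw [hS t h ht (le_of_lt hh)]
  simp

theorem IsGenerator.map_graph (hS : ∀ s t : ℝ, 0 ≤ s → 0 ≤ t → S (s + t) = (S s).comp (S t))
    (hA : IsGenerator S A) {x y : H} (h : (x, y) ∈ A.graph) {t : ℝ} (ht : 0 ≤ t) :
    (S t x, S t y) ∈ A.graph := by
  refine (hA _ _).2 ((hA.tendsto_slope hS h ht).congr' ?_)
  filter_upwards [self_mem_nhdsWithin] with h hh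
  rw [add_comm, hS h t (le_of_lt hh) ht]
  simp

theorem IsGenerator.hasDerivWithinAt
    (hS : ∀ s t : ℝ, 0 ≤ s → 0 ≤ t → S (s + t) = (S s).comp (S t))
    (hA : IsGenerator S A) {x y : H} (h : (x, y) ∈ A.graph) {t : ℝ} (ht : 0 ≤ t) :
    HasDerivWithinAt (fun t => S t x) (S t y) (Ici t) t :=
  hasDerivWithinAt_Ici_of_tendsto (hA.tendsto_slope hS h ht)

/-- Contractivity is not yet known here, and its proof needs continuity of the orbits; the energy
bound supplies the uniform boundedness in the meantime. -/
theorem IsC0Semigroup.continuousOn (hS : IsC0Semigroup S) {K : ℝ}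
    (hK : ∀ t, 0 ≤ t → ∀ x, ‖S t x‖ ≤ K * ‖x‖) (x : H) :
    ContinuousOn (fun t => S t x) (Ici 0) := by
  intro t₀ ht₀
  rw [ContinuousWithinAt, tendsto_iff_norm_sub_tendsto_zero]
  have hb : ∀ t ∈ Ici (0 : ℝ), ‖S t x - S t₀ x‖ ≤ K * ‖S |t - t₀| x - x‖ := by
    intro t ht
    wlog h : t₀ ≤ t generalizing t t₀
    · rw [norm_sub_rev, abs_sub_comm]
      exact this t ht t₀ ht₀ (le_of_not_ge h)
    rw [abs_of_nonneg (sub_nonneg.2 h)]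
    have : S t x = S t₀ (S (t - t₀) x) := by
      rw [← ContinuousLinearMap.comp_apply, ← hS.map_add _ _ ht₀ (sub_nonneg.2 h)]
      congr 2; ring
    rw [this, ← map_sub]
    exact hK _ ht₀ _
  have h0 : Tendsto (fun t => S |t| x) (𝓝 0) (𝓝 x) := by
    have h1 : Tendsto (fun t => S t x) (𝓝[≥] 0) (𝓝 x) := by
      have : Tendsto (fun t => S t x) (pure 0) (𝓝 x) := by
        rw [tendsto_pure_left]
        intro s hs
        rw [hS.map_zero]; exact mem_of_mem_nhds hs
      have h2 := this.sup (hS.tendsto_zero x)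
      rwa [← nhdsWithin_singleton, ← nhdsWithin_union, singleton_union, Ioi_insert] at h2
    refine h1.comp (tendsto_nhdsWithin_iff.2 ⟨?_, Eventually.of_forall fun t => abs_nonneg t⟩)
    simpa using (continuous_abs.tendsto (0 : ℝ))
  have h1 : Tendsto (fun t : ℝ => t - t₀) (𝓝[Ici 0] t₀) (𝓝 0) := by
    have : Continuous fun s : ℝ => s - t₀ := by fun_prop
    simpa using (this.tendsto t₀).mono_left nhdsWithin_le_nhds
  refine squeeze_zero' (Eventually.of_forall fun _ => norm_nonneg _)
    (eventually_mem_nhdsWithin.mono hb) ?_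
  have := (((h0.comp h1).sub_const x).norm).const_mul K
  simpa [Function.comp_def] using this

/-- The semigroup generated by an m-dissipative operator is contractive. -/
theorem IsMDissipative.norm_semigroup_le [CompleteSpace H] (hA : IsMDissipative A)
    (hS : IsSemigroupGeneratedBy S A) {K : ℝ} (hK : ∀ t, 0 ≤ t → ∀ x, ‖S t x‖ ≤ K * ‖x‖)
    {t : ℝ} (ht : 0 ≤ t) (x : H) : ‖S t x‖ ≤ ‖x‖ := by
  have hgen : IsGenerator S A := hS.2
  have h1 : ∀ x ∈ A.domain, ‖S t x‖ ≤ ‖x‖ := by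
    intro x hx
    have hg : (x, A ⟨x, hx⟩) ∈ A.graph := mem_graph_iff_exists.2 ⟨hx, rfl⟩
    have := norm_le_of_dissipative_right_deriv (z := fun t => S t x) ht
      ((hS.1.continuousOn hK x).mono Icc_subset_Ici_self)
      (fun s hs => hgen.hasDerivWithinAt hS.1.map_add hg hs.1)
      (fun s hs => hA.re_inner_nonpos (hgen.map_graph hS.1.map_add hg hs.1))
    simpa [hS.1.map_zero] using this
  refine hA.dense_domain.induction (P := fun x => ‖S t x‖ ≤ ‖x‖) h1 ?_ x
  exact isClosed_le (by fun_prop) (by fun_prop)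

theorem IsMDissipative.isContractionSemigroup [CompleteSpace H] (hA : IsMDissipative A)
    (hS : IsSemigroupGeneratedBy S A) {K : ℝ} (hK : ∀ t, 0 ≤ t → ∀ x, ‖S t x‖ ≤ K * ‖x‖) :
    IsContractionSemigroup (fun t => S (max t 0)) ∧ IsGenerator (fun t => S (max t 0)) A := by
  refine ⟨⟨fun t ht => ?_, fun s t hs ht => ?_, fun t x => ?_, fun x => ?_⟩, fun x y => ?_⟩
  · rw [max_eq_right ht, hS.1.map_zero]
  · rw [max_eq_left hs, max_eq_left ht, max_eq_left (add_nonneg hs ht), hS.1.map_add s t hs ht]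
  · exact hA.norm_semigroup_le hS hK (le_max_right _ _) x
  · refine (hS.1.tendsto_zero x).congr' ?_
    filter_upwards [self_mem_nhdsWithin] with t ht
    rw [max_eq_left (le_of_lt ht)]
  · rw [hS.2 x y]
    refine tendsto_congr' ?_
    filter_upwards [self_mem_nhdsWithin] with t ht
    rw [max_eq_left (le_of_lt ht)]

end

/-- Commuting resolvents make `RA` map the graph of `B` into itself. For `x` in `D(B)` the
difference of the two sides then solves `z' = Bz` with `z(0) = 0`, and dissipativity forces it to
vanish; density extends this to all `x`. -/
theorem IsGenerator.semigroup_comm_resolvent [CompleteSpace H] {SB : ℝ → H →L[ℂ] H}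
    {B : H →ₗ.[ℂ] H} (hB : IsMDissipative B) (hSB : IsContractionSemigroup SB)
    (hgB : IsGenerator SB B) {RA RB : H →L[ℂ] H}
    (hRB : ∀ f, (RB f, RB f - f) ∈ B.graph) (hRB' : ∀ u v, (u, v) ∈ B.graph → RB (u - v) = u)
    (hcomm : ∀ x, RB (RA x) = RA (RB x)) {t : ℝ} (ht : 0 ≤ t) (x : H) :
    SB t (RA x) = RA (SB t x) := by
  have hgr : ∀ x y, (x, y) ∈ B.graph → (RA x, RA y) ∈ B.graph := fun x y h => by
    have h1 := hRB (RA (x - y))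
    rw [hcomm, hRB' x y h, map_sub, sub_sub_cancel] at h1
    exact h1
  have h1 : ∀ x ∈ B.domain, SB t (RA x) = RA (SB t x) := by
    intro x hx
    have hg : (x, B ⟨x, hx⟩) ∈ B.graph := mem_graph_iff_exists.2 ⟨hx, rfl⟩
    set y := B ⟨x, hx⟩
    have hz := norm_le_of_dissipative_right_deriv (z := fun t => SB t (RA x) - RA (SB t x))
      (z' := fun t => SB t (RA y) - RA (SB t y)) ht
      (by
        have h1 := hSB.continuous_apply (RA x)
        have h2 := hSB.continuous_apply x
        fun_prop)
      (fun s hs => by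
        refine (hgB.hasDerivWithinAt hSB.map_add (hgr _ _ hg) hs.1).sub ?_
        exact ((RA.restrictScalars ℝ).hasFDerivAt.comp_hasDerivWithinAt s
          (hgB.hasDerivWithinAt hSB.map_add hg hs.1)))
      (fun s hs => by
        refine hB.re_inner_nonpos (B.graph.sub_mem (x := (_, _)) (y := (_, _)) ?_ ?_)
        · exact hgB.map_graph hSB.map_add (hgr _ _ hg) hs.1
        · exact hgr _ _ (hgB.map_graph hSB.map_add hg hs.1))
    simpa [hSB.map_nonpos 0 le_rfl, sub_eq_zero] using hz
  refine hB.dense_domain.induction (P := fun x => SB t (RA x) = RA (SB t x)) h1 ?_ x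
  exact isClosed_eq (by fun_prop) (by fun_prop)

/-- Duhamel's formula for the difference of two commuting semigroups. -/
theorem sub_eq_integral_of_comm [CompleteSpace H] {SA SB : ℝ → H →L[ℂ] H} {A B : H →ₗ.[ℂ] H}
    (hA : IsMDissipative A) (hB : IsMDissipative B)
    (hAB : A.domain ≤ B.domain) (hc : opProd A B = opProd B A)
    (hSA : IsContractionSemigroup SA) (hSB : IsContractionSemigroup SB)
    (hgA : IsGenerator SA A) (hgB : IsGenerator SB B) {x a b : H}
    (ha : (x, a) ∈ A.graph) (hb : (x, b) ∈ B.graph) {t : ℝ} (ht : 0 ≤ t) :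
    SA t x - SB t x = ∫ s in (0)..t, SA (t - s) (SB s (a - b)) := by
  obtain ⟨RA, hRA, hRA'⟩ := hA.exists_resolvent
  obtain ⟨RB, hRB, hRB'⟩ := hB.exists_resolvent
  have hcomm : ∀ {s : ℝ}, 0 ≤ s → ∀ y, SB s (RA y) = RA (SB s y) := hgB.semigroup_comm_resolvent hB hSB hRB hRB'
    (resolvent_comm hAB hc hRA hRA' hRB hRB')
  -- Since `x = RA (x - a)` and `SB` commutes with `RA`, the orbit `SB s x` stays in `D(A)`, with `A
  -- SB s x = SB s a`.
  have hgr : ∀ s, 0 ≤ s → (SB s x, SB s a) ∈ A.graph := fun s hs => by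
    have h1 := hRA (SB s (x - a))
    rw [← hcomm hs, hRA' x a ha, map_sub, sub_sub_cancel] at h1
    exact h1
  have hcont : ∀ y, Continuous fun s => SA (t - s) (SB s y) := fun y =>
    hSA.continuous_uncurry.comp
      ((continuous_const.sub continuous_id).prodMk (hSB.continuous_apply y))
  have h := intervalIntegral.integral_eq_sub_of_hasDeriv_right_of_le (a := 0) (b := t)
    (f := fun s => SA (t - s) (SB s x)) (f' := fun s => SA (t - s) (SB s (b - a))) ht
    (hcont x).continuousOn (fun s hs => by
      refine (hasDerivWithinAt_Ici_of_tendsto ?_).mono Ioi_subset_Ici_self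
      -- With `SA (t - (s + h))` factored out, the difference quotient of the curve is this
      -- difference of two quotients, one for each generator at `SB s x`; joint continuity of `SA`
      -- then passes to the limit.
      have h1 : Tendsto (fun h : ℝ => ((h : ℂ)⁻¹) • (SB (s + h) x - SB s x) -
          ((h : ℂ)⁻¹) • (SA h (SB s x) - SB s x)) (𝓝[>] 0) (𝓝 (SB s (b - a))) := by
        rw [map_sub]
        exact (hgB.tendsto_slope hSB.map_add hb hs.1.le).sub ((hgA _ _).1 (hgr s hs.1.le))
      have h2 : Tendsto (fun h : ℝ => t - (s + h)) (𝓝[>] 0) (𝓝 (t - s)) := by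
        have : Continuous fun h : ℝ => t - (s + h) := by fun_prop
        simpa using (this.tendsto 0).mono_left nhdsWithin_le_nhds
      have h3 := (hSA.continuous_uncurry.tendsto (t - s, SB s (b - a))).comp
        (h2.prodMk_nhds h1)
      refine h3.congr' ?_
      have hlt : ∀ᶠ h in 𝓝[>] (0 : ℝ), h < t - s :=
        (eventually_lt_nhds (sub_pos.2 hs.2)).filter_mono nhdsWithin_le_nhds
      filter_upwards [self_mem_nhdsWithin, hlt] with h hh hh'
      have e : SA (t - s) (SB s x) = SA (t - (s + h)) (SA h (SB s x)) := by
        rw [← hSA.map_add_apply (by linarith) (le_of_lt hh)]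
        congr 2; ring
      simp only [Function.comp_def]
      rw [e, ← map_sub, ← map_smul, ← smul_sub]
      congr 2
      abel) ((hcont _).intervalIntegrable _ _)
  simp only [sub_self, sub_zero, hSA.map_nonpos 0 le_rfl, hSB.map_nonpos 0 le_rfl,
    ContinuousLinearMap.coe_id', id_eq] at h
  rw [← neg_sub, ← h, ← intervalIntegral.integral_neg]
  refine intervalIntegral.integral_congr fun s _ => ?_
  rw [← map_neg, ← map_neg, neg_sub]

end Generators

/-! ### The `L^r` norm on `L²`: semicontinuity, measurability, duality. -/

section LpFacts

variable {X : Type*} [MeasurableSpace X] {μ : Measure X}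

/-- A sequence converging in `L²` has an almost everywhere convergent subsequence, to which Fatou
applies. Hence the `L^p` norm of a measurable curve in `L²` is measurable in time, although it may
be infinite. -/
theorem lowerSemicontinuous_eLpNorm (p : ℝ≥0∞) :
    LowerSemicontinuous fun v : Lp ℂ 2 μ => eLpNorm v p μ := by
  rw [lowerSemicontinuous_iff_isClosed_preimage]
  intro c
  refine IsSeqClosed.isClosed fun v w hv hvw => ?_
  obtain ⟨φ, -, hφ⟩ := (tendstoInMeasure_of_tendsto_Lp hvw).exists_seq_tendsto_ae
  refine (Lp.eLpNorm_lim_le_liminf_eLpNorm (fun n => (Lp.aestronglyMeasurable (v (φ n)))) _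
    hφ).trans ?_
  exact liminf_le_of_le (by isBoundedDefault) fun b hb =>
    let ⟨n, hn⟩ := hb.exists
    hn.trans (hv (φ n))

theorem measurable_eLpNorm_comp {Y : Type*} [MeasurableSpace Y] {u : Y → Lp ℂ 2 μ}
    (hu : StronglyMeasurable u) (p : ℝ≥0∞) : Measurable fun s => eLpNorm (u s) p μ := by
  let _ : MeasurableSpace (Lp ℂ 2 μ) := borel _
  have : BorelSpace (Lp ℂ 2 μ) := ⟨rfl⟩
  exact (lowerSemicontinuous_eLpNorm p).measurable.comp hu.measurable

theorem eLpNorm_lp_smul (c : ℂ) (v : Lp ℂ 2 μ) (p : ℝ≥0∞) :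
    eLpNorm (c • v : Lp ℂ 2 μ) p μ = ‖c‖ₑ * eLpNorm v p μ := by
  rw [eLpNorm_congr_ae (Lp.coeFn_smul c v), eLpNorm_const_smul]

theorem eLpNorm_lp_zero (p : ℝ≥0∞) : eLpNorm (0 : Lp ℂ 2 μ) p μ = 0 := by
  rw [eLpNorm_congr_ae (Lp.coeFn_zero ℂ 2 μ), eLpNorm_zero]

theorem eLpNorm_lp_two (v : Lp ℂ 2 μ) : eLpNorm v 2 μ = ‖v‖ₑ := (Lp.enorm_def v).symm

theorem eq_zero_of_eLpNorm_eq_zero {v : Lp ℂ 2 μ} {p : ℝ≥0∞} (hp : p ≠ 0)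
    (h : eLpNorm v p μ = 0) : v = 0 := by
  rw [eLpNorm_eq_zero_iff (Lp.aestronglyMeasurable v) hp] at h
  exact (Lp.eq_zero_iff_ae_eq_zero).2 h

/-- Hölder's inequality for the `L²` pairing. -/
theorem enorm_inner_le_eLpNorm_mul (p q : ℝ≥0∞) [p.HolderConjugate q] (g v : Lp ℂ 2 μ) :
    ‖inner ℂ g v‖ₑ ≤ eLpNorm g p μ * eLpNorm v q μ := by
  rw [L2.inner_def]
  refine (enorm_integral_le_lintegral_enorm _).trans ?_
  have := eLpNorm_le_eLpNorm_mul_eLpNorm'_of_norm (p := p) (q := q) (r := 1)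
    (Lp.aestronglyMeasurable g) (Lp.aestronglyMeasurable v) (fun a b => inner ℂ a b) 1
    (Eventually.of_forall fun x => by simpa using norm_inner_le_norm (𝕜 := ℂ) (g x) (v x))
  rw [eLpNorm_one_eq_lintegral_enorm] at this
  simpa using this

theorem enorm_inner_eq_lintegral {g v : Lp ℂ 2 μ} {a : X → ℝ} (ha : ∀ x, 0 ≤ a x)
    (hg : g =ᵐ[μ] fun x => (a x : ℂ) * v x) :
    ‖inner ℂ g v‖ₑ = ∫⁻ x, ‖g x‖ₑ * ‖v x‖ₑ ∂μ := by
  have h1 : (fun x => inner ℂ (g x) (v x)) =ᵐ[μ] fun x => ((‖g x‖ * ‖v x‖ : ℝ) : ℂ) := by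
    filter_upwards [hg] with x hx
    rw [hx, RCLike.inner_apply, map_mul, Complex.conj_ofReal, norm_mul, Complex.norm_real,
      Real.norm_of_nonneg (ha x), mul_left_comm, Complex.mul_conj, Complex.normSq_eq_norm_sq]
    push_cast; ring
  have hint : Integrable (fun x => ‖g x‖ * ‖v x‖) μ := by
    have := (L2.integrable_inner (𝕜 := ℂ) g v).norm
    refine this.congr ?_
    filter_upwards [h1] with x hx
    rw [hx, Complex.norm_real, Real.norm_of_nonneg (by positivity)]
  rw [L2.inner_def, integral_congr_ae h1, integral_complex_ofReal]
  rw [← ofReal_norm, Complex.norm_real, Real.norm_of_nonneg (integral_nonneg fun x => by positivity),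
    ofReal_integral_eq_lintegral_ofReal hint (Eventually.of_forall fun x => by positivity)]
  refine lintegral_congr fun x => ?_
  rw [ENNReal.ofReal_mul (norm_nonneg _), ofReal_norm, ofReal_norm]

/-- For finite `r` the extremal function `|v|^{r-2} v` is cut to `{|v| ≤ n}`: there `r ≥ 2` makes
the factor bounded, so the product stays in `L²`, and the truncated norms increase to the full one.
For `r = ∞` the phase of `v` is taken on a superlevel set, of finite measure because `v` is square
integrable. Thus no σ-finiteness of `μ` is needed. -/
theorem exists_pairing_gt {r : ℝ≥0∞} (hr : 2 ≤ r) {v : Lp ℂ 2 μ} {c : ℝ≥0∞}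
    (hc : c < eLpNorm v r μ) : ∃ g : Lp ℂ 2 μ, eLpNorm g r.conjExponent μ ≠ ∞ ∧
      c * eLpNorm g r.conjExponent μ < ‖inner ℂ g v‖ₑ := by
  have hvm := Lp.stronglyMeasurable v
  have hr1 : 1 ≤ r := le_trans (by norm_num) hr
  have : r.HolderConjugate r.conjExponent := .conjExponent hr1
  rcases eq_or_ne r ∞ with rfl | hrtop
  · have hconj : ENNReal.conjExponent ∞ = 1 := by simp [ENNReal.conjExponent]
    rw [hconj]
    rw [eLpNorm_exponent_top] at hc
    obtain ⟨c', hcc', hc'⟩ := exists_between hc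
    set E := {x | c' < ‖v x‖ₑ} with hE
    have hEm : MeasurableSet E := measurableSet_lt measurable_const hvm.enorm
    have hE0 : μ E ≠ 0 := fun h => by
      refine not_le.2 hc' (essSup_le_of_ae_le _ ?_)
      rw [EventuallyLE, ae_iff]
      simpa [hE] using h
    have hc't : c' ≠ ∞ := hc'.ne_top
    have hc'0 : c' ≠ 0 := (pos_of_gt hcc').ne'
    have hEt : μ E ≠ ∞ := by
      have h1 := (Lp.memLp v).meas_ge_lt_top_enorm (ε := c'.toNNReal) (by norm_num) (by norm_num)
        (by simpa [ENNReal.toNNReal_eq_zero_iff] using ⟨hc'0, hc't⟩)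
      refine ((measure_mono fun x hx => ?_).trans_lt h1).ne
      rw [ENNReal.coe_toNNReal hc't]
      have hx' : c' < ‖v x‖ₑ := hx
      exact hx'.le
    have hn : ∀ x ∈ E, ‖v x‖ ≠ 0 := fun x hx h => by
      have : ‖v x‖ₑ = 0 := by simpa using h
      have hx' : c' < ‖v x‖ₑ := hx
      rw [this] at hx'
      exact not_lt_zero hx'
    set a : X → ℝ := E.indicator fun x => ‖v x‖⁻¹ with ha
    have ham : Measurable a := (hvm.norm.measurable.inv).indicator hEm
    have hav : ∀ x, ‖(a x : ℂ) * v x‖ₑ = E.indicator 1 x := fun x => by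
      by_cases hx : x ∈ E
      · rw [ha, indicator_of_mem hx, indicator_of_mem hx, ← ofReal_norm, norm_mul, Complex.norm_real,
          norm_inv, norm_norm, inv_mul_cancel₀ (hn x hx)]
        simp
      · simp [ha, indicator_of_notMem hx]
    have hmem : MemLp (fun x => (a x : ℂ) * v x) 2 μ := by
      have h1 : MemLp (E.indicator fun _ => (1 : ℝ)) 2 μ := memLp_indicator_const 2 hEm 1 (Or.inr hEt)
      refine h1.of_le ((Complex.measurable_ofReal.comp ham).mul
        hvm.measurable).aestronglyMeasurable (Eventually.of_forall fun x => ?_)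
      have h2 := hav x
      rw [← enorm_le_iff_norm_le, h2]
      by_cases hx : x ∈ E <;> simp [hx]
    refine ⟨hmem.toLp, ?_, ?_⟩
    · rw [eLpNorm_congr_ae hmem.coeFn_toLp, eLpNorm_one_eq_lintegral_enorm]
      simp_rw [hav]
      rw [lintegral_indicator_one hEm]
      exact hEt
    · rw [enorm_inner_eq_lintegral (a := a)
        (fun x => indicator_nonneg (fun x _ => inv_nonneg.2 (norm_nonneg _)) x) hmem.coeFn_toLp]
      rw [eLpNorm_congr_ae hmem.coeFn_toLp, eLpNorm_one_eq_lintegral_enorm]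
      have e1 : ∫⁻ x, ‖(hmem.toLp) x‖ₑ * ‖v x‖ₑ ∂μ = ∫⁻ x in E, ‖v x‖ₑ ∂μ := by
        rw [← lintegral_indicator hEm]
        refine lintegral_congr_ae ?_
        filter_upwards [hmem.coeFn_toLp] with x hx
        rw [hx, hav]
        by_cases hx : x ∈ E <;> simp [hx]
      rw [e1]
      simp_rw [hav]
      rw [lintegral_indicator_one hEm]
      calc c * μ E < c' * μ E := ENNReal.mul_lt_mul_left hE0 hEt hcc'
        _ = ∫⁻ x in E, c' ∂μ := by simp
        _ ≤ _ := setLIntegral_mono' hEm fun x hx => le_of_lt hx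
  · set ρ := r.toReal with hρ
    have hρ2 : 2 ≤ ρ := by simpa using (ENNReal.toReal_le_toReal (by norm_num) hrtop).2 hr
    set p := r.conjExponent with hp
    have hρ1 : 1 < ρ := by linarith
    have hpr : ρ.HolderConjugate p.toReal := ENNReal.HolderConjugate.toReal (p := r) (q := p) hρ1
    have hp0 : 0 < p.toReal := hpr.symm.pos
    have hρ0 : 0 < ρ := by linarith
    have hptop : p ≠ ∞ := (ENNReal.toReal_pos_iff.1 hp0).2.ne
    have hpne : p ≠ 0 := (ENNReal.toReal_pos_iff.1 hp0).1.ne'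
    have hrne : r ≠ 0 := (ENNReal.toReal_pos_iff.1 hρ0).1.ne'
    set E : ℕ → Set X := fun n => {x | ‖v x‖ ≤ n} with hE
    have hEm : ∀ n, MeasurableSet (E n) := fun n =>
      measurableSet_le hvm.norm.measurable measurable_const
    have hEmono : Monotone E := fun m n hmn x (hx : ‖v x‖ ≤ m) =>
      show ‖v x‖ ≤ n from hx.trans (by exact_mod_cast hmn)
    have hEU : ⋃ n, E n = univ := eq_univ_of_forall fun x => mem_iUnion.2 (exists_nat_ge ‖v x‖)
    set a : ℕ → X → ℝ := fun n => (E n).indicator fun x => ‖v x‖ ^ (ρ - 2) with ha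
    have ha0 : ∀ n x, 0 ≤ a n x := fun n x => indicator_nonneg (fun x _ => by positivity) x
    have ham : ∀ n, Measurable (a n) := fun n =>
      (hvm.norm.measurable.pow_const _).indicator (hEm n)
    have hmem : ∀ n, MemLp (fun x => (a n x : ℂ) * v x) 2 μ := fun n => by
      refine (Lp.memLp v).of_le_mul (c := (n : ℝ) ^ (ρ - 2))
        ((Complex.measurable_ofReal.comp (ham n)).mul hvm.measurable).aestronglyMeasurable
        (Eventually.of_forall fun x => ?_)
      rw [norm_mul, Complex.norm_real, Real.norm_of_nonneg (ha0 n x)]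
      gcongr
      by_cases hx : x ∈ E n
      · simp only [ha, indicator_of_mem hx]
        exact Real.rpow_le_rpow (norm_nonneg _) hx (by linarith)
      · simp only [ha, indicator_of_notMem hx]; positivity
    have hav : ∀ n x, ‖(a n x : ℂ) * v x‖ₑ = (E n).indicator (fun x => ‖v x‖ₑ ^ (ρ - 1)) x := by
      intro n x
      by_cases hx : x ∈ E n
      · simp only [ha, indicator_of_mem hx]
        rw [← ofReal_norm, norm_mul, Complex.norm_real,
          Real.norm_of_nonneg (by positivity), ← ofReal_norm,
          ENNReal.ofReal_rpow_of_nonneg (norm_nonneg _) (by linarith)]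
        congr 1
        rcases (norm_nonneg (v x)).eq_or_lt with h0 | h0
        · rw [← h0, mul_zero, Real.zero_rpow (by linarith)]
        · nth_rewrite 2 [← Real.rpow_one ‖v x‖]
          rw [← Real.rpow_add h0]; congr 1; ring
      · simp [ha, indicator_of_notMem hx]
    set J : ℕ → ℝ≥0∞ := fun n => ∫⁻ x in E n, ‖v x‖ₑ ^ ρ ∂μ with hJ
    have hJtop : ∀ n, J n ≠ ∞ := fun n => by
      have h1 : J n ≤ ∫⁻ x, ENNReal.ofReal ((n : ℝ) ^ (ρ - 2)) * ‖v x‖ₑ ^ (2 : ℝ) ∂μ := by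
        rw [hJ]
        dsimp only
        refine (setLIntegral_mono' (hEm n) fun x hx => ?_).trans (setLIntegral_le_lintegral (E n) _)
        have e : ‖v x‖ₑ ^ ρ = ‖v x‖ₑ ^ (ρ - 2) * ‖v x‖ₑ ^ (2 : ℝ) := by
          rw [← ENNReal.rpow_add_of_nonneg _ _ (by linarith) (by norm_num)]; congr 1; ring
        rw [e]
        gcongr
        rw [← ofReal_norm, ENNReal.ofReal_rpow_of_nonneg (norm_nonneg _) (by linarith)]
        exact ENNReal.ofReal_le_ofReal (Real.rpow_le_rpow (norm_nonneg _) hx (by linarith))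
      refine (h1.trans_lt ?_).ne
      rw [lintegral_const_mul' _ _ ENNReal.ofReal_ne_top]
      refine ENNReal.mul_lt_top ENNReal.ofReal_lt_top ?_
      have := lintegral_rpow_enorm_lt_top_of_eLpNorm_lt_top (p := 2) (by norm_num) (by norm_num)
        (Lp.memLp v).2
      simpa using this
    have hJlim : Tendsto (fun n => J n ^ (1 / ρ)) atTop (𝓝 (eLpNorm v r μ)) := by
      rw [eLpNorm_eq_lintegral_rpow_enorm_toReal hrne hrtop]
      refine (ENNReal.continuous_rpow_const.tendsto _).comp ?_
      have h1 : ∫⁻ x, ‖v x‖ₑ ^ ρ ∂μ = ⨆ n, J n := by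
        rw [← setLIntegral_univ, ← hEU, setLIntegral_iUnion_of_directed _ hEmono.directed_le]
      rw [← hρ, h1]
      exact tendsto_atTop_iSup fun m n hmn => lintegral_mono_set (hEmono hmn)
    obtain ⟨n, hn⟩ := (hJlim.eventually (lt_mem_nhds hc)).exists
    have hN : eLpNorm (hmem n).toLp p μ = J n ^ (1 / p.toReal) := by
      rw [eLpNorm_congr_ae (hmem n).coeFn_toLp, eLpNorm_eq_lintegral_rpow_enorm_toReal hpne hptop]
      congr 1
      rw [hJ]
      dsimp only
      rw [← lintegral_indicator (hEm n)]
      refine lintegral_congr fun x => ?_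
      rw [hav]
      by_cases hx : x ∈ E n
      · rw [indicator_of_mem hx, indicator_of_mem hx, ← ENNReal.rpow_mul, hpr.sub_one_mul_conj]
      · rw [indicator_of_notMem hx, indicator_of_notMem hx, ENNReal.zero_rpow_of_pos hp0]
    have hI : ‖inner ℂ (hmem n).toLp v‖ₑ = J n := by
      rw [enorm_inner_eq_lintegral (ha0 n) (hmem n).coeFn_toLp, hJ]
      dsimp only
      rw [← lintegral_indicator (hEm n)]
      refine lintegral_congr_ae ?_
      filter_upwards [(hmem n).coeFn_toLp] with x hx
      rw [hx, hav]
      by_cases hx : x ∈ E n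
      · rw [indicator_of_mem hx, indicator_of_mem hx]
        nth_rewrite 2 [← ENNReal.rpow_one ‖v x‖ₑ]
        rw [← ENNReal.rpow_add_of_nonneg _ _ (by linarith) zero_le_one]
        congr 1; ring
      · rw [indicator_of_notMem hx, indicator_of_notMem hx, zero_mul]
    have hJ0 : J n ≠ 0 := fun h => by
      rw [h, ENNReal.zero_rpow_of_pos (by positivity)] at hn
      exact not_lt_zero hn
    refine ⟨(hmem n).toLp, ?_, ?_⟩
    · rw [hN]
      exact ENNReal.rpow_ne_top_of_nonneg (by positivity) (hJtop n)
    · rw [hN, hI]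
      have e : J n = J n ^ (1 / ρ) * J n ^ (1 / p.toReal) := by
        rw [← ENNReal.rpow_add _ _ hJ0 (hJtop n), one_div, one_div, hpr.inv_add_inv_eq_one,
          ENNReal.rpow_one]
      nth_rewrite 2 [e]
      refine ENNReal.mul_lt_mul_left ?_ ?_ hn
      · exact (ENNReal.rpow_pos (pos_iff_ne_zero.2 hJ0) (hJtop n)).ne'
      · exact ENNReal.rpow_ne_top_of_nonneg (by positivity) (hJtop n)

theorem exists_normalized_pairing_gt {r : ℝ≥0∞} (hr : 2 ≤ r) {v : Lp ℂ 2 μ} {c : ℝ≥0∞}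
    (hc : c < eLpNorm v r μ) : ∃ g : Lp ℂ 2 μ, eLpNorm g r.conjExponent μ ≤ 1 ∧
      c < ‖inner ℂ g v‖ₑ := by
  obtain ⟨g, hg, hgv⟩ := exists_pairing_gt hr hc
  have : r.HolderConjugate r.conjExponent := .conjExponent (le_trans (by norm_num) hr)
  set a := eLpNorm g r.conjExponent μ with ha
  have hne : r.conjExponent ≠ 0 := by simp [ENNReal.conjExponent]
  have ha0 : a ≠ 0 := fun h => by
    have := eq_zero_of_eLpNorm_eq_zero hne h
    rw [this] at hgv
    simp at hgv
  have e : ‖((a.toReal⁻¹ : ℝ) : ℂ)‖ₑ = a⁻¹ := by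
    rw [← ofReal_norm, Complex.norm_real, Real.norm_of_nonneg (by positivity),
      ENNReal.ofReal_inv_of_pos (ENNReal.toReal_pos ha0 hg), ENNReal.ofReal_toReal hg]
  refine ⟨((a.toReal⁻¹ : ℝ) : ℂ) • g, ?_, ?_⟩
  · rw [eLpNorm_lp_smul, e, ← ha, ENNReal.inv_mul_cancel ha0 hg]
  · rw [inner_smul_left, enorm_mul, RCLike.enorm_conj, e, mul_comm, ← div_eq_mul_inv]
    exact (ENNReal.lt_div_iff_mul_lt (Or.inl ha0) (Or.inl hg)).2 hgv

/-- For functions with values in a separable subset of `L²`, the `L^r` norm is a supremum of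
countably many pairings. -/
theorem exists_countable_norming {r : ℝ≥0∞} (hr : 2 ≤ r) {u : ℝ → Lp ℂ 2 μ}
    (hu : StronglyMeasurable u) : ∃ g : ℕ → Lp ℂ 2 μ,
      (∀ i, eLpNorm (g i) r.conjExponent μ ≤ 1) ∧
        ∀ s, eLpNorm (u s) r μ = ⨆ i, ‖inner ℂ (g i) (u s)‖ₑ := by
  have hrc : r.HolderConjugate r.conjExponent := .conjExponent (le_trans (by norm_num) hr)
  have hsep := hu.isSeparable_range
  have : TopologicalSpace.SeparableSpace (range u) := hsep.separableSpace
  have : SecondCountableTopology (range u) := UniformSpace.secondCountable_of_separable _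
  -- Lindelöf: the open regions below the pairings cover the region below the norm, over the
  -- separable range of `u`, and countably many of them already do. Separability of `L²` is not
  -- needed.
  let U : {g : Lp ℂ 2 μ // eLpNorm g r.conjExponent μ ≤ 1} → Set (range u × ℝ≥0∞) :=
    fun g => {x | x.2 < ‖inner ℂ g.1 x.1.1‖ₑ}
  have hU : ∀ g, IsOpen (U g) := fun g => isOpen_lt continuous_snd (by fun_prop)
  obtain ⟨T, hT, hTU⟩ := TopologicalSpace.isOpen_iUnion_countable U hU
  let g0 : {g : Lp ℂ 2 μ // eLpNorm g r.conjExponent μ ≤ 1} := ⟨0, by rw [eLpNorm_lp_zero]; exact zero_le⟩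
  obtain ⟨g, hg⟩ := (hT.insert g0).exists_eq_range (insert_nonempty _ _)
  refine ⟨fun i => g i, fun i => (g i).2, fun s => le_antisymm ?_ (iSup_le fun i => ?_)⟩
  · refine le_of_forall_lt fun c hc => ?_
    obtain ⟨h, hh1, hh2⟩ := exists_normalized_pairing_gt hr hc
    have hmem : ((⟨u s, mem_range_self s⟩, c) : range u × ℝ≥0∞) ∈ ⋃ i ∈ T, U i := by
      rw [hTU]
      exact mem_iUnion.2 ⟨⟨h, hh1⟩, hh2⟩
    obtain ⟨k, hkT, hk⟩ := mem_iUnion₂.1 hmem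
    have : k ∈ range g := hg ▸ mem_insert_of_mem _ hkT
    obtain ⟨i, rfl⟩ := this
    exact lt_of_lt_of_le hk (le_iSup (fun i => ‖inner ℂ (g i : Lp ℂ 2 μ) (u s)‖ₑ) i)
  · refine (enorm_inner_le_eLpNorm_mul r.conjExponent r _ _).trans ?_
    calc _ ≤ 1 * eLpNorm (u s) r μ := by gcongr; exact (g i).2
      _ = _ := one_mul _

/-- At each time, `y n s` is the best of the first `n + 1` functionals. A selection that is
measurable, bounded and monotone in `n` permits monotone convergence in time. -/
theorem exists_measurable_norming {r : ℝ≥0∞} (hr : 2 ≤ r) {u : ℝ → Lp ℂ 2 μ}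
    (hu : StronglyMeasurable u) : ∃ y : ℕ → ℝ → Lp ℂ 2 μ, (∀ n, IsBddMeas (y n)) ∧
      (∀ n s, eLpNorm (y n s) r.conjExponent μ ≤ 1) ∧
      (∀ s, Monotone fun n => ‖inner ℂ (y n s) (u s)‖ₑ) ∧
        ∀ s, eLpNorm (u s) r μ = ⨆ n, ‖inner ℂ (y n s) (u s)‖ₑ := by
  obtain ⟨g, hg, hgu⟩ := exists_countable_norming hr hu
  classical
  let y : ℕ → ℝ → Lp ℂ 2 μ := fun n => Nat.rec (fun _ => g 0)
    (fun n z s => if ‖inner ℂ (z s) (u s)‖ₑ ≤ ‖inner ℂ (g (n + 1)) (u s)‖ₑ then g (n + 1) else z s) n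
  have hy0 : ∀ s, y 0 s = g 0 := fun s => rfl
  have hys : ∀ n s, y (n + 1) s = if ‖inner ℂ (y n s) (u s)‖ₑ ≤ ‖inner ℂ (g (n + 1)) (u s)‖ₑ
    then g (n + 1) else y n s := fun n s => rfl
  have hyg : ∀ n s, ∃ i, y n s = g i := fun n s => by
    induction n with
    | zero => exact ⟨0, rfl⟩
    | succ n ih =>
      rw [hys]; split_ifs
      · exact ⟨_, rfl⟩
      · exact ih
  have hmono : ∀ s, Monotone fun n => ‖inner ℂ (y n s) (u s)‖ₑ := fun s =>
    monotone_nat_of_le_succ fun n => by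
      rw [hys]; split_ifs with h
      · exact h
      · exact le_rfl
  refine ⟨y, fun n => ?_, fun n s => ?_, hmono, fun s => le_antisymm ?_ (iSup_le fun n => ?_)⟩
  · induction n with
    | zero => exact ⟨stronglyMeasurable_const, ‖g 0‖, norm_nonneg _, fun s => le_rfl⟩
    | succ n ih =>
      obtain ⟨hm, M, hM0, hM⟩ := ih
      refine ⟨?_, max M ‖g (n + 1)‖, le_max_of_le_left hM0, fun s => ?_⟩
      · exact StronglyMeasurable.ite (measurableSet_le (hm.inner hu).enorm
          (stronglyMeasurable_const.inner hu).enorm) stronglyMeasurable_const hm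
      · rw [hys]; split_ifs
        · exact le_max_right _ _
        · exact (hM s).trans (le_max_left _ _)
  · obtain ⟨i, hi⟩ := hyg n s
    rw [hi]; exact hg i
  · rw [hgu]
    refine iSup_le fun i => le_trans ?_ (le_iSup (fun n => ‖inner ℂ (y n s) (u s)‖ₑ) i)
    cases i with
    | zero => exact le_rfl
    | succ n =>
      rw [hys]; split_ifs with h
      · exact le_rfl
      · exact (not_le.1 h).le
  · obtain ⟨i, hi⟩ := hyg n s
    rw [hi, hgu]
    exact le_iSup (fun i => ‖inner ℂ (g i) (u s)‖ₑ) i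

end LpFacts

/-! ### Mixed norms: Hölder, duality and interpolation. -/

section MixedNorms

theorem eLpNorm_ennreal_eq {Y : Type*} [MeasurableSpace Y] {ν : Measure Y} {q : ℝ≥0∞} (hq0 : q ≠ 0)
    (hq : q ≠ ∞) (f : Y → ℝ≥0∞) :
    eLpNorm f q ν = (∫⁻ y, f y ^ q.toReal ∂ν) ^ (1 / q.toReal) := by
  rw [eLpNorm_eq_lintegral_rpow_enorm_toReal hq0 hq]
  simp

theorem eLpNorm_ennreal_rpow {Y : Type*} [MeasurableSpace Y] {ν : Measure Y} {q : ℝ≥0∞}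
    (hq0 : q ≠ 0) (hq : q ≠ ∞) (f : Y → ℝ≥0∞) :
    eLpNorm f q ν ^ q.toReal = ∫⁻ y, f y ^ q.toReal ∂ν := by
  rw [eLpNorm_ennreal_eq hq0 hq, ← ENNReal.rpow_mul, one_div,
    inv_mul_cancel₀ (ENNReal.toReal_pos hq0 hq).ne', ENNReal.rpow_one]

theorem eLpNorm_ennreal_top {Y : Type*} [MeasurableSpace Y] {ν : Measure Y} (f : Y → ℝ≥0∞) :
    eLpNorm f ∞ ν = essSup f ν := by
  rw [eLpNorm_exponent_top]; simp [eLpNormEssSup]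

theorem eLpNorm_ennreal_one {Y : Type*} [MeasurableSpace Y] {ν : Measure Y} (f : Y → ℝ≥0∞) :
    eLpNorm f 1 ν = ∫⁻ y, f y ∂ν := by
  rw [eLpNorm_one_eq_lintegral_enorm]; simp

theorem lintegral_mul_le_eLpNorm_mul {Y : Type*} [MeasurableSpace Y] {ν : Measure Y} (p q : ℝ≥0∞)
    [hpq : p.HolderConjugate q] {f g : Y → ℝ≥0∞} (hf : AEMeasurable f ν) (hg : AEMeasurable g ν) :
    ∫⁻ y, f y * g y ∂ν ≤ eLpNorm f p ν * eLpNorm g q ν := by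
  have key : ∀ {f g : Y → ℝ≥0∞}, AEMeasurable f ν →
      ∫⁻ y, f y * g y ∂ν ≤ eLpNorm f 1 ν * eLpNorm g ∞ ν := fun {f g} hf => by
    rw [eLpNorm_ennreal_one, eLpNorm_ennreal_top, ← lintegral_mul_const'' _ hf]
    refine lintegral_mono_ae ?_
    filter_upwards [ENNReal.ae_le_essSup g] with y hy
    gcongr
  rcases eq_or_ne p ∞ with rfl | hp
  · have : q = 1 := by
      rw [hpq.conj_eq]; simp
    rw [this, mul_comm]
    simp_rw [mul_comm (f _)]
    exact key hg
  rcases eq_or_ne q ∞ with rfl | hq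
  · have : p = 1 := by
      rw [hpq.symm.conj_eq]; simp
    rw [this]
    exact key hf
  have h := ENNReal.HolderConjugate.toReal_of_ne_top hp hq
  have hp0 : p ≠ 0 := (ENNReal.toReal_pos_iff.1 h.pos).1.ne'
  have hq0 : q ≠ 0 := (ENNReal.toReal_pos_iff.1 h.symm.pos).1.ne'
  rw [eLpNorm_ennreal_eq hp0 hp, eLpNorm_ennreal_eq hq0 hq]
  exact ENNReal.lintegral_mul_le_Lp_mul_Lq ν h hf hg

variable {X : Type*} [MeasurableSpace X] {μ : Measure X}

theorem lintegral_enorm_inner_le_mixedNorm {q r q' r' : ℝ≥0∞} [q'.HolderConjugate q]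
    [r'.HolderConjugate r] {I : Set ℝ} {G u : ℝ → Lp ℂ 2 μ} (hG : StronglyMeasurable G)
    (hu : StronglyMeasurable u) :
    ∫⁻ s in I, ‖inner ℂ (G s) (u s)‖ₑ ≤ mixedNorm q' r' I G * mixedNorm q r I u := by
  refine le_trans (lintegral_mono fun s => enorm_inner_le_eLpNorm_mul r' r (G s) (u s)) ?_
  exact lintegral_mul_le_eLpNorm_mul q' q (measurable_eLpNorm_comp hG r').aemeasurable
    (measurable_eLpNorm_comp hu r).aemeasurable

/-- The norm of `L^q(I, L^r)` of a bounded function is controlled by duality. -/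
theorem mixedNorm_le_of_pairing {q r : ℝ≥0∞} (hq2 : 2 ≤ q) (hqt : q ≠ ∞) (hr : 2 ≤ r)
    {I : Set ℝ} (hI : MeasurableSet I) (hIf : volume I ≠ ∞) {u : ℝ → Lp ℂ 2 μ} (hu : IsBddMeas u)
    {C : ℝ≥0∞} (h : ∀ G : ℝ → Lp ℂ 2 μ, IsBddMeas G → (∀ s ∉ I, G s = 0) →
      ‖∫ s in I, inner ℂ (G s) (u s)‖ₑ ≤
        C * mixedNorm q.conjExponent r.conjExponent I G) : mixedNorm q r I u ≤ C := by
  obtain ⟨y, hy, hy1, hmono, hyu⟩ := exists_measurable_norming hr hu.meas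
  set ρ := q.toReal with hρ
  have hρ2 : 2 ≤ ρ := by simpa using (ENNReal.toReal_le_toReal (by norm_num) hqt).2 hq2
  have hρ0 : 0 < ρ := by linarith
  set p := q.conjExponent with hp
  have hqc : q.HolderConjugate p := .conjExponent (le_trans (by norm_num) hq2)
  have hpr : ρ.HolderConjugate p.toReal := ENNReal.HolderConjugate.toReal (p := q) (q := p)
    (by linarith)
  have hp0 : 0 < p.toReal := hpr.symm.pos
  have hptop : p ≠ ∞ := (ENNReal.toReal_pos_iff.1 hp0).2.ne
  have hpne : p ≠ 0 := (ENNReal.toReal_pos_iff.1 hp0).1.ne'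
  have hqne : q ≠ 0 := (ENNReal.toReal_pos_iff.1 hρ0).1.ne'
  set z : ℕ → ℝ → ℂ := fun n s => inner ℂ (y n s) (u s) with hz
  have hzm : ∀ n, StronglyMeasurable (z n) := fun n => (hy n).meas.inner hu.meas
  have hsup : mixedNorm q r I u = (⨆ n, ∫⁻ s in I, ‖z n s‖ₑ ^ ρ) ^ (1 / ρ) := by
    rw [mixedNorm, eLpNorm_ennreal_eq hqne hqt, ← hρ,
      ← lintegral_iSup (fun n => (hzm n).enorm.pow_const ρ)
        (fun m n hmn s => ENNReal.rpow_le_rpow (hmono s hmn) hρ0.le)]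
    congr 1
    refine lintegral_congr fun s => ?_
    rw [hyu s]
    exact (ENNReal.monotone_rpow_of_nonneg hρ0.le).map_iSup_of_continuousAt
      ENNReal.continuous_rpow_const.continuousAt (by simp [hρ0])
  rw [hsup]
  have hJ : ∀ n, ∫⁻ s in I, ‖z n s‖ₑ ^ ρ ≤ C ^ ρ := by
    intro n
    obtain ⟨M, hM0, hM⟩ := hu.bdd
    obtain ⟨N, hN0, hN⟩ := (hy n).bdd
    have hzb : ∀ s, ‖z n s‖ ≤ N * M := fun s =>
      (norm_inner_le_norm _ _).trans (mul_le_mul (hN s) (hM s) (norm_nonneg _) hN0)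
    set J := ∫⁻ s in I, ‖z n s‖ₑ ^ ρ with hJdef
    -- Boundedness of `u` and `y n` on a set of finite measure is used here; without finiteness, `J
    -- ≤ C J^{1/q'}` would give nothing.
    have hJt : J ≠ ∞ := by
      refine ne_top_of_le_ne_top ?_ (lintegral_mono (g := fun _ => ENNReal.ofReal ((N * M) ^ ρ))
        fun s => ?_)
      · rw [setLIntegral_const]
        exact ENNReal.mul_ne_top ENNReal.ofReal_ne_top hIf
      · dsimp only
        rw [← ofReal_norm, ENNReal.ofReal_rpow_of_nonneg (norm_nonneg _) hρ0.le]
        exact ENNReal.ofReal_le_ofReal (Real.rpow_le_rpow (norm_nonneg _) (hzb s) hρ0.le)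
    -- The extremal function for the time variable: the first slot of the inner product is conjugate
    -- linear, so pairing `a • y n` with `u` yields `|z|^ρ`.
    set a : ℝ → ℂ := I.indicator fun s => ((‖z n s‖ ^ (ρ - 2) : ℝ) : ℂ) * z n s with ha
    have ham : StronglyMeasurable a := by
      refine StronglyMeasurable.indicator ?_ hI
      exact ((Complex.measurable_ofReal.comp ((hzm n).norm.measurable.pow_const _)).mul
        (hzm n).measurable).stronglyMeasurable
    have han : ∀ s ∈ I, ‖a s‖ = ‖z n s‖ ^ (ρ - 1) := fun s hs => by
      rw [ha, indicator_of_mem hs, norm_mul, Complex.norm_real, Real.norm_of_nonneg (by positivity)]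
      rcases (norm_nonneg (z n s)).eq_or_lt with h0 | h0
      · rw [← h0, mul_zero, Real.zero_rpow (by linarith)]
      · nth_rewrite 2 [← Real.rpow_one ‖z n s‖]
        rw [← Real.rpow_add h0]; congr 1; ring
    have hbG : IsBddMeas fun s => a s • y n s := by
      refine ⟨ham.smul (hy n).meas, (N * M) ^ (ρ - 1) * N, by positivity, fun s => ?_⟩
      by_cases hs : s ∈ I
      · rw [norm_smul, han s hs]
        exact mul_le_mul (Real.rpow_le_rpow (norm_nonneg _) (hzb s) (by linarith)) (hN s)
          (norm_nonneg _) (by positivity)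
      · rw [ha, indicator_of_notMem hs, zero_smul, norm_zero]; positivity
    have h1 := h _ hbG (fun s hs => by rw [ha, indicator_of_notMem hs, zero_smul])
    have h2 : mixedNorm p r.conjExponent I (fun s => a s • y n s) ≤ J ^ (1 / p.toReal) := by
      rw [mixedNorm, eLpNorm_ennreal_eq hpne hptop]
      gcongr
      refine setLIntegral_mono' hI fun s hs => ?_
      rw [eLpNorm_lp_smul]
      calc (‖a s‖ₑ * eLpNorm (y n s) r.conjExponent μ) ^ p.toReal
          ≤ (‖a s‖ₑ * 1) ^ p.toReal := by gcongr; exact hy1 n s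
        _ = ‖z n s‖ₑ ^ ρ := by
          rw [mul_one, ← ofReal_norm, han s hs, ← ENNReal.ofReal_rpow_of_nonneg (norm_nonneg _)
            (by linarith), ofReal_norm, ← ENNReal.rpow_mul, hpr.sub_one_mul_conj]
    have h3 : ‖∫ s in I, inner ℂ (a s • y n s) (u s)‖ₑ = J := by
      have e : ∀ s ∈ I, inner ℂ (a s • y n s) (u s) = ((‖z n s‖ ^ ρ : ℝ) : ℂ) := fun s hs => by
        rw [inner_smul_left, ha, indicator_of_mem hs, map_mul, Complex.conj_ofReal, mul_assoc,
          mul_comm ((starRingEnd ℂ) (z n s)), show inner ℂ (y n s) (u s) = z n s from rfl, Complex.mul_conj, Complex.normSq_eq_norm_sq,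
          ← Complex.ofReal_mul]
        congr 1
        rcases (norm_nonneg (z n s)).eq_or_lt with h0 | h0
        · rw [← h0, Real.zero_rpow (by linarith : ρ ≠ 0)]; simp
        · rw [← Real.rpow_natCast, ← Real.rpow_add h0]; congr 1; push_cast; ring
      rw [setIntegral_congr_fun hI e, integral_complex_ofReal, ← ofReal_norm, Complex.norm_real,
        Real.norm_of_nonneg (integral_nonneg fun s => by positivity),
        ofReal_integral_eq_lintegral_ofReal ?_ (Eventually.of_forall fun s => by positivity)]
      · refine lintegral_congr fun s => ?_
        rw [← ENNReal.ofReal_rpow_of_nonneg (norm_nonneg _) hρ0.le, ofReal_norm]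
      · refine ⟨((hzm n).norm.measurable.pow_const _).aestronglyMeasurable, ?_⟩
        rw [hasFiniteIntegral_iff_ofReal (Eventually.of_forall fun s => by positivity)]
        refine lt_of_le_of_lt (le_of_eq ?_) hJt.lt_top
        refine lintegral_congr fun s => ?_
        rw [← ENNReal.ofReal_rpow_of_nonneg (norm_nonneg _) hρ0.le, ofReal_norm]
    rw [h3] at h1
    have h4 : J ≤ C * J ^ (1 / p.toReal) := h1.trans (by gcongr)
    rcases eq_or_ne J 0 with hJ0 | hJ0
    · rw [hJ0]; exact zero_le
    have e : J = J ^ (1 / ρ) * J ^ (1 / p.toReal) := by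
      rw [← ENNReal.rpow_add _ _ hJ0 hJt, one_div, one_div, hpr.inv_add_inv_eq_one,
        ENNReal.rpow_one]
    have h5 : J ^ (1 / ρ) ≤ C := by
      nth_rewrite 1 [e] at h4
      exact (ENNReal.mul_le_mul_iff_left
        (ENNReal.rpow_pos (pos_iff_ne_zero.2 hJ0) hJt).ne'
        (ENNReal.rpow_ne_top_of_nonneg (by positivity) hJt)).1 h4
    calc J = (J ^ (1 / ρ)) ^ ρ := by
          rw [← ENNReal.rpow_mul, one_div, inv_mul_cancel₀ hρ0.ne', ENNReal.rpow_one]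
      _ ≤ C ^ ρ := by gcongr
  calc (⨆ n, ∫⁻ s in I, ‖z n s‖ₑ ^ ρ) ^ (1 / ρ) ≤ (C ^ ρ) ^ (1 / ρ) := by
        gcongr; exact iSup_le hJ
    _ = C := by rw [← ENNReal.rpow_mul, mul_one_div_cancel hρ0.ne', ENNReal.rpow_one]

/-- Hölder applied to `|v| = |v|^{1-θ} |v|^θ`. -/
theorem eLpNorm_le_rpow_mul_rpow {r₀ r₁ r : ℝ≥0∞} {θ : ℝ} (h0 : 0 < θ) (h1 : θ < 1)
    (hr : r⁻¹ = r₀⁻¹ * ENNReal.ofReal (1 - θ) + r₁⁻¹ * ENNReal.ofReal θ) {v : X → ℂ}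
    (hv : AEStronglyMeasurable v μ) :
    eLpNorm v r μ ≤ eLpNorm v r₀ μ ^ (1 - θ) * eLpNorm v r₁ μ ^ θ := by
  have hθ0 : ENNReal.ofReal θ ≠ 0 := by simpa using h0
  have hθ1 : ENNReal.ofReal (1 - θ) ≠ 0 := by simpa using h1
  have : ENNReal.HolderTriple (r₀ / ENNReal.ofReal (1 - θ)) (r₁ / ENNReal.ofReal θ) r := ⟨by
    rw [hr, ENNReal.inv_div (Or.inl ENNReal.ofReal_ne_top) (Or.inl hθ1),
      ENNReal.inv_div (Or.inl ENNReal.ofReal_ne_top) (Or.inl hθ0), div_eq_mul_inv, div_eq_mul_inv,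
      mul_comm, mul_comm (ENNReal.ofReal θ)]⟩
  have h := eLpNorm_le_eLpNorm_mul_eLpNorm'_of_norm (p := r₀ / ENNReal.ofReal (1 - θ))
    (q := r₁ / ENNReal.ofReal θ) (r := r) (f := fun x => ‖v x‖ ^ (1 - θ))
    (g := fun x => ‖v x‖ ^ θ) (μ := μ)
    (hv.norm.aemeasurable.pow_const _).aestronglyMeasurable
    (hv.norm.aemeasurable.pow_const _).aestronglyMeasurable (fun a b => a * b) 1
    (Eventually.of_forall fun x => by simp [norm_mul])
  rw [eLpNorm_norm_rpow _ (sub_pos.2 h1), eLpNorm_norm_rpow _ h0,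
    ENNReal.div_mul_cancel hθ1 ENNReal.ofReal_ne_top,
    ENNReal.div_mul_cancel hθ0 ENNReal.ofReal_ne_top] at h
  have e : eLpNorm (fun x => ‖v x‖ ^ (1 - θ) * ‖v x‖ ^ θ) r μ = eLpNorm v r μ := by
    rw [← eLpNorm_norm v]
    congr 1
    funext x
    rw [← Real.rpow_add_of_nonneg (norm_nonneg _) (by linarith) h0.le]
    simp
  rw [e] at h
  simpa using h

theorem Admissible.inv_ne_top {α : ℝ} {q r : ℝ≥0∞} (h : Admissible α q r) :
    q⁻¹ ≠ ∞ ∧ r⁻¹ ≠ ∞ :=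
  ⟨ENNReal.inv_ne_top.2 (lt_of_lt_of_le (by norm_num) h.1).ne',
    ENNReal.inv_ne_top.2 (lt_of_lt_of_le (by norm_num) h.2.1).ne'⟩

theorem Admissible.eq_two {α : ℝ} (hα : 0 < α) {r : ℝ≥0∞} (h : Admissible α ∞ r) : r = 2 := by
  have h1 := h.2.2.2
  have h2 := h.inv_ne_top.2
  simp only [ENNReal.inv_top, ENNReal.toReal_zero] at h1
  have h3 : (r⁻¹).toReal = 1 / 2 := by
    rcases mul_eq_zero.1 h1.symm with h | h
    · linarith
    · linarith
  have h4 : r⁻¹ = 2⁻¹ := by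
    rw [← ENNReal.ofReal_toReal h2, h3, ENNReal.ofReal_div_of_pos two_pos]
    simp
  exact inv_injective h4

theorem mixedNorm_top_two_le {I : Set ℝ} (hI : MeasurableSet I) {u : ℝ → Lp ℂ 2 μ} {D : ℝ≥0∞}
    (hD : ∀ s ∈ I, ‖u s‖ₑ ≤ D) : mixedNorm ∞ 2 I u ≤ D := by
  rw [mixedNorm, eLpNorm_ennreal_top]
  refine essSup_le_of_ae_le _ ((ae_restrict_iff' hI).2 (Eventually.of_forall fun s hs => ?_))
  dsimp only
  rw [eLpNorm_lp_two]
  exact hD s hs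

/-- The estimates in `L^∞L²` and in one admissible space imply those in all admissible spaces with
larger time exponent. -/
theorem mixedNorm_le_of_le {α : ℝ} (hα : 0 < α) {q₁ r₁ q r : ℝ≥0∞} (h1 : Admissible α q₁ r₁)
    (h : Admissible α q r) (hle : q₁ ≤ q) {I : Set ℝ} (hI : MeasurableSet I) {u : ℝ → Lp ℂ 2 μ}
    {D : ℝ≥0∞} (hD : ∀ s ∈ I, ‖u s‖ₑ ≤ D) (hm : mixedNorm q₁ r₁ I u ≤ D) :
    mixedNorm q r I u ≤ D := by
  rcases eq_or_ne q ∞ with rfl | hq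
  · rw [h.eq_two hα]
    exact mixedNorm_top_two_le hI hD
  have hq1 : q₁ ≠ ∞ := ne_top_of_le_ne_top hq hle
  have hq10 : q₁ ≠ 0 := (lt_of_lt_of_le (by norm_num) h1.1).ne'
  have hq0 : q ≠ 0 := (lt_of_lt_of_le (by norm_num) h.1).ne'
  have hx1 : 0 < q₁.toReal := ENNReal.toReal_pos hq10 hq1
  have hx : 0 < q.toReal := ENNReal.toReal_pos hq0 hq
  have hlex : q₁.toReal ≤ q.toReal := (ENNReal.toReal_le_toReal hq1 hq).2 hle
  have e1 := h1.2.2.2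
  have e := h.2.2.2
  rw [ENNReal.toReal_inv] at e1 e
  rcases hlex.eq_or_lt with heq | hlt
  · have hqq : q = q₁ := ((ENNReal.toReal_eq_toReal_iff' hq1 hq).1 heq).symm
    have hrr : r = r₁ := by
      rw [hqq, e1] at e
      have : (r⁻¹).toReal = (r₁⁻¹).toReal := by
        have := mul_left_cancel₀ hα.ne' e
        linarith
      exact inv_injective ((ENNReal.toReal_eq_toReal_iff' h.inv_ne_top.2 h1.inv_ne_top.2).1 this)
    rw [hqq, hrr]; exact hm
  -- Here `1/q = θ/q₁`. Admissibility is affine in `(1/q, 1/r)`, so `1/r` is the same interpolate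
  -- between `1/2` and `1/r₁`.
  set θ := q₁.toReal / q.toReal with hθ
  have hθ0 : 0 < θ := by positivity
  have hθ1 : θ < 1 := (div_lt_one hx).2 hlt
  have hr : r⁻¹ = 2⁻¹ * ENNReal.ofReal (1 - θ) + r₁⁻¹ * ENNReal.ofReal θ := by
    rw [← ENNReal.ofReal_toReal h.inv_ne_top.2, ← ENNReal.ofReal_toReal h1.inv_ne_top.2,
      show (2 : ℝ≥0∞)⁻¹ = ENNReal.ofReal (1 / 2) by
        rw [ENNReal.ofReal_div_of_pos two_pos]; simp,
      ← ENNReal.ofReal_mul (by norm_num), ← ENNReal.ofReal_mul (by positivity),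
      ← ENNReal.ofReal_add (mul_nonneg (by norm_num) (by linarith)) (by positivity)]
    congr 1
    have e2 : θ * (1 / 2 - (r₁⁻¹).toReal) = 1 / 2 - (r⁻¹).toReal := by
      refine mul_left_cancel₀ hα.ne' ?_
      rw [← e, mul_left_comm, ← e1, hθ]
      field_simp
    linarith
  have hpt : ∀ s ∈ I, eLpNorm (u s) r μ ^ q.toReal ≤
      D ^ ((1 - θ) * q.toReal) * eLpNorm (u s) r₁ μ ^ q₁.toReal := fun s hs => by
    calc eLpNorm (u s) r μ ^ q.toReal
        ≤ (D ^ (1 - θ) * eLpNorm (u s) r₁ μ ^ θ) ^ q.toReal := by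
          gcongr
          refine (eLpNorm_le_rpow_mul_rpow hθ0 hθ1 hr (Lp.aestronglyMeasurable (u s))).trans ?_
          gcongr
          rw [eLpNorm_lp_two]; exact hD s hs
      _ = _ := by
          rw [ENNReal.mul_rpow_of_nonneg _ _ hx.le, ← ENNReal.rpow_mul, ← ENNReal.rpow_mul,
            hθ, div_mul_cancel₀ _ hx.ne']
  have hm' : ∫⁻ s in I, eLpNorm (u s) r₁ μ ^ q₁.toReal ≤ D ^ q₁.toReal := by
    rw [← eLpNorm_ennreal_rpow hq10 hq1]
    exact ENNReal.rpow_le_rpow hm hx1.le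
  rcases eq_or_ne D ∞ with rfl | hDt
  · exact le_top
  rw [mixedNorm, eLpNorm_ennreal_eq hq0 hq]
  calc (∫⁻ s in I, eLpNorm (u s) r μ ^ q.toReal) ^ (1 / q.toReal)
      ≤ (D ^ ((1 - θ) * q.toReal) * D ^ q₁.toReal) ^ (1 / q.toReal) := by
        gcongr
        refine (setLIntegral_mono' hI hpt).trans ?_
        rw [lintegral_const_mul' _ _ (ENNReal.rpow_ne_top_of_nonneg
          (mul_nonneg (by linarith) hx.le) hDt)]
        gcongr
    _ = D := by
        have : (1 - θ) * q.toReal = q.toReal - q₁.toReal := by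
          rw [hθ]; field_simp
        rw [this, ← ENNReal.rpow_add_of_nonneg _ _ (by linarith) hx1.le, sub_add_cancel,
          ← ENNReal.rpow_mul, mul_one_div_cancel hx.ne', ENNReal.rpow_one]

end MixedNorms

/-! ### One-dimensional kernels: Hardy-Littlewood-Sobolev, Young, geometric sums. -/

section Scalar

/-- The one-sided kernel `x ↦ x^{-l}`, `x > 0`. -/
noncomputable def powKernel (l : ℝ) (x : ℝ) : ℝ≥0∞ :=
  (Ioi (0 : ℝ)).indicator (fun x => ENNReal.ofReal (x ^ (-l))) x

theorem measurable_powKernel (l : ℝ) : Measurable (powKernel l) :=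
  (by fun_prop : Measurable fun x : ℝ => ENNReal.ofReal (x ^ (-l))).indicator measurableSet_Ioi

theorem lintegral_powKernel_Iic {l : ℝ} (hl : l < 1) {R : ℝ} (hR : 0 < R) :
    ∫⁻ x in Iic R, powKernel l x = ENNReal.ofReal (R ^ (1 - l) / (1 - l)) := by
  have h1 : ∫⁻ x in Iic R, powKernel l x = ∫⁻ x in Ioc 0 R, ENNReal.ofReal (x ^ (-l)) := by
    unfold powKernel
    rw [lintegral_indicator measurableSet_Ioi, Measure.restrict_restrict measurableSet_Ioi,
      Ioi_inter_Iic]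
  have hint : IntervalIntegrable (fun x : ℝ => x ^ (-l)) volume 0 R :=
    intervalIntegral.intervalIntegrable_rpow' (by linarith)
  rw [h1, ← ofReal_integral_eq_lintegral_ofReal
    ((intervalIntegrable_iff_integrableOn_Ioc_of_le hR.le).1 hint)
    ((ae_restrict_iff' measurableSet_Ioc).2 (Eventually.of_forall fun x hx =>
      Real.rpow_nonneg hx.1.le _)), ← intervalIntegral.integral_of_le hR.le,
    integral_rpow (Or.inl (by linarith))]
  congr 1
  rw [Real.zero_rpow (by linarith)]
  rw [show -l + 1 = 1 - l by ring]; simp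

theorem lintegral_powKernel_rpow_Ioi {l : ℝ} (hl : 0 < l) {R : ℝ} (hR : 0 < R) :
    ∫⁻ x in Ioi R, powKernel l x ^ (2 / l) = ENNReal.ofReal R⁻¹ := by
  have h1 : ∫⁻ x in Ioi R, powKernel l x ^ (2 / l) = ∫⁻ x in Ioi R, ENNReal.ofReal (x ^ (-2 : ℝ)) := by
    refine setLIntegral_congr_fun measurableSet_Ioi fun x hx => ?_
    have hx0 : 0 < x := hR.trans hx
    rw [powKernel, indicator_of_mem (mem_Ioi.2 hx0),
      ENNReal.ofReal_rpow_of_nonneg (by positivity) (by positivity), ← Real.rpow_mul hx0.le]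
    congr 2
    field_simp
  rw [h1, ← ofReal_integral_eq_lintegral_ofReal (integrableOn_Ioi_rpow_of_lt (by norm_num) hR)
    ((ae_restrict_iff' measurableSet_Ioi).2 (Eventually.of_forall fun x hx =>
      Real.rpow_nonneg (hR.trans hx).le _)), integral_Ioi_rpow_of_lt (by norm_num) hR]
  congr 1
  norm_num [Real.rpow_neg_one]

/-- Split at `R = a^{-p}` with `p = 2/(2-l)`. Near the origin use `h ≤ a`, which gives `a
R^{1-l}/(1-l)`; beyond `R` use Hölder with exponents `p` and `2/l`, which gives `R^{-l/2}`. This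
choice of `R` makes both multiples of `a^{p-1}`. -/
theorem powKernel_pairing_le {l : ℝ} (hl : 0 < l) (hl1 : l < 1) {h : ℝ → ℝ≥0∞} (hm : Measurable h)
    (h1 : ∫⁻ x, h x ^ (2 / (2 - l)) ≤ 1) {a : ℝ≥0∞} (ha0 : a ≠ 0) (hat : a ≠ ∞) :
    ∫⁻ x, {x | h x ≤ a}.indicator h x * powKernel l x ≤
      ENNReal.ofReal (1 / (1 - l) + 1) * a ^ (2 / (2 - l) - 1) := by
  set p := 2 / (2 - l) with hp
  have hp0 : 0 < p := by have : 0 < 2 - l := by linarith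
                         positivity
  lift a to NNReal using hat
  have ha : 0 < (a : ℝ) := by
    have : a ≠ 0 := by simpa using ha0
    exact_mod_cast pos_iff_ne_zero.2 this
  set R : ℝ := (a : ℝ) ^ (-p) with hRdef
  have hR : 0 < R := Real.rpow_pos_of_pos ha _
  have hcR : IsCompl (Iic R) (Ioi R) := by
    rw [← compl_Iic]; exact isCompl_compl
  rw [← lintegral_add_compl _ (measurableSet_Iic (a := R)), compl_Iic]
  have e1 : ∫⁻ x in Iic R, {x | h x ≤ a}.indicator h x * powKernel l x ≤
      ENNReal.ofReal (1 / (1 - l)) * (a : ℝ≥0∞) ^ (p - 1) := by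
    calc ∫⁻ x in Iic R, {x | h x ≤ a}.indicator h x * powKernel l x
        ≤ ∫⁻ x in Iic R, (a : ℝ≥0∞) * powKernel l x := by
          refine lintegral_mono fun x => ?_
          gcongr
          by_cases hx : h x ≤ a
          · rw [indicator_of_mem (show x ∈ {x | h x ≤ a} from hx)]; exact hx
          · rw [indicator_of_notMem (show x ∉ {x | h x ≤ a} from hx)]; exact zero_le
      _ = a * ENNReal.ofReal (R ^ (1 - l) / (1 - l)) := by
          rw [lintegral_const_mul _ (measurable_powKernel l), lintegral_powKernel_Iic hl1 hR]
      _ = ENNReal.ofReal (1 / (1 - l)) * (a : ℝ≥0∞) ^ (p - 1) := by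
          have e : (a : ℝ) * (R ^ (1 - l) / (1 - l)) = (1 / (1 - l)) * (a : ℝ) ^ (p - 1) := by
            rw [hRdef, ← Real.rpow_mul ha.le]
            have : p - 1 = 1 + -p * (1 - l) := by
              have : (2 - l) ≠ 0 := by linarith
              rw [hp]; field_simp; ring
            rw [this, Real.rpow_add ha, Real.rpow_one]
            ring
          rw [← ENNReal.ofReal_coe_nnreal, ← ENNReal.ofReal_mul ha.le, e,
            ENNReal.ofReal_mul (by have : 0 < 1 - l := by linarith
                                   positivity), ENNReal.ofReal_rpow_of_pos ha]
  have hpc : p.HolderConjugate (2 / l) := by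
    rw [Real.holderConjugate_iff]
    have : 0 < 2 - l := by linarith
    constructor
    · rw [hp, lt_div_iff₀ this]; linarith
    · rw [hp]; field_simp; ring
  have e2 : ∫⁻ x in Ioi R, {x | h x ≤ a}.indicator h x * powKernel l x ≤
      1 * (a : ℝ≥0∞) ^ (p - 1) := by
    calc ∫⁻ x in Ioi R, {x | h x ≤ a}.indicator h x * powKernel l x
        ≤ ∫⁻ x in Ioi R, h x * powKernel l x := by
          refine lintegral_mono fun x => ?_
          gcongr
          exact indicator_le_self _ _ _
      _ ≤ (∫⁻ x in Ioi R, h x ^ p) ^ (1 / p) *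
            (∫⁻ x in Ioi R, powKernel l x ^ (2 / l)) ^ (1 / (2 / l)) :=
          ENNReal.lintegral_mul_le_Lp_mul_Lq _ hpc hm.aemeasurable
            (measurable_powKernel l).aemeasurable
      _ ≤ 1 ^ (1 / p) * ENNReal.ofReal R⁻¹ ^ (1 / (2 / l)) := by
          gcongr
          · exact (setLIntegral_le_lintegral _ _).trans h1
          · rw [lintegral_powKernel_rpow_Ioi hl hR]
      _ = 1 * (a : ℝ≥0∞) ^ (p - 1) := by
          rw [ENNReal.one_rpow, ENNReal.ofReal_rpow_of_pos (by positivity), hRdef,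
            ← Real.rpow_neg ha.le, neg_neg, ← Real.rpow_mul ha.le, ← ENNReal.ofReal_rpow_of_pos ha,
            ENNReal.ofReal_coe_nnreal]
          congr 2
          have : (2 - l) ≠ 0 := by linarith
          rw [hp]; field_simp; ring
  rw [ENNReal.ofReal_add (by have : 0 < 1 - l := by linarith
                             positivity) zero_le_one, add_mul, ENNReal.ofReal_one]
  exact add_le_add e1 e2

/-- Where `g(t) ≤ f(s)`, the pairing bound at height `a = f(s)` leaves `f(s) · f(s)^{p-1} = f(s)^p`,
whose integral is at most one; the region `f(s) ≤ g(t)` is symmetric. Each region contributes one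
copy of the constant. -/
theorem powKernel_bilinear_le_of_normalized {l : ℝ} (hl : 0 < l) (hl1 : l < 1) {f g : ℝ → ℝ≥0∞}
    (hf : Measurable f) (hg : Measurable g) (hf1 : ∫⁻ x, f x ^ (2 / (2 - l)) ≤ 1)
    (hg1 : ∫⁻ x, g x ^ (2 / (2 - l)) ≤ 1) :
    ∫⁻ s, ∫⁻ t, f s * g t * powKernel l (t - s) ≤ 2 * ENNReal.ofReal (1 / (1 - l) + 1) := by
  set p := 2 / (2 - l) with hp
  have hp1 : 1 < p := by
    rw [hp, lt_div_iff₀ (by linarith)]; linarith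
  set C := ENNReal.ofReal (1 / (1 - l) + 1) with hC
  have hkm := measurable_powKernel l
  have key : ∀ {f h : ℝ → ℝ≥0∞} (σ : ℝ → ℝ → ℝ), Measurable f → Measurable h →
      ∫⁻ x, f x ^ p ≤ 1 → (∀ s, Measurable (σ s)) → (∀ s, ∫⁻ x, h (σ s x) ^ p ≤ 1) →
      ∫⁻ s, f s * ∫⁻ x, {x | h (σ s x) ≤ f s}.indicator (fun x => h (σ s x)) x * powKernel l x ≤
        C := by
    intro f h σ hf hh hf1 hσ hh1
    have hfin : ∀ᵐ s, f s ≠ ∞ := by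
      have h2 : ∫⁻ x, f x ^ p ≠ ∞ := ne_top_of_le_ne_top ENNReal.one_ne_top hf1
      filter_upwards [ae_lt_top (hf.pow_const p) h2] with s hs hst
      rw [hst, ENNReal.top_rpow_of_pos (by linarith)] at hs
      exact lt_irrefl _ hs
    calc _ ≤ ∫⁻ s, C * f s ^ p := by
          refine lintegral_mono_ae ?_
          filter_upwards [hfin] with s hs
          rcases eq_or_ne (f s) 0 with h0 | h0
          · rw [h0, zero_mul]; exact zero_le
          · refine (mul_le_mul_right (powKernel_pairing_le hl hl1 (hh.comp (hσ s)) (hh1 s) h0 hs)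
              _).trans (le_of_eq ?_)
            rw [← hp, ← hC, mul_left_comm]
            nth_rewrite 1 [← ENNReal.rpow_one (f s)]
            rw [← ENNReal.rpow_add_of_nonneg _ _ zero_le_one (by linarith), add_sub_cancel]
      _ = C * ∫⁻ s, f s ^ p := lintegral_const_mul _ (hf.pow_const p)
      _ ≤ C * 1 := by gcongr
      _ = C := mul_one _
  have hpt : ∀ s t, f s * g t * powKernel l (t - s) ≤
      f s * ({t | g t ≤ f s}.indicator g t * powKernel l (t - s)) +
        g t * ({s | f s ≤ g t}.indicator f s * powKernel l (t - s)) := by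
    intro s t
    rcases le_total (g t) (f s) with h | h
    · refine le_add_right ?_
      rw [indicator_of_mem (show t ∈ {t | g t ≤ f s} from h), mul_assoc]
    · refine le_add_left ?_
      rw [indicator_of_mem (show s ∈ {s | f s ≤ g t} from h)]
      exact le_of_eq (by ring)
  have hm1 : Measurable fun z : ℝ × ℝ =>
      f z.1 * ({t | g t ≤ f z.1}.indicator g z.2 * powKernel l (z.2 - z.1)) := by
    have h1 : Measurable fun z : ℝ × ℝ => {t | g t ≤ f z.1}.indicator g z.2 := by
      have := Measurable.indicator (hg.comp measurable_snd)
        (measurableSet_le (hg.comp measurable_snd) (hf.comp measurable_fst) :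
          MeasurableSet {z : ℝ × ℝ | g z.2 ≤ f z.1})
      exact this
    exact (hf.comp measurable_fst).mul (h1.mul (hkm.comp (measurable_snd.sub measurable_fst)))
  have hm2 : Measurable fun z : ℝ × ℝ =>
      g z.2 * ({s | f s ≤ g z.2}.indicator f z.1 * powKernel l (z.2 - z.1)) := by
    have h1 : Measurable fun z : ℝ × ℝ => {s | f s ≤ g z.2}.indicator f z.1 := by
      have := Measurable.indicator (hf.comp measurable_fst)
        (measurableSet_le (hf.comp measurable_fst) (hg.comp measurable_snd) :
          MeasurableSet {z : ℝ × ℝ | f z.1 ≤ g z.2})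
      exact this
    exact (hg.comp measurable_snd).mul (h1.mul (hkm.comp (measurable_snd.sub measurable_fst)))
  calc ∫⁻ s, ∫⁻ t, f s * g t * powKernel l (t - s)
      ≤ ∫⁻ s, ∫⁻ t, (f s * ({t | g t ≤ f s}.indicator g t * powKernel l (t - s)) +
        g t * ({s | f s ≤ g t}.indicator f s * powKernel l (t - s))) :=
        lintegral_mono fun s => lintegral_mono fun t => hpt s t
    _ = (∫⁻ s, ∫⁻ t, f s * ({t | g t ≤ f s}.indicator g t * powKernel l (t - s))) +
        ∫⁻ t, ∫⁻ s, g t * ({s | f s ≤ g t}.indicator f s * powKernel l (t - s)) := by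
        rw [lintegral_lintegral_swap (f := fun t s =>
          g t * ({s | f s ≤ g t}.indicator f s * powKernel l (t - s)))
          (hm2.comp measurable_swap).aemeasurable, ← lintegral_add_left hm1.lintegral_prod_right']
        refine lintegral_congr fun s => ?_
        exact lintegral_add_left (hm1.comp (measurable_prodMk_left (x := s))) _
    _ ≤ C + C := by
        gcongr
        · refine le_trans (le_of_eq ?_) (key (f := f) (h := g) (fun s x => s + x) hf hg hf1
            (fun s => by fun_prop) fun s => ?_)
          · refine lintegral_congr fun s => ?_
            have hms : Measurable fun t => {t | g t ≤ f s}.indicator g t * powKernel l (t - s) :=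
              (hg.indicator (measurableSet_le hg measurable_const)).mul
                (hkm.comp (measurable_id.sub_const s))
            rw [lintegral_const_mul _ hms, ← lintegral_add_left_eq_self _ s]
            simp only [add_sub_cancel_left]
            rfl
          · rw [lintegral_add_left_eq_self (fun x => g x ^ p) s]; exact hg1
        · refine le_trans (le_of_eq ?_) (key (f := g) (h := f) (fun s x => s - x) hg hf hg1
            (fun s => by fun_prop) fun s => ?_)
          · refine lintegral_congr fun t => ?_
            have hms : Measurable fun s => {s | f s ≤ g t}.indicator f s * powKernel l (t - s) :=
              (hf.indicator (measurableSet_le hf measurable_const)).mul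
                (hkm.comp (measurable_id.const_sub t))
            rw [lintegral_const_mul _ hms, ← lintegral_sub_left_eq_self _ t]
            simp only [sub_sub_cancel]
            rfl
          · rw [lintegral_sub_left_eq_self (fun x => f x ^ p) s]; exact hf1
    _ = 2 * C := (two_mul C).symm

theorem eq_zero_ae_of_lintegral_rpow_eq_zero {f : ℝ → ℝ≥0∞} (hf : Measurable f) {p : ℝ}
    (hp : 0 < p) (h : ∫⁻ x, f x ^ p = 0) : f =ᵐ[volume] 0 := by
  rw [lintegral_eq_zero_iff (hf.pow_const p)] at h
  filter_upwards [h] with x hx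
  simpa [hp, hp.le, not_lt.2 hp.le] using hx

/-- The Hardy–Littlewood–Sobolev inequality on the diagonal, in one dimension. -/
theorem powKernel_bilinear_le {l : ℝ} (hl : 0 < l) (hl1 : l < 1) {f g : ℝ → ℝ≥0∞}
    (hf : Measurable f) (hg : Measurable g) :
    ∫⁻ s, ∫⁻ t, f s * g t * powKernel l (t - s) ≤ 2 * ENNReal.ofReal (1 / (1 - l) + 1) *
      ((∫⁻ x, f x ^ (2 / (2 - l))) ^ (1 / (2 / (2 - l))) *
        (∫⁻ x, g x ^ (2 / (2 - l))) ^ (1 / (2 / (2 - l)))) := by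
  set p := 2 / (2 - l) with hp
  have hp1 : 1 < p := by
    rw [hp, lt_div_iff₀ (by linarith)]; linarith
  have hp0 : 0 < p := by linarith
  set C := 2 * ENNReal.ofReal (1 / (1 - l) + 1) with hC
  have hC0 : C ≠ 0 := by
    have : 0 < 1 - l := by linarith
    have : 0 < 1 / (1 - l) + 1 := by positivity
    simp only [hC, ne_eq, mul_eq_zero, not_or]
    exact ⟨two_ne_zero, by simpa using this⟩
  set A := (∫⁻ x, f x ^ p) ^ (1 / p) with hA
  set B := (∫⁻ x, g x ^ p) ^ (1 / p) with hB
  have hkm := measurable_powKernel l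
  have hz : ∀ {f : ℝ → ℝ≥0∞}, Measurable f → (∫⁻ x, f x ^ p) ^ (1 / p) = 0 → f =ᵐ[volume] 0 := by
    intro f hf h
    refine eq_zero_ae_of_lintegral_rpow_eq_zero hf hp0 ?_
    have : 0 < 1 / p := by positivity
    simpa [this, not_lt.2 this.le, hp0, hp0.le, not_lt.2 hp0.le] using h
  rcases eq_or_ne A 0 with hA0 | hA0
  · have := hz hf hA0
    refine le_trans (le_of_eq ?_) zero_le
    rw [lintegral_congr_ae (g := 0)]
    · simp
    · filter_upwards [this] with s hs
      simp [hs]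
  rcases eq_or_ne B 0 with hB0 | hB0
  · have := hz hg hB0
    refine le_trans (le_of_eq ?_) zero_le
    have h2 : ∀ s, ∫⁻ t, f s * g t * powKernel l (t - s) = 0 := fun s => by
      rw [lintegral_congr_ae (g := 0)]
      · simp
      · filter_upwards [this] with s hs
        simp [hs]
    simp [h2]
  rcases eq_or_ne A ∞ with hAt | hAt
  · rw [hAt, ENNReal.top_mul hB0, ENNReal.mul_top hC0]; exact le_top
  rcases eq_or_ne B ∞ with hBt | hBt
  · rw [hBt, ENNReal.mul_top hA0, ENNReal.mul_top hC0]; exact le_top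
  have hnorm : ∀ {f : ℝ → ℝ≥0∞} {A : ℝ≥0∞}, Measurable f → A = (∫⁻ x, f x ^ p) ^ (1 / p) →
      A ≠ 0 → A ≠ ∞ → ∫⁻ x, (A⁻¹ * f x) ^ p ≤ 1 := by
    intro f A hf hA hA0 hAt
    simp_rw [ENNReal.mul_rpow_of_nonneg _ _ hp0.le]
    rw [lintegral_const_mul _ (hf.pow_const p)]
    have : ∫⁻ x, f x ^ p = A ^ p := by
      rw [hA, ← ENNReal.rpow_mul, one_div, inv_mul_cancel₀ hp0.ne', ENNReal.rpow_one]
    rw [this, ← ENNReal.mul_rpow_of_nonneg _ _ hp0.le, ENNReal.inv_mul_cancel hA0 hAt,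
      ENNReal.one_rpow]
  have h := powKernel_bilinear_le_of_normalized hl hl1 (hf.const_mul A⁻¹) (hg.const_mul B⁻¹)
    (hnorm hf hA hA0 hAt) (hnorm hg hB hB0 hBt)
  calc ∫⁻ s, ∫⁻ t, f s * g t * powKernel l (t - s)
      = (A * B) * ∫⁻ s, ∫⁻ t, A⁻¹ * f s * (B⁻¹ * g t) * powKernel l (t - s) := by
        have hABt : A * B ≠ ∞ := ENNReal.mul_ne_top hAt hBt
        rw [← lintegral_const_mul' _ _ hABt]
        refine lintegral_congr fun s => ?_
        rw [← lintegral_const_mul' _ _ hABt]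
        refine lintegral_congr fun t => ?_
        calc f s * g t * powKernel l (t - s)
            = (A * A⁻¹) * (B * B⁻¹) * (f s * g t * powKernel l (t - s)) := by
              rw [ENNReal.mul_inv_cancel hA0 hAt, ENNReal.mul_inv_cancel hB0 hBt, one_mul, one_mul]
          _ = _ := by ring
    _ ≤ (A * B) * C := by gcongr
    _ = C * (A * B) := mul_comm _ _

/-- Young's inequality for a one-dimensional convolution kernel acting on `L²`. -/
theorem convolution_bilinear_le {k f g : ℝ → ℝ≥0∞} (hk : Measurable k) (hf : Measurable f)
    (hg : Measurable g) :
    ∫⁻ s, ∫⁻ t, f s * g t * k (t - s) ≤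
      (∫⁻ x, k x) * ((∫⁻ x, f x ^ (2 : ℝ)) ^ (1 / 2 : ℝ) * (∫⁻ x, g x ^ (2 : ℝ)) ^ (1 / 2 : ℝ)) := by
  have h22 : (2 : ℝ).HolderConjugate 2 := by rw [Real.holderConjugate_iff]; norm_num
  calc ∫⁻ s, ∫⁻ t, f s * g t * k (t - s)
      = ∫⁻ s, ∫⁻ x, f s * g (s + x) * k x := by
        refine lintegral_congr fun s => ?_
        rw [← lintegral_add_left_eq_self _ s]
        simp only [add_sub_cancel_left]
    _ = ∫⁻ x, ∫⁻ s, f s * g (s + x) * k x := by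
        refine lintegral_lintegral_swap (Measurable.aemeasurable ?_)
        exact ((hf.comp measurable_fst).mul (hg.comp (measurable_fst.add measurable_snd))).mul
          (hk.comp measurable_snd)
    _ = ∫⁻ x, k x * ∫⁻ s, f s * g (s + x) := by
        refine lintegral_congr fun x => ?_
        have hms : Measurable fun s => f s * g (s + x) :=
          hf.mul (hg.comp (measurable_id.add_const x))
        rw [lintegral_mul_const _ hms, mul_comm]
    _ ≤ ∫⁻ x, k x *
        ((∫⁻ x, f x ^ (2 : ℝ)) ^ (1 / 2 : ℝ) * (∫⁻ x, g x ^ (2 : ℝ)) ^ (1 / 2 : ℝ)) := by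
        refine lintegral_mono fun x => ?_
        dsimp only
        gcongr
        refine (ENNReal.lintegral_mul_le_Lp_mul_Lq volume h22 hf.aemeasurable
          (hg.comp (measurable_id.add_const x)).aemeasurable).trans (le_of_eq ?_)
        congr 2
        exact lintegral_add_right_eq_self (fun s => g s ^ (2 : ℝ)) x
    _ = _ := lintegral_mul_const _ hk

/-- Two-sided geometric sums are bounded uniformly in the position of their peak. -/
theorem exists_tsum_geometric_le {ε c : ℝ} (hε : 0 < ε) (hc : 0 < c) :
    ∃ C : NNReal, ∀ x : ℝ,
      ∑' k : ℤ, ENNReal.ofReal ((2 : ℝ) ^ (-(ε * |x + c * k|))) ≤ C := by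
  have hb : (0 : ℝ) < 2 ^ (-(ε * c)) := by positivity
  have hb1 : (2 : ℝ) ^ (-(ε * c)) < 1 :=
    Real.rpow_lt_one_of_one_lt_of_neg one_lt_two (by have := mul_pos hε hc; linarith)
  have hsum : Summable fun k : ℤ => (2 : ℝ) ^ (-(ε * c * |(k : ℝ)|)) := by
    have hn : Summable fun k : ℕ => (2 : ℝ) ^ (-(ε * c * (k : ℝ))) := by
      refine (summable_geometric_of_lt_one hb.le hb1).congr fun k => ?_
      rw [← Real.rpow_natCast, ← Real.rpow_mul two_pos.le]
      congr 1; ring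
    refine Summable.of_nat_of_neg ?_ ?_ <;> simpa using hn
  have hC : ∑' k : ℤ, ENNReal.ofReal (2 ^ (ε * c) * (2 : ℝ) ^ (-(ε * c * |(k : ℝ)|))) ≠ ∞ :=
    (hsum.mul_left (2 ^ (ε * c))).tsum_ofReal_ne_top
  refine ⟨(∑' k : ℤ, ENNReal.ofReal (2 ^ (ε * c) * (2 : ℝ) ^ (-(ε * c * |(k : ℝ)|)))).toNNReal,
    fun x => ?_⟩
  -- Shifting the index by `⌊x/c⌋` moves the peak to within one step of the origin, at the price of
  -- the factor `2^{εc}`. This is why the bound does not depend on `x`.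
  rw [ENNReal.coe_toNNReal hC,
    ← (Equiv.addLeft ⌊x / c⌋).tsum_eq fun k : ℤ =>
      ENNReal.ofReal (2 ^ (ε * c) * (2 : ℝ) ^ (-(ε * c * |(k : ℝ)|)))]
  refine ENNReal.tsum_le_tsum fun k => ENNReal.ofReal_le_ofReal ?_
  rw [← Real.rpow_add two_pos]
  refine Real.rpow_le_rpow_of_exponent_le one_le_two ?_
  have h1 : |((⌊x / c⌋ + k : ℤ) : ℝ)| ≤ |x / c + k| + 1 := by
    push_cast
    have h2 : |(⌊x / c⌋ : ℝ) - x / c| ≤ 1 := by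
      rw [abs_le]; constructor <;> linarith [Int.floor_le (x / c), Int.lt_floor_add_one (x / c)]
    have h3 : (⌊x / c⌋ : ℝ) + k = (x / c + k) + (⌊x / c⌋ - x / c) := by ring
    rw [h3]
    exact (abs_add_le _ _).trans (by gcongr)
  have h4 : |x + c * k| = c * |x / c + k| := by
    rw [← abs_of_pos hc, ← abs_mul, abs_of_pos hc]
    congr 1; field_simp
  rw [h4]
  simp only [Equiv.coe_addLeft]
  nlinarith [mul_pos hε hc, mul_le_mul_of_nonneg_left h1 (mul_pos hε hc).le]

end Scalar

/-! ### Truncation of `L²` functions at dyadic heights. -/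

section Atoms

/-- Truncation of a real number to `[-c, c]`. -/
noncomputable def clamp (c x : ℝ) : ℝ := max (-c) (min c x)

theorem abs_clamp_sub_clamp_le (c x y : ℝ) : |clamp c x - clamp c y| ≤ |x - y| := by
  unfold clamp
  refine (abs_max_sub_max_le_max _ _ _ _).trans ?_
  rw [sub_self, abs_zero]
  refine max_le (abs_nonneg _) ((abs_min_sub_min_le_max _ _ _ _).trans ?_)
  rw [sub_self, abs_zero]
  exact max_le (abs_nonneg _) le_rfl

theorem clamp_of_abs_le {c x : ℝ} (h : |x| ≤ c) : clamp c x = x := by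
  rw [abs_le] at h
  rw [clamp, min_eq_right h.2, max_eq_right h.1]

theorem abs_clamp_le {c : ℝ} (hc : 0 ≤ c) (x : ℝ) : |clamp c x| ≤ c := by
  rw [clamp, abs_le]
  exact ⟨le_max_left _ _, max_le (by linarith) (min_le_left _ _)⟩

theorem clamp_zero {c : ℝ} (hc : 0 ≤ c) : clamp c 0 = 0 := clamp_of_abs_le (by simpa using hc)

theorem abs_clamp_two_mul_sub_le {c : ℝ} (hc : 0 ≤ c) (x : ℝ) :
    |clamp (2 * c) x - clamp c x| ≤ c := by
  rw [abs_le]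
  unfold clamp
  rcases le_total (2 * c) x with h1 | h1 <;> rcases le_total c x with h2 | h2 <;>
    rcases le_total (-c) x with h3 | h3 <;> rcases le_total (-(2 * c)) x with h4 | h4 <;>
    simp only [min_eq_left, min_eq_right, *] <;>
    constructor <;>
    (first
      | (rw [max_eq_right (by linarith), max_eq_right (by linarith)]; linarith)
      | (rw [max_eq_right (by linarith), max_eq_left (by linarith)]; linarith)
      | (rw [max_eq_left (by linarith), max_eq_left (by linarith)]; linarith))

/-- Truncation of both components of a complex number. -/
noncomputable def clampC (c : ℝ) (z : ℂ) : ℂ := ⟨clamp c z.re, clamp c z.im⟩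

theorem lipschitzWith_clampC (c : ℝ) : LipschitzWith 2 (clampC c) := by
  refine LipschitzWith.of_dist_le_mul fun z w => ?_
  rw [dist_eq_norm, dist_eq_norm]
  refine (Complex.norm_le_abs_re_add_abs_im _).trans ?_
  have h1 := (abs_clamp_sub_clamp_le c z.re w.re).trans (Complex.abs_re_le_norm (z - w))
  have h2 := (abs_clamp_sub_clamp_le c z.im w.im).trans (Complex.abs_im_le_norm (z - w))
  simp only [clampC, Complex.sub_re, Complex.sub_im, NNReal.coe_ofNat]
  linarith

theorem clampC_zero {c : ℝ} (hc : 0 ≤ c) : clampC c 0 = 0 := by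
  simp [clampC, clamp_zero hc, Complex.ext_iff]

theorem clampC_of_norm_le {c : ℝ} {z : ℂ} (h : ‖z‖ ≤ c) : clampC c z = z := by
  rw [clampC, clamp_of_abs_le ((Complex.abs_re_le_norm z).trans h),
    clamp_of_abs_le ((Complex.abs_im_le_norm z).trans h)]

theorem norm_clampC_le {c : ℝ} (hc : 0 ≤ c) (z : ℂ) : ‖clampC c z‖ ≤ 2 * c := by
  refine (Complex.norm_le_abs_re_add_abs_im _).trans ?_
  have h1 := abs_clamp_le hc z.re
  have h2 := abs_clamp_le hc z.im
  simp only [clampC]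
  linarith

theorem norm_clampC_le_norm {c : ℝ} (hc : 0 ≤ c) (z : ℂ) : ‖clampC c z‖ ≤ 2 * ‖z‖ := by
  have := (lipschitzWith_clampC c).dist_le_mul z 0
  simpa [clampC_zero hc] using this

theorem norm_clampC_two_mul_sub_le {c : ℝ} (hc : 0 ≤ c) (z : ℂ) :
    ‖clampC (2 * c) z - clampC c z‖ ≤ if c < ‖z‖ then 2 * c else 0 := by
  split_ifs with h
  · refine (Complex.norm_le_abs_re_add_abs_im _).trans ?_
    have h1 := abs_clamp_two_mul_sub_le hc z.re
    have h2 := abs_clamp_two_mul_sub_le hc z.im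
    simp only [clampC, Complex.sub_re, Complex.sub_im]
    linarith
  · rw [clampC_of_norm_le (not_lt.1 h), clampC_of_norm_le ((not_lt.1 h).trans (by linarith)),
      sub_self, norm_zero]

variable {X : Type*} [MeasurableSpace X] {μ : Measure X}

/-- Truncation of an `L²` function at height `2^k`. -/
noncomputable def truncLp (k : ℤ) (v : Lp ℂ 2 μ) : Lp ℂ 2 μ :=
  (lipschitzWith_clampC ((2 : ℝ) ^ k)).compLp (clampC_zero (by positivity)) v

theorem coeFn_truncLp (k : ℤ) (v : Lp ℂ 2 μ) :
    truncLp k v =ᵐ[μ] fun x => clampC ((2 : ℝ) ^ k) (v x) :=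
  LipschitzWith.coeFn_compLp _ _ v

/-- Continuity on `L²`, due to the Lipschitz form of the truncation, makes the pieces of a
measurable function of time measurable; cutting sharply along level sets would not be continuous. -/
theorem continuous_truncLp (k : ℤ) : Continuous (truncLp (μ := μ) k) :=
  LipschitzWith.continuous_compLp (lipschitzWith_clampC ((2 : ℝ) ^ k)) (clampC_zero (by positivity))

theorem norm_truncLp_le (k : ℤ) (v : Lp ℂ 2 μ) : ‖truncLp k v‖ ≤ 2 * ‖v‖ :=
  LipschitzWith.norm_compLp_le _ _ v

/-- The part of an `L²` function at height between `2^k` and `2^(k+1)`. -/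
noncomputable def atomLp (k : ℤ) (v : Lp ℂ 2 μ) : Lp ℂ 2 μ := truncLp (k + 1) v - truncLp k v

theorem norm_atomLp_le (k : ℤ) (v : Lp ℂ 2 μ) :
    ∀ᵐ x ∂μ, ‖atomLp k v x‖ ≤ {x | (2 : ℝ) ^ k < ‖v x‖}.indicator (fun _ => 2 * (2 : ℝ) ^ k) x := by
  filter_upwards [Lp.coeFn_sub (truncLp (k + 1) v) (truncLp k v), coeFn_truncLp k v,
    coeFn_truncLp (k + 1) v] with x h1 h2 h3
  rw [atomLp, h1, Pi.sub_apply, h2, h3, zpow_add_one₀ two_ne_zero, mul_comm]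
  refine (norm_clampC_two_mul_sub_le (by positivity) (v x)).trans (le_of_eq ?_)
  by_cases h : (2 : ℝ) ^ k < ‖v x‖
  · rw [if_pos h, indicator_of_mem (show x ∈ {x | (2 : ℝ) ^ k < ‖v x‖} from h)]
  · rw [if_neg h, indicator_of_notMem (show x ∉ {x | (2 : ℝ) ^ k < ‖v x‖} from h)]

theorem eLpNorm_atomLp_le (k : ℤ) (v : Lp ℂ 2 μ) (p : ℝ≥0∞) :
    eLpNorm (atomLp k v) p μ ≤
      ENNReal.ofReal (2 * (2 : ℝ) ^ k) * μ {x | (2 : ℝ) ^ k < ‖v x‖} ^ (1 / p.toReal) := by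
  have hm : MeasurableSet {x | (2 : ℝ) ^ k < ‖v x‖} :=
    measurableSet_lt measurable_const (Lp.stronglyMeasurable v).norm.measurable
  refine (eLpNorm_mono_ae_real (norm_atomLp_le k v)).trans ?_
  refine (eLpNorm_indicator_const_le _ p).trans (le_of_eq ?_)
  rw [← ofReal_norm, Real.norm_of_nonneg (by positivity)]

theorem sum_atomLp (n : ℕ) (v : Lp ℂ 2 μ) :
    ∑ k ∈ Finset.Ico (-n : ℤ) n, atomLp k v = truncLp n v - truncLp (-n) v := by
  have h : ∀ m : ℕ, ∑ k ∈ Finset.Ico (-n : ℤ) (-n + m), atomLp k v =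
      truncLp (-n + m) v - truncLp (-n) v := fun m => by
    induction m with
    | zero => simp
    | succ m ih =>
      have e : Finset.Ico (-n : ℤ) (-n + (m + 1 : ℕ)) =
          insert (-n + m : ℤ) (Finset.Ico (-n : ℤ) (-n + m)) := by
        ext j; simp only [Finset.mem_Ico, Finset.mem_insert]; push_cast; omega
      rw [e, Finset.sum_insert (by simp), ih, atomLp]
      push_cast
      rw [← add_assoc]
      abel
  have := h (2 * n)
  have e : (-n : ℤ) + (2 * n : ℕ) = n := by push_cast; ring
  rwa [e] at this

theorem tendsto_sum_atomLp (v : Lp ℂ 2 μ) :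
    Tendsto (fun n : ℕ => ∑ k ∈ Finset.Ico (-n : ℤ) n, atomLp k v) atTop (𝓝 v) := by
  simp_rw [sum_atomLp]
  rw [tendsto_iff_norm_sub_tendsto_zero]
  have h1 : Tendsto (fun n : ℕ => ∫⁻ x, ‖clampC (2 ^ (n : ℤ)) (v x) - clampC (2 ^ (-n : ℤ)) (v x) -
      v x‖ₑ ^ (2 : ℝ) ∂μ) atTop (𝓝 (∫⁻ _, 0 ∂μ)) := by
    refine tendsto_lintegral_of_dominated_convergence' (fun x => (5 * ‖v x‖ₑ) ^ (2 : ℝ))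
      (fun n => ?_) (fun n => ?_) ?_ ?_
    · have hc : ∀ c, Measurable fun x => clampC c (v x) := fun c =>
        (lipschitzWith_clampC c).continuous.measurable.comp (Lp.stronglyMeasurable v).measurable
      exact ((((hc _).sub (hc _)).sub (Lp.stronglyMeasurable v).measurable).enorm.pow_const
        _).aemeasurable
    · refine Eventually.of_forall fun x => ?_
      dsimp only
      gcongr
      rw [← ofReal_norm, ← ofReal_norm, show (5 : ℝ≥0∞) = ENNReal.ofReal 5 by simp,
        ← ENNReal.ofReal_mul (by norm_num)]
      refine ENNReal.ofReal_le_ofReal ?_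
      have h1 := norm_clampC_le_norm (c := 2 ^ (n : ℤ)) (by positivity) (v x)
      have h2 := norm_clampC_le_norm (c := 2 ^ (-n : ℤ)) (by positivity) (v x)
      have h3 := norm_sub_le (clampC (2 ^ (n : ℤ)) (v x) - clampC (2 ^ (-n : ℤ)) (v x)) (v x)
      have h4 := norm_sub_le (clampC (2 ^ (n : ℤ)) (v x)) (clampC (2 ^ (-n : ℤ)) (v x))
      linarith
    · simp_rw [ENNReal.mul_rpow_of_nonneg _ _ (zero_le_two (α := ℝ))]
      rw [lintegral_const_mul' _ _ (by finiteness)]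
      refine ENNReal.mul_ne_top (by finiteness) ?_
      have := lintegral_rpow_enorm_lt_top_of_eLpNorm_lt_top (p := 2) (by norm_num) (by norm_num)
        (Lp.memLp v).2
      simpa using this.ne
    · refine Eventually.of_forall fun x => ?_
      have h2 : Tendsto (fun n : ℕ => clampC (2 ^ (n : ℤ)) (v x) - clampC (2 ^ (-n : ℤ)) (v x) -
          v x) atTop (𝓝 0) := by
        have e1 : Tendsto (fun n : ℕ => clampC (2 ^ (n : ℤ)) (v x)) atTop (𝓝 (v x)) := by
          refine tendsto_const_nhds.congr' ?_
          filter_upwards [(tendsto_pow_atTop_atTop_of_one_lt (one_lt_two (α := ℝ))).eventually_ge_atTop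
            ‖v x‖] with n hn
          exact (clampC_of_norm_le (by simpa using hn)).symm
        have e2 : Tendsto (fun n : ℕ => clampC (2 ^ (-n : ℤ)) (v x)) atTop (𝓝 0) := by
          have e3 : Tendsto (fun n : ℕ => 2 * (1 / 2 : ℝ) ^ n) atTop (𝓝 (2 * 0)) :=
            (tendsto_pow_atTop_nhds_zero_of_lt_one (by norm_num) (by norm_num)).const_mul 2
          rw [mul_zero] at e3
          refine squeeze_zero_norm (fun n => (norm_clampC_le (by positivity) _).trans
            (le_of_eq ?_)) e3
          simp
        simpa using (e1.sub e2).sub_const (v x)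
      have h3 := ((ENNReal.continuous_rpow_const (y := 2)).tendsto _).comp h2.enorm
      rw [enorm_zero, ENNReal.zero_rpow_of_pos two_pos] at h3
      exact h3
  have h2 : Tendsto (fun n : ℕ => ‖truncLp n v - truncLp (-n) v - v‖ₑ) atTop (𝓝 0) := by
    have h3 := ((ENNReal.continuous_rpow_const (y := 1 / 2)).tendsto _).comp h1
    rw [lintegral_zero, ENNReal.zero_rpow_of_pos (by norm_num)] at h3
    refine h3.congr fun n => ?_
    rw [← eLpNorm_lp_two, eLpNorm_eq_lintegral_rpow_enorm_toReal two_ne_zero ENNReal.ofNat_ne_top]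
    simp only [Function.comp_def, ENNReal.toReal_ofNat]
    congr 1
    refine lintegral_congr_ae ?_
    filter_upwards [Lp.coeFn_sub (truncLp n v - truncLp (-n) v) v,
      Lp.coeFn_sub (truncLp n v) (truncLp (-n) v), coeFn_truncLp n v, coeFn_truncLp (-n) v]
      with x e1 e2 e3 e4
    rw [e1, Pi.sub_apply, e2, Pi.sub_apply, e3, e4]
  have h3 := (ENNReal.tendsto_toReal ENNReal.zero_ne_top).comp h2
  simpa [Function.comp_def] using h3

/-- A geometric series dominated by its top term, which sits just below `log₂ ρ`: it is part of a
two-sided geometric sum peaked there. -/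
theorem exists_tsum_dyadic_indicator_le {p : ℝ} (hp : 0 < p) : ∃ C : NNReal, ∀ ρ : ℝ, 0 ≤ ρ →
    ∑' k : ℤ, ({k : ℤ | (2 : ℝ) ^ k < ρ}.indicator
      (fun k : ℤ => ENNReal.ofReal ((2 : ℝ) ^ (k * p))) k) ≤ C * ENNReal.ofReal ρ ^ p := by
  obtain ⟨C, hC⟩ := exists_tsum_geometric_le hp one_pos
  refine ⟨C, fun ρ hρ => ?_⟩
  rcases hρ.eq_or_lt with rfl | hρ
  · rw [ENNReal.tsum_eq_zero.2 fun k => ?_]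
    · exact zero_le
    · have : ¬ (2 : ℝ) ^ k < 0 := not_lt.2 (by positivity)
      exact indicator_of_notMem (s := {k : ℤ | (2 : ℝ) ^ k < 0}) this _
  · calc _ ≤ ∑' k : ℤ, ENNReal.ofReal ρ ^ p *
          ENNReal.ofReal ((2 : ℝ) ^ (-(p * |-Real.logb 2 ρ + 1 * k|))) := by
          refine ENNReal.tsum_le_tsum fun k => ?_
          by_cases hk : (2 : ℝ) ^ k < ρ
          · rw [indicator_of_mem (s := {k : ℤ | (2 : ℝ) ^ k < ρ}) hk,
              ENNReal.ofReal_rpow_of_pos hρ, ← ENNReal.ofReal_mul (by positivity)]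
            refine ENNReal.ofReal_le_ofReal (le_of_eq ?_)
            have h1 : (k : ℝ) < Real.logb 2 ρ := by
              rw [Real.lt_logb_iff_rpow_lt one_lt_two hρ, Real.rpow_intCast]; exact hk
            have h2 : ρ ^ p = 2 ^ (Real.logb 2 ρ * p) := by
              rw [Real.rpow_mul two_pos.le, Real.rpow_logb two_pos (by norm_num) hρ]
            rw [h2, ← Real.rpow_add two_pos, abs_of_neg (by linarith)]
            congr 1; ring
          · rw [indicator_of_notMem (s := {k : ℤ | (2 : ℝ) ^ k < ρ}) hk]; exact zero_le
      _ ≤ _ := by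
          rw [ENNReal.tsum_mul_left, mul_comm]
          gcongr
          exact hC _

/-- The dyadic layer-cake formula: apply the pointwise sum to `‖v x‖` and integrate. -/
theorem exists_tsum_measure_le {p : ℝ} (hp : 0 < p) : ∃ C : NNReal,
    ∀ {X : Type*} [MeasurableSpace X] {μ : Measure X} (v : Lp ℂ 2 μ),
      ∑' k : ℤ, ENNReal.ofReal ((2 : ℝ) ^ (k * p)) * μ {x | (2 : ℝ) ^ k < ‖v x‖} ≤
        C * eLpNorm v (ENNReal.ofReal p) μ ^ p := by
  obtain ⟨C, hC⟩ := exists_tsum_dyadic_indicator_le hp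
  refine ⟨C, fun {X} _ {μ} v => ?_⟩
  have hm : ∀ k : ℤ, MeasurableSet {x | (2 : ℝ) ^ k < ‖v x‖} := fun k =>
    measurableSet_lt measurable_const (Lp.stronglyMeasurable v).norm.measurable
  have hp' : (ENNReal.ofReal p).toReal = p := ENNReal.toReal_ofReal hp.le
  calc ∑' k : ℤ, ENNReal.ofReal ((2 : ℝ) ^ (k * p)) * μ {x | (2 : ℝ) ^ k < ‖v x‖}
      = ∑' k : ℤ, ∫⁻ x, {x | (2 : ℝ) ^ k < ‖v x‖}.indicator
          (fun _ => ENNReal.ofReal ((2 : ℝ) ^ (k * p))) x ∂μ := by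
        congr 1; funext k
        rw [lintegral_indicator_const (hm k)]
    _ = ∫⁻ x, ∑' k : ℤ, {x | (2 : ℝ) ^ k < ‖v x‖}.indicator
          (fun _ => ENNReal.ofReal ((2 : ℝ) ^ (k * p))) x ∂μ :=
        (lintegral_tsum fun k => (measurable_const.indicator (hm k)).aemeasurable).symm
    _ ≤ ∫⁻ x, C * ‖v x‖ₑ ^ p ∂μ := by
        refine lintegral_mono fun x => ?_
        have := hC ‖v x‖ (norm_nonneg _)
        rw [ofReal_norm] at this
        exact this
    _ = C * eLpNorm v (ENNReal.ofReal p) μ ^ p := by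
        rw [lintegral_const_mul' _ _ ENNReal.coe_ne_top, eLpNorm_eq_lintegral_rpow_enorm_toReal
          (by simpa using hp) ENNReal.ofReal_ne_top, hp', ← ENNReal.rpow_mul, one_div,
          inv_mul_cancel₀ hp.ne', ENNReal.rpow_one]

end Atoms

/-! ### Dyadic pieces normalized by the `L^p` norm. -/

section Pieces

variable {X : Type*} [MeasurableSpace X] {μ : Measure X}

/-- The dyadic pieces of an `L²` function, at heights normalized by its `L^p` norm. -/
noncomputable def piece (p : ℝ) (k : ℤ) (v : Lp ℂ 2 μ) : Lp ℂ 2 μ :=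
  (((eLpNorm v (ENNReal.ofReal p) μ).toReal : ℝ) : ℂ) •
    atomLp k (((eLpNorm v (ENNReal.ofReal p) μ).toReal : ℂ)⁻¹ • v)

/-- A bound for the `L¹` and `L²` norms of the dyadic pieces. -/
noncomputable def pieceWeight (p : ℝ) (k : ℤ) (v : Lp ℂ 2 μ) : ℝ≥0∞ :=
  max (ENNReal.ofReal ((2 : ℝ) ^ (k * (p - 1))) * eLpNorm (piece p k v) 1 μ)
    (ENNReal.ofReal ((2 : ℝ) ^ (k * (p / 2 - 1))) * eLpNorm (piece p k v) 2 μ)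

theorem ofReal_two_rpow_mul (x y : ℝ) : ENNReal.ofReal ((2 : ℝ) ^ x) * ENNReal.ofReal ((2 : ℝ) ^ y) =
    ENNReal.ofReal ((2 : ℝ) ^ (x + y)) := by
  rw [← ENNReal.ofReal_mul (by positivity), Real.rpow_add two_pos]

theorem ofReal_two_rpow_rpow (x y : ℝ) : ENNReal.ofReal ((2 : ℝ) ^ x) ^ y =
    ENNReal.ofReal ((2 : ℝ) ^ (x * y)) := by
  rw [ENNReal.ofReal_rpow_of_pos (by positivity), Real.rpow_mul two_pos.le]

theorem eLpNorm_piece_one_le (p : ℝ) (k : ℤ) (v : Lp ℂ 2 μ) :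
    eLpNorm (piece p k v) 1 μ ≤ ENNReal.ofReal ((2 : ℝ) ^ (k * (1 - p))) * pieceWeight p k v := by
  calc eLpNorm (piece p k v) 1 μ = ENNReal.ofReal ((2 : ℝ) ^ (k * (1 - p))) *
        (ENNReal.ofReal ((2 : ℝ) ^ (k * (p - 1))) * eLpNorm (piece p k v) 1 μ) := by
        rw [← mul_assoc, ofReal_two_rpow_mul]; ring_nf; simp
    _ ≤ _ := by gcongr; exact le_max_left _ _

theorem eLpNorm_piece_two_le (p : ℝ) (k : ℤ) (v : Lp ℂ 2 μ) :
    eLpNorm (piece p k v) 2 μ ≤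
      ENNReal.ofReal ((2 : ℝ) ^ (k * (1 - p / 2))) * pieceWeight p k v := by
  calc eLpNorm (piece p k v) 2 μ = ENNReal.ofReal ((2 : ℝ) ^ (k * (1 - p / 2))) *
        (ENNReal.ofReal ((2 : ℝ) ^ (k * (p / 2 - 1))) * eLpNorm (piece p k v) 2 μ) := by
        rw [← mul_assoc, ofReal_two_rpow_mul]; ring_nf; simp
    _ ≤ _ := by gcongr; exact le_max_right _ _

theorem stronglyMeasurable_piece (p : ℝ) (k : ℤ) {Y : Type*} [MeasurableSpace Y]
    {u : Y → Lp ℂ 2 μ} (hu : StronglyMeasurable u) :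
    StronglyMeasurable fun s => piece p k (u s) := by
  have h1 : StronglyMeasurable fun s =>
      (((eLpNorm (u s) (ENNReal.ofReal p) μ).toReal : ℝ) : ℂ) :=
    (Complex.measurable_ofReal.comp (measurable_eLpNorm_comp hu _).ennreal_toReal).stronglyMeasurable
  have h2 : Continuous (atomLp (μ := μ) k) := (continuous_truncLp _).sub (continuous_truncLp _)
  exact h1.smul (h2.comp_stronglyMeasurable (h1.measurable.inv.stronglyMeasurable.smul hu))

theorem measurable_pieceWeight (p : ℝ) (k : ℤ) {Y : Type*} [MeasurableSpace Y]
    {u : Y → Lp ℂ 2 μ} (hu : StronglyMeasurable u) :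
    Measurable fun s => pieceWeight p k (u s) :=
  ((measurable_eLpNorm_comp (stronglyMeasurable_piece p k hu) 1).const_mul _).max
    ((measurable_eLpNorm_comp (stronglyMeasurable_piece p k hu) 2).const_mul _)

theorem sum_piece (p : ℝ) (n : ℕ) (v : Lp ℂ 2 μ) :
    ∑ k ∈ Finset.Ico (-n : ℤ) n, piece p k v =
      (((eLpNorm v (ENNReal.ofReal p) μ).toReal : ℝ) : ℂ) • ∑ k ∈ Finset.Ico (-n : ℤ) n,
        atomLp k (((eLpNorm v (ENNReal.ofReal p) μ).toReal : ℂ)⁻¹ • v) := by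
  rw [Finset.smul_sum]; rfl

theorem norm_smul_inv_smul_le {c b : ℝ} {f : Lp ℂ 2 μ → Lp ℂ 2 μ} (hb : 0 ≤ b)
    (hf : ∀ v, ‖f v‖ ≤ b * ‖v‖) (v : Lp ℂ 2 μ) : ‖(c : ℂ) • f ((c : ℂ)⁻¹ • v)‖ ≤ b * ‖v‖ := by
  rcases eq_or_ne c 0 with rfl | hc
  · simp only [Complex.ofReal_zero, zero_smul, norm_zero]; positivity
  · rw [norm_smul]
    calc ‖(c : ℂ)‖ * ‖f ((c : ℂ)⁻¹ • v)‖ ≤ ‖(c : ℂ)‖ * (b * (‖(c : ℂ)‖⁻¹ * ‖v‖)) := by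
          gcongr
          refine (hf _).trans (le_of_eq ?_)
          rw [norm_smul, norm_inv]
      _ = b * ‖v‖ := by
          have : ‖(c : ℂ)‖ ≠ 0 := by simpa using hc
          field_simp

theorem norm_piece_le (p : ℝ) (k : ℤ) (v : Lp ℂ 2 μ) : ‖piece p k v‖ ≤ 4 * ‖v‖ := by
  refine norm_smul_inv_smul_le (f := atomLp k) (by norm_num) (fun w => ?_) v
  refine (norm_sub_le _ _).trans ?_
  linarith [norm_truncLp_le k w, norm_truncLp_le (k + 1) w]

theorem norm_sum_piece_le (p : ℝ) (n : ℕ) (v : Lp ℂ 2 μ) :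
    ‖∑ k ∈ Finset.Ico (-n : ℤ) n, piece p k v‖ ≤ 4 * ‖v‖ := by
  rw [sum_piece]
  refine norm_smul_inv_smul_le (f := fun w => ∑ k ∈ Finset.Ico (-n : ℤ) n, atomLp k w)
    (by norm_num) (fun w => ?_) v
  rw [sum_atomLp]
  refine (norm_sub_le _ _).trans ?_
  linarith [norm_truncLp_le n w, norm_truncLp_le (-n) w]

theorem tendsto_sum_piece {p : ℝ} (hp : 0 < p) {v : Lp ℂ 2 μ}
    (hv : eLpNorm v (ENNReal.ofReal p) μ ≠ ∞) :
    Tendsto (fun n : ℕ => ∑ k ∈ Finset.Ico (-n : ℤ) n, piece p k v) atTop (𝓝 v) := by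
  simp_rw [sum_piece]
  rcases eq_or_ne (eLpNorm v (ENNReal.ofReal p) μ) 0 with h0 | h0
  · rw [eq_zero_of_eLpNorm_eq_zero (by simpa using hp) h0, eLpNorm_lp_zero]
    simp
  · have hne : (((eLpNorm v (ENNReal.ofReal p) μ).toReal : ℝ) : ℂ) ≠ 0 := by
      simpa using (ENNReal.toReal_pos h0 hv).ne'
    have := (tendsto_sum_atomLp
      ((((eLpNorm v (ENNReal.ofReal p) μ).toReal : ℝ) : ℂ)⁻¹ • v)).const_smul
      (((eLpNorm v (ENNReal.ofReal p) μ).toReal : ℝ) : ℂ)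
    rwa [smul_inv_smul₀ hne] at this

/-- Let `N` be the `L^p` norm of `v`, `Φ = v/N` and `m_k = 2^{kp} μ{|Φ| > 2^k}`. The two entries of
the weight are at most `2N m_k` and `2N m_k^{1/2}`. The layer-cake bound gives `∑ m_k ≤ C`, in
particular `m_k ≤ C`, so both squares are bounded by a multiple of `N² m_k`. Normalizing before
cutting is what produces the square of the norm, even when the norm varies in time. -/
theorem exists_tsum_pieceWeight_le {p : ℝ} (hp : 0 < p) : ∃ C : NNReal,
    ∀ {X : Type*} [MeasurableSpace X] {μ : Measure X} (v : Lp ℂ 2 μ),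
      ∑' k : ℤ, pieceWeight p k v ^ (2 : ℝ) ≤ C * eLpNorm v (ENNReal.ofReal p) μ ^ (2 : ℝ) := by
  obtain ⟨C, hC⟩ := exists_tsum_measure_le hp
  refine ⟨4 * (C + 1) * C, fun {X} _ {μ} v => ?_⟩
  set N := eLpNorm v (ENNReal.ofReal p) μ with hN
  by_cases hbad : N.toReal = 0
  · have : ∀ k, pieceWeight p k v = 0 := fun k => by
      have : piece p k v = 0 := by rw [piece, ← hN, hbad]; simp
      rw [pieceWeight, this, eLpNorm_lp_zero, eLpNorm_lp_zero]; simp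
    simp [this]
  have hN0 : N ≠ 0 := fun h => hbad (by simp [h])
  have hNt : N ≠ ∞ := fun h => hbad (by simp [h])
  have hNe : ‖((N.toReal : ℝ) : ℂ)‖ₑ = N := by
    rw [← ofReal_norm, Complex.norm_real, Real.norm_of_nonneg ENNReal.toReal_nonneg,
      ENNReal.ofReal_toReal hNt]
  set Φ : Lp ℂ 2 μ := ((N.toReal : ℝ) : ℂ)⁻¹ • v with hΦ
  have hΦ1 : eLpNorm Φ (ENNReal.ofReal p) μ = 1 := by
    rw [hΦ, eLpNorm_lp_smul, enorm_inv (by simpa using hbad), hNe, ← hN,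
      ENNReal.inv_mul_cancel hN0 hNt]
  set m : ℤ → ℝ≥0∞ := fun k => ENNReal.ofReal ((2 : ℝ) ^ (k * p)) * μ {x | (2 : ℝ) ^ k < ‖Φ x‖}
    with hm
  have hsum : ∑' k, m k ≤ C := by
    have := hC Φ
    rwa [hΦ1, ENNReal.one_rpow, mul_one] at this
  have hmC : ∀ k, m k ≤ C := fun k => (ENNReal.le_tsum k).trans hsum
  have h2k : ∀ k : ℤ, ENNReal.ofReal (2 * (2 : ℝ) ^ k) = 2 * ENNReal.ofReal ((2 : ℝ) ^ (k : ℝ)) := by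
    intro k
    rw [ENNReal.ofReal_mul two_pos.le, Real.rpow_intCast]; simp
  have hpc : ∀ k, piece p k v = ((N.toReal : ℝ) : ℂ) • atomLp k Φ := fun k => rfl
  have hw : ∀ k, pieceWeight p k v ^ (2 : ℝ) ≤ 4 * (C + 1) * N ^ (2 : ℝ) * m k := by
    intro k
    have h1 : ENNReal.ofReal ((2 : ℝ) ^ (k * (p - 1))) * eLpNorm (piece p k v) 1 μ ≤
        2 * N * m k := by
      rw [hpc, eLpNorm_lp_smul, hNe]
      calc _ ≤ ENNReal.ofReal ((2 : ℝ) ^ (k * (p - 1))) * (N *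
            (ENNReal.ofReal (2 * (2 : ℝ) ^ k) * μ {x | (2 : ℝ) ^ k < ‖Φ x‖} ^ (1 / (1 : ℝ≥0∞).toReal))) := by
            gcongr; exact eLpNorm_atomLp_le k Φ 1
        _ = 2 * N * ((ENNReal.ofReal ((2 : ℝ) ^ (k * (p - 1))) * ENNReal.ofReal ((2 : ℝ) ^ (k : ℝ))) *
              μ {x | (2 : ℝ) ^ k < ‖Φ x‖}) := by
            rw [h2k, ENNReal.toReal_one, div_one, ENNReal.rpow_one]; ring
        _ = 2 * N * m k := by
            rw [ofReal_two_rpow_mul, hm]; ring_nf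
    have h2 : ENNReal.ofReal ((2 : ℝ) ^ (k * (p / 2 - 1))) * eLpNorm (piece p k v) 2 μ ≤
        2 * N * m k ^ (1 / 2 : ℝ) := by
      rw [hpc, eLpNorm_lp_smul, hNe]
      calc _ ≤ ENNReal.ofReal ((2 : ℝ) ^ (k * (p / 2 - 1))) * (N *
            (ENNReal.ofReal (2 * (2 : ℝ) ^ k) * μ {x | (2 : ℝ) ^ k < ‖Φ x‖} ^ (1 / (2 : ℝ≥0∞).toReal))) := by
            gcongr; exact eLpNorm_atomLp_le k Φ 2
        _ = 2 * N * ((ENNReal.ofReal ((2 : ℝ) ^ (k * (p / 2 - 1))) *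
              ENNReal.ofReal ((2 : ℝ) ^ (k : ℝ))) * μ {x | (2 : ℝ) ^ k < ‖Φ x‖} ^ (1 / 2 : ℝ)) := by
            rw [h2k, ENNReal.toReal_ofNat]; ring
        _ = 2 * N * m k ^ (1 / 2 : ℝ) := by
            rw [ofReal_two_rpow_mul, hm]
            dsimp only
            rw [ENNReal.mul_rpow_of_nonneg _ _ (by norm_num), ofReal_two_rpow_rpow]
            congr 4; ring
    have h1' : (2 * N * m k) ^ (2 : ℝ) ≤ 4 * (C + 1) * N ^ (2 : ℝ) * m k := by
      simp only [ENNReal.rpow_ofNat]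
      calc (2 * N * m k) ^ 2 = 4 * m k * N ^ 2 * m k := by ring
        _ ≤ 4 * (C + 1) * N ^ 2 * m k := by gcongr; exact (hmC k).trans le_self_add
    have h2' : (2 * N * m k ^ (1 / 2 : ℝ)) ^ (2 : ℝ) ≤ 4 * (C + 1) * N ^ (2 : ℝ) * m k := by
      rw [ENNReal.mul_rpow_of_nonneg _ _ two_pos.le, ← ENNReal.rpow_mul]
      norm_num only [ENNReal.rpow_one]
      calc (2 * N) ^ (2 : ℝ) * m k = 4 * 1 * N ^ (2 : ℝ) * m k := by
            simp only [ENNReal.rpow_ofNat]; ring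
        _ ≤ 4 * (C + 1) * N ^ (2 : ℝ) * m k := by gcongr; exact le_add_self
    rcases le_total (2 * N * m k) (2 * N * m k ^ (1 / 2 : ℝ)) with h | h
    · exact (ENNReal.rpow_le_rpow (max_le (h1.trans h) h2) two_pos.le).trans h2'
    · exact (ENNReal.rpow_le_rpow (max_le h1 (h2.trans h)) two_pos.le).trans h1'
  calc ∑' k : ℤ, pieceWeight p k v ^ (2 : ℝ) ≤ ∑' k, 4 * (C + 1) * N ^ (2 : ℝ) * m k :=
        ENNReal.tsum_le_tsum hw
    _ = 4 * (C + 1) * N ^ (2 : ℝ) * ∑' k, m k := ENNReal.tsum_mul_left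
    _ ≤ 4 * (C + 1) * N ^ (2 : ℝ) * C := by gcongr
    _ = _ := by push_cast; ring

end Pieces

/-! ### Schur's test. -/

section Schur

/-- Schur's test for sums. -/
theorem tsum_tsum_schur_le {ι κ : Type*} [Countable ι] [Countable κ] {w : ι → κ → ℝ≥0∞} {W : ℝ≥0∞}
    (h1 : ∀ k, ∑' l, w k l ≤ W) (h2 : ∀ l, ∑' k, w k l ≤ W) (a : ι → ℝ≥0∞) (b : κ → ℝ≥0∞) :
    ∑' k, ∑' l, w k l * (a k * b l) ≤
      W * ((∑' k, a k ^ (2 : ℝ)) ^ (1 / 2 : ℝ) * (∑' l, b l ^ (2 : ℝ)) ^ (1 / 2 : ℝ)) := by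
  let _ : MeasurableSpace (ι × κ) := ⊤
  have hsq : ∀ x : ℝ≥0∞, (x ^ (1 / 2 : ℝ)) ^ (2 : ℝ) = x := fun x => by
    rw [← ENNReal.rpow_mul]; norm_num
  have hmul : ∀ x : ℝ≥0∞, x ^ (1 / 2 : ℝ) * x ^ (1 / 2 : ℝ) = x := fun x => by
    rw [← ENNReal.rpow_add_of_nonneg _ _ (by norm_num) (by norm_num)]; norm_num
  -- Cauchy-Schwarz on the product index set, with the kernel shared equally between the two
  -- factors.
  have hH := ENNReal.lintegral_mul_le_Lp_mul_Lq (Measure.count : Measure (ι × κ))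
    (p := 2) (q := 2) (f := fun z => a z.1 * w z.1 z.2 ^ (1 / 2 : ℝ))
    (g := fun z => b z.2 * w z.1 z.2 ^ (1 / 2 : ℝ))
    ⟨by norm_num, by norm_num, by norm_num⟩ measurable_from_top.aemeasurable
    measurable_from_top.aemeasurable
  have hm : ∀ F : ι × κ → ℝ≥0∞, ∫⁻ z, F z ∂Measure.count = ∑' z, F z := fun F =>
    lintegral_count' measurable_from_top
  simp only [hm, Pi.mul_apply, ENNReal.mul_rpow_of_nonneg _ _ (zero_le_two : (0 : ℝ) ≤ 2), hsq] at hH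
  have e1 : ∑' k, ∑' l, w k l * (a k * b l) = ∑' z : ι × κ, a z.1 * w z.1 z.2 ^ (1 / 2 : ℝ) *
      (b z.2 * w z.1 z.2 ^ (1 / 2 : ℝ)) := by
    rw [ENNReal.tsum_prod']
    refine tsum_congr fun k => tsum_congr fun l => ?_
    nth_rewrite 1 [← hmul (w k l)]
    ring
  have e2 : ∑' z : ι × κ, a z.1 ^ (2 : ℝ) * w z.1 z.2 ≤ W * ∑' k, a k ^ (2 : ℝ) := by
    rw [ENNReal.tsum_prod', ← ENNReal.tsum_mul_left]
    refine ENNReal.tsum_le_tsum fun k => ?_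
    simp only [ENNReal.tsum_mul_left]
    rw [mul_comm]
    gcongr
    exact h1 k
  have e3 : ∑' z : ι × κ, b z.2 ^ (2 : ℝ) * w z.1 z.2 ≤ W * ∑' l, b l ^ (2 : ℝ) := by
    rw [ENNReal.tsum_prod', ENNReal.tsum_comm, ← ENNReal.tsum_mul_left]
    refine ENNReal.tsum_le_tsum fun l => ?_
    simp only [ENNReal.tsum_mul_left]
    rw [mul_comm]
    gcongr
    exact h2 l
  rw [e1]
  refine hH.trans ?_
  calc _ ≤ (W * ∑' k, a k ^ (2 : ℝ)) ^ (1 / 2 : ℝ) * (W * ∑' l, b l ^ (2 : ℝ)) ^ (1 / 2 : ℝ) := by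
        gcongr
    _ = _ := by
        rw [ENNReal.mul_rpow_of_nonneg _ _ (by norm_num), ENNReal.mul_rpow_of_nonneg _ _ (by norm_num)]
        nth_rewrite 3 [← hmul W]
        ring

end Schur

/-! ### Dispersive semigroups and interpolation of the decay estimate. -/

section Dispersive

variable {X : Type*} [MeasurableSpace X] {μ : Measure X}

/-- A contraction semigroup whose operators map `L¹` to `L^∞` with norm at most `K t^(-α)`. -/
structure IsDispersive (α K : ℝ) (S : ℝ → Lp ℂ 2 μ →L[ℂ] Lp ℂ 2 μ) : Prop
    extends IsContractionSemigroup S where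
  decay : ∀ t, 0 < t → ∀ f g : Lp ℂ 2 μ, ‖inner ℂ g (S t f)‖ₑ ≤
    ENNReal.ofReal (K * t ^ (-α)) * (eLpNorm g 1 μ * eLpNorm f 1 μ)

theorem IsDispersive.adjoint {α K : ℝ} {S : ℝ → Lp ℂ 2 μ →L[ℂ] Lp ℂ 2 μ}
    (hS : IsDispersive α K S) : IsDispersive α K fun t => ContinuousLinearMap.adjoint (S t) where
  toIsContractionSemigroup := hS.toIsContractionSemigroup.adjoint
  decay t ht f g := by
    rw [ContinuousLinearMap.adjoint_inner_right, ← inner_conj_symm, RCLike.enorm_conj,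
      mul_comm (eLpNorm g 1 μ)]
    exact hS.decay t ht g f

/-- Only `s = 0` of the hypothesis is needed, where the adjoint is the identity. The degenerate
cases are removed first, because the hypothesis concerns `f` in `L¹` only. -/
theorem isDispersive_of_decayEstimate {α K : ℝ} (hK : 0 < K) {S : ℝ → Lp ℂ 2 μ →L[ℂ] Lp ℂ 2 μ}
    (h0 : S 0 = ContinuousLinearMap.id ℂ _)
    (hS : IsContractionSemigroup fun t => S (max t 0)) (hd : DecayEstimate α K S) :
    IsDispersive α K fun t => S (max t 0) where
  toIsContractionSemigroup := hS
  decay t ht f g := by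
    rw [max_eq_left ht.le]
    by_cases hg : eLpNorm g 1 μ = 0
    · rw [eq_zero_of_eLpNorm_eq_zero one_ne_zero hg]; simp
    by_cases hf : eLpNorm f 1 μ = ∞
    · rw [hf, ENNReal.mul_top hg, ENNReal.mul_top]
      · exact le_top
      · simp only [ne_eq, ENNReal.ofReal_eq_zero, not_le]; positivity
    have h := hd t 0 ht.le le_rfl ht.ne' f ⟨(Lp.memLp f).1, lt_top_iff_ne_top.2 hf⟩
    have hid : ContinuousLinearMap.adjoint (S 0) f = f := by
      refine ext_inner_right ℂ fun x => ?_
      rw [ContinuousLinearMap.adjoint_inner_left, h0]; rfl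
    rw [hid, sub_zero, abs_of_pos ht] at h
    calc ‖inner ℂ g (S t f)‖ₑ ≤ eLpNorm g 1 μ * eLpNorm (S t f) ∞ μ :=
          enorm_inner_le_eLpNorm_mul 1 ∞ g _
      _ ≤ eLpNorm g 1 μ * (ENNReal.ofReal (K * t ^ (-α)) * eLpNorm f 1 μ) := by gcongr
      _ = _ := by ring

/-- Both exponents are affine in `n` and equal `z(2/p - 1)` at `n = 2z/p`. Their slopes `1 - p` and
`1 - p/2` have opposite signs and size at least `ε`, so the smaller one decays at rate `ε` away from
the crossing. -/
theorem two_rpow_min_le {p z n ε : ℝ} (h1 : ε ≤ p - 1) (h2 : ε ≤ 1 - p / 2) (hp : 0 < p) :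
    min (z + n * (1 - p)) (n * (1 - p / 2)) ≤ z * (2 / p - 1) - ε * |n - 2 * z / p| := by
  have hz : 2 * z / p = 2 / p * z := by ring
  set y := 2 * z / p with hy
  have e : z = y * p / 2 := by rw [hy]; field_simp
  have e2 : z * (2 / p - 1) = y - z := by rw [hz]; ring
  rw [e2, min_le_iff]
  rcases le_total y n with h | h
  · left
    rw [abs_of_nonneg (by linarith), e]
    nlinarith
  · right
    rw [abs_of_nonpos (by linarith), e]
    nlinarith

/-- With a nonzero constant the estimate is trivial as soon as one of the norms is zero or infinite;
in the remaining case the dyadic pieces sum to the function. -/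
theorem enorm_inner_le_of_ne_top {p : ℝ≥0∞} (hp : p ≠ 0) (f g : Lp ℂ 2 μ)
    (T : Lp ℂ 2 μ →L[ℂ] Lp ℂ 2 μ) {c : ℝ≥0∞} (hc : c ≠ 0)
    (h : eLpNorm g p μ ≠ ∞ → eLpNorm f p μ ≠ ∞ →
      ‖inner ℂ g (T f)‖ₑ ≤ c * (eLpNorm g p μ * eLpNorm f p μ)) :
    ‖inner ℂ g (T f)‖ₑ ≤ c * (eLpNorm g p μ * eLpNorm f p μ) := by
  by_cases hg0 : eLpNorm g p μ = 0
  · rw [eq_zero_of_eLpNorm_eq_zero hp hg0]; simp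
  by_cases hf0 : eLpNorm f p μ = 0
  · rw [eq_zero_of_eLpNorm_eq_zero hp hf0]; simp
  by_cases hg : eLpNorm g p μ = ∞
  · rw [hg, ENNReal.top_mul hf0, ENNReal.mul_top hc]; exact le_top
  by_cases hf : eLpNorm f p μ = ∞
  · rw [hf, ENNReal.mul_top hg0, ENNReal.mul_top hc]; exact le_top
  exact h hg hf

/-- Interpolation between `L¹ → L^∞` and `L² → L²`. -/
theorem exists_enorm_inner_le_interpolation {p : ℝ} (hp1 : 1 < p) (hp2 : p < 2) : ∃ C : NNReal,
    ∀ {X : Type u} [MeasurableSpace X] {μ : Measure X} (T : Lp ℂ 2 μ →L[ℂ] Lp ℂ 2 μ) (M : ℝ), 0 < M →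
      (∀ f g : Lp ℂ 2 μ, ‖inner ℂ g (T f)‖ₑ ≤ ENNReal.ofReal M * (eLpNorm g 1 μ * eLpNorm f 1 μ)) →
      (∀ f, ‖T f‖ ≤ ‖f‖) → ∀ f g : Lp ℂ 2 μ, ‖inner ℂ g (T f)‖ₑ ≤
        C * ENNReal.ofReal (M ^ (2 / p - 1)) *
          (eLpNorm g (ENNReal.ofReal p) μ * eLpNorm f (ENNReal.ofReal p) μ) := by
  have hp0 : 0 < p := by linarith
  set ε := min (p - 1) (1 - p / 2) with hε
  have hεp : 0 < ε := lt_min (by linarith) (by linarith)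
  obtain ⟨W, hW⟩ := exists_tsum_geometric_le hεp one_pos
  obtain ⟨D, hD⟩ := exists_tsum_pieceWeight_le.{u} hp0
  -- The added one keeps the constant nonzero, as the reduction to finite norms requires.
  refine ⟨W * D + 1, fun {X} _ {μ} T M hM hT1 hT2 f g => ?_⟩
  set P := ENNReal.ofReal p with hP
  have hP0 : P ≠ 0 := by simpa [hP] using hp0
  obtain ⟨z, rfl⟩ : ∃ z : ℝ, M = 2 ^ z := ⟨Real.logb 2 M, by rw [Real.rpow_logb] <;> norm_num [hM]⟩
  refine enorm_inner_le_of_ne_top hP0 f g T (mul_ne_zero (by simp) ?_) fun hg hf => ?_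
  · simp only [ne_eq, ENNReal.ofReal_eq_zero, not_le]; positivity
  rw [← Real.rpow_mul two_pos.le]
  set w : ℤ → ℤ → ℝ≥0∞ := fun k l => ENNReal.ofReal ((2 : ℝ) ^ (-(ε * |(k + l : ℝ) - 2 * z / p|)))
    with hw
  have hw1 : ∀ k, ∑' l, w k l ≤ W := fun k => by
    refine (le_of_eq (tsum_congr fun l => ?_)).trans (hW (k - 2 * z / p))
    simp only [hw]; congr 6; ring
  have hw2 : ∀ l, ∑' k, w k l ≤ W := fun k => by
    refine (le_of_eq (tsum_congr fun l => ?_)).trans (hW (k - 2 * z / p))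
    simp only [hw]; congr 6; ring
  -- The `L¹` bound gives the exponent `z + (k+l)(1-p)` and the `L²` bound gives `(k+l)(1-p/2)`.
  -- Taking the smaller leaves a kernel peaked along `k + l = 2z/p`, with bounded row and column
  -- sums.
  have hterm : ∀ k l : ℤ, ‖inner ℂ (piece p l g) (T (piece p k f))‖ₑ ≤
      ENNReal.ofReal (2 ^ (z * (2 / p - 1))) * (w k l * (pieceWeight p k f * pieceWeight p l g)) := by
    intro k l
    have hmin := two_rpow_min_le (p := p) (z := z) (n := k + l) (min_le_left _ _) (min_le_right _ _) hp0
    rw [← hε] at hmin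
    have key : ∀ e : ℝ, e ≤ z * (2 / p - 1) - ε * |(k + l : ℝ) - 2 * z / p| →
        ENNReal.ofReal ((2 : ℝ) ^ e) * (pieceWeight p k f * pieceWeight p l g) ≤
        ENNReal.ofReal (2 ^ (z * (2 / p - 1))) *
          (w k l * (pieceWeight p k f * pieceWeight p l g)) := fun e he => by
      simp only [hw]
      rw [← mul_assoc (ENNReal.ofReal _) (ENNReal.ofReal _), ofReal_two_rpow_mul]
      gcongr
      · norm_num
      · linarith
    rcases min_le_iff.1 hmin with h | h
    · refine le_trans ?_ (key _ h)
      calc _ ≤ ENNReal.ofReal (2 ^ z) * (eLpNorm (piece p l g) 1 μ * eLpNorm (piece p k f) 1 μ) :=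
            hT1 _ _
        _ ≤ ENNReal.ofReal (2 ^ z) * ((ENNReal.ofReal ((2 : ℝ) ^ (l * (1 - p))) * pieceWeight p l g) *
            (ENNReal.ofReal ((2 : ℝ) ^ (k * (1 - p))) * pieceWeight p k f)) := by
            gcongr
            · exact eLpNorm_piece_one_le p l g
            · exact eLpNorm_piece_one_le p k f
        _ = ENNReal.ofReal (2 ^ z) * ENNReal.ofReal ((2 : ℝ) ^ (l * (1 - p))) *
            ENNReal.ofReal ((2 : ℝ) ^ (k * (1 - p))) * (pieceWeight p k f * pieceWeight p l g) := by ring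
        _ = _ := by rw [ofReal_two_rpow_mul, ofReal_two_rpow_mul]; congr 3; ring
    · refine le_trans ?_ (key _ h)
      calc _ ≤ ‖piece p l g‖ₑ * ‖piece p k f‖ₑ := by
            rw [enorm_eq_nnnorm, enorm_eq_nnnorm, enorm_eq_nnnorm, ← ENNReal.coe_mul,
              ENNReal.coe_le_coe, ← NNReal.coe_le_coe]
            exact (norm_inner_le_norm _ _).trans (mul_le_mul_of_nonneg_left (hT2 _) (norm_nonneg _))
        _ ≤ (ENNReal.ofReal ((2 : ℝ) ^ (l * (1 - p / 2))) * pieceWeight p l g) *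
            (ENNReal.ofReal ((2 : ℝ) ^ (k * (1 - p / 2))) * pieceWeight p k f) := by
            rw [← eLpNorm_lp_two, ← eLpNorm_lp_two]
            gcongr
            · exact eLpNorm_piece_two_le p l g
            · exact eLpNorm_piece_two_le p k f
        _ = ENNReal.ofReal ((2 : ℝ) ^ (l * (1 - p / 2))) * ENNReal.ofReal ((2 : ℝ) ^ (k * (1 - p / 2))) *
            (pieceWeight p k f * pieceWeight p l g) := by ring
        _ = _ := by rw [ofReal_two_rpow_mul]; congr 3; ring
  have hlim : Tendsto (fun n : ℕ => ‖inner ℂ (∑ l ∈ Finset.Ico (-n : ℤ) n, piece p l g)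
      (T (∑ k ∈ Finset.Ico (-n : ℤ) n, piece p k f))‖ₑ) atTop (𝓝 ‖inner ℂ g (T f)‖ₑ) :=
    ((tendsto_sum_piece hp0 hg).inner ((T.continuous.tendsto _).comp
      (tendsto_sum_piece hp0 hf))).enorm
  refine le_of_tendsto' hlim fun n => ?_
  calc _ ≤ ∑ k ∈ Finset.Ico (-n : ℤ) n, ∑ l ∈ Finset.Ico (-n : ℤ) n,
          ‖inner ℂ (piece p l g) (T (piece p k f))‖ₑ := by
        rw [map_sum, inner_sum]
        refine (enorm_sum_le _ _).trans (Finset.sum_le_sum fun k _ => ?_)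
        rw [sum_inner]
        exact enorm_sum_le _ _
    _ ≤ ∑ k ∈ Finset.Ico (-n : ℤ) n, ∑ l ∈ Finset.Ico (-n : ℤ) n,
          ENNReal.ofReal (2 ^ (z * (2 / p - 1))) *
            (w k l * (pieceWeight p k f * pieceWeight p l g)) :=
        Finset.sum_le_sum fun k _ => Finset.sum_le_sum fun l _ => hterm k l
    _ ≤ ∑' k : ℤ, ∑' l : ℤ, ENNReal.ofReal (2 ^ (z * (2 / p - 1))) *
            (w k l * (pieceWeight p k f * pieceWeight p l g)) :=
        (Finset.sum_le_sum fun k _ => ENNReal.sum_le_tsum _).trans (ENNReal.sum_le_tsum _)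
    _ ≤ ENNReal.ofReal (2 ^ (z * (2 / p - 1))) * (W *
        ((∑' k, pieceWeight p k f ^ (2 : ℝ)) ^ (1 / 2 : ℝ) *
          (∑' l, pieceWeight p l g ^ (2 : ℝ)) ^ (1 / 2 : ℝ))) := by
        simp only [ENNReal.tsum_mul_left]
        gcongr
        exact tsum_tsum_schur_le hw1 hw2 _ _
    _ ≤ ENNReal.ofReal (2 ^ (z * (2 / p - 1))) * (W *
        ((D * eLpNorm f P μ ^ (2 : ℝ)) ^ (1 / 2 : ℝ) *
          (D * eLpNorm g P μ ^ (2 : ℝ)) ^ (1 / 2 : ℝ))) := by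
        gcongr
        · exact hD f
        · exact hD g
    _ = (W * D : NNReal) * ENNReal.ofReal (2 ^ (z * (2 / p - 1))) *
        (eLpNorm g P μ * eLpNorm f P μ) := by
        rw [ENNReal.mul_rpow_of_nonneg _ _ (by norm_num), ENNReal.mul_rpow_of_nonneg _ _ (by norm_num),
          ← ENNReal.rpow_mul, ← ENNReal.rpow_mul, show (2 : ℝ) * (1 / 2) = 1 by norm_num,
          ENNReal.rpow_one, ENNReal.rpow_one, ENNReal.coe_mul]
        have hDD : (D : ℝ≥0∞) ^ (1 / 2 : ℝ) * (D : ℝ≥0∞) ^ (1 / 2 : ℝ) = D := by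
          rw [← ENNReal.rpow_add_of_nonneg _ _ (by norm_num) (by norm_num)]; norm_num
        nth_rewrite 3 [← hDD]
        ring
    _ ≤ _ := by
        gcongr
        exact le_self_add

end Dispersive

/-! ### The bilinear form restricted to a window of time differences. -/

section WindowForm

variable {H : Type*} [NormedAddCommGroup H] [InnerProductSpace ℂ H]

/-- A bounded strongly measurable function vanishing outside `(0, T)`. -/
structure IsBddSupp {H : Type*} [NormedAddCommGroup H] (T : ℝ) (F : ℝ → H) : Prop extends IsBddMeas F where
  supp : ∀ s ∉ Ioo 0 T, F s = 0

/-- The form `∬ ⟨G(t), S(t - s) F(s)⟩` over the region `t - s ∈ W`. -/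
noncomputable def windowForm (W : Set ℝ) (S : ℝ → H →L[ℂ] H) (F G : ℝ → H) : ℂ :=
  ∫ t, ∫ s, W.indicator (fun τ => inner ℂ (G t) (S τ (F s))) (t - s)

theorem IsBddSupp.reflect {H : Type*} [NormedAddCommGroup H] {T : ℝ} {F : ℝ → H} (hF : IsBddSupp T F) :
    IsBddSupp T fun s => F (T - s) where
  meas := hF.meas.comp_measurable (measurable_const.sub measurable_id)
  bdd := hF.bdd.imp fun M hM => ⟨hM.1, fun s => hM.2 _⟩
  supp s hs := hF.supp _ fun h => hs ⟨by linarith [h.2], by linarith [h.1]⟩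

variable {S : ℝ → H →L[ℂ] H} {F G : ℝ → H} {T : ℝ} {W : Set ℝ}

theorem IsContractionSemigroup.stronglyMeasurable_window (hS : IsContractionSemigroup S)
    (hW : MeasurableSet W) (hF : StronglyMeasurable F) (hG : StronglyMeasurable G) :
    StronglyMeasurable fun z : ℝ × ℝ =>
      W.indicator (fun τ => inner ℂ (G z.1) (S τ (F z.2))) (z.1 - z.2) := by
  have h1 : StronglyMeasurable fun z : ℝ × ℝ => inner ℂ (G z.1) (S (z.1 - z.2) (F z.2)) := by
    refine (hG.comp_measurable measurable_fst).inner ?_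
    exact hS.continuous_uncurry.comp_stronglyMeasurable
      ((measurable_fst.sub measurable_snd).stronglyMeasurable.prodMk
        (hF.comp_measurable measurable_snd))
  exact h1.indicator (s := {z : ℝ × ℝ | z.1 - z.2 ∈ W}) ((measurable_fst.sub measurable_snd) hW)

theorem IsContractionSemigroup.integrable_window (hS : IsContractionSemigroup S)
    (hW : MeasurableSet W) (hF : IsBddSupp T F) (hG : IsBddSupp T G) :
    Integrable fun z : ℝ × ℝ =>
      W.indicator (fun τ => inner ℂ (G z.1) (S τ (F z.2))) (z.1 - z.2) := by
  obtain ⟨M, hM0, hM⟩ := hF.bdd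
  obtain ⟨N, hN0, hN⟩ := hG.bdd
  refine Integrable.mono' (g := (Ioo 0 T ×ˢ Ioo 0 T).indicator fun _ => N * M) ?_
    (hS.stronglyMeasurable_window hW hF.meas hG.meas).aestronglyMeasurable (.of_forall fun z => ?_)
  · refine (integrable_indicator_iff (measurableSet_Ioo.prod measurableSet_Ioo)).2 ?_
    refine integrableOn_const ?_
    rw [Measure.volume_eq_prod, Measure.prod_prod]
    exact ENNReal.mul_ne_top (by simp) (by simp)
  · by_cases h1 : z.1 ∈ Ioo 0 T
    · by_cases h2 : z.2 ∈ Ioo 0 T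
      · rw [indicator_of_mem (show z ∈ Ioo 0 T ×ˢ Ioo 0 T from ⟨h1, h2⟩)]
        refine (norm_indicator_le_norm_self _ _).trans ((norm_inner_le_norm _ _).trans ?_)
        gcongr
        · exact hN _
        · exact (hS.norm_le _ _).trans (hM _)
      · rw [hF.supp _ h2]
        simpa using indicator_nonneg (fun _ _ => mul_nonneg hN0 hM0) z
    · rw [hG.supp _ h1]
      simpa using indicator_nonneg (fun _ _ => mul_nonneg hN0 hM0) z

/-- The change of variables `(t, s) ↦ (T - s, T - t)` preserves `t - s` and exchanges the sources,
with the adjoint in place of the operator. It transfers every estimate that singles out one source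
to the other. -/
theorem IsContractionSemigroup.windowForm_reflect [CompleteSpace H] (hS : IsContractionSemigroup S)
    (hW : MeasurableSet W) (hF : IsBddSupp T F) (hG : IsBddSupp T G) :
    ‖windowForm W (fun t => ContinuousLinearMap.adjoint (S t)) (fun t => G (T - t))
      (fun t => F (T - t))‖ₑ = ‖windowForm W S F G‖ₑ := by
  have h : ∀ t s, W.indicator (fun τ => inner ℂ (F (T - t))
      (ContinuousLinearMap.adjoint (S τ) (G (T - s)))) (t - s) =
      (starRingEnd ℂ) (W.indicator (fun τ => inner ℂ (G (T - s)) (S τ (F (T - t))))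
        ((T - s) - (T - t))) := fun t s => by
    rw [show (T - s) - (T - t) = t - s by ring]
    by_cases hts : t - s ∈ W
    · rw [indicator_of_mem hts, indicator_of_mem hts, ContinuousLinearMap.adjoint_inner_right,
        inner_conj_symm]
    · rw [indicator_of_notMem hts, indicator_of_notMem hts, map_zero]
  unfold windowForm
  simp only [h, integral_conj]
  rw [RCLike.enorm_conj]
  congr 1
  have h1 : ∀ t, ∫ s, W.indicator (fun τ => inner ℂ (G (T - s)) (S τ (F (T - t))))
        ((T - s) - (T - t)) = ∫ s, W.indicator (fun τ => inner ℂ (G s) (S τ (F (T - t))))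
        (s - (T - t)) := fun t =>
    integral_sub_left_eq_self (fun s => W.indicator (fun τ => inner ℂ (G s) (S τ (F (T - t))))
        (s - (T - t))) volume T
  simp only [h1]
  rw [integral_sub_left_eq_self (fun t => ∫ s, W.indicator (fun τ => inner ℂ (G s) (S τ (F t)))
        (s - t)) volume T]
  exact (integral_integral_swap (hS.integrable_window hW hF hG)).symm

theorem enorm_windowForm_le {f g k : ℝ → ℝ≥0∞}
    (h : ∀ s t, t - s ∈ W → ‖inner ℂ (G t) (S (t - s) (F s))‖ₑ ≤ f s * g t * k (t - s))
    (hf : Measurable f) (hg : Measurable g) (hk : Measurable k) :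
    ‖windowForm W S F G‖ₑ ≤ ∫⁻ s, ∫⁻ t, f s * g t * k (t - s) := by
  rw [lintegral_lintegral_swap (by fun_prop)]
  refine (enorm_integral_le_lintegral_enorm _).trans (lintegral_mono fun t => ?_)
  refine (enorm_integral_le_lintegral_enorm _).trans (lintegral_mono fun s => ?_)
  by_cases hts : t - s ∈ W
  · simp only [indicator_of_mem hts]
    exact h s t hts
  · simp [indicator_of_notMem hts]

theorem IsContractionSemigroup.windowForm_Ico [CompleteSpace H] (hS : IsContractionSemigroup S)
    (hF : IsBddMeas F) {a b : ℝ} (hab : a ≤ b) :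
    windowForm (Ico a b) S F G =
      ∫ t, inner ℂ (G t) (∫ s in (t - b)..(t - a), S (t - s) (F s)) := by
  unfold windowForm
  congr 1
  ext t
  have hi := hS.intervalIntegrable hF (τ := fun s => t - s) (by fun_prop) (t - b) (t - a)
  rw [intervalIntegral.integral_of_le (by linarith), ← integral_inner hi.1,
    ← integral_indicator measurableSet_Ioc]
  congr 1
  ext s
  by_cases h : t - s ∈ Ico a b
  · rw [indicator_of_mem h, indicator_of_mem]
    exact ⟨by linarith [h.2], by linarith [h.1]⟩
  · rw [indicator_of_notMem h, indicator_of_notMem]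
    exact fun h' => h ⟨by linarith [h'.2], by linarith [h'.1]⟩

theorem IsContractionSemigroup.windowForm_Ioi [CompleteSpace H] (hS : IsContractionSemigroup S)
    (hF : IsBddSupp T F) (hG : IsBddSupp T G) :
    windowForm (Ioi 0) S F G = ∫ t in Ioo 0 T, inner ℂ (G t) (duhamel S F 0 t) := by
  unfold windowForm
  rw [← integral_indicator measurableSet_Ioo]
  congr 1
  ext t
  by_cases ht : t ∈ Ioo 0 T
  · have hi := hS.intervalIntegrable hF.toIsBddMeas (τ := fun s => t - s) (by fun_prop) 0 t
    rw [indicator_of_mem ht, duhamel, intervalIntegral.integral_of_le ht.1.le,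
      ← integral_inner hi.1, integral_Ioc_eq_integral_Ioo, ← integral_indicator measurableSet_Ioo]
    congr 1
    ext s
    by_cases h : s ∈ Ioo 0 t
    · rw [indicator_of_mem h, indicator_of_mem (show t - s ∈ Ioi 0 from sub_pos.2 h.2)]
    · rw [indicator_of_notMem h]
      by_cases h0 : t - s ∈ Ioi 0
      · rw [indicator_of_mem h0, hF.supp s fun hs => h ⟨hs.1, sub_pos.1 h0⟩]
        simp
      · rw [indicator_of_notMem h0]
  · rw [indicator_of_notMem ht, hG.supp t ht]
    simp

end WindowForm

/-! ### Energy bounds for the form. -/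

section Energy

variable {H : Type*} [NormedAddCommGroup H] [InnerProductSpace ℂ H] [CompleteSpace H]
variable {S : ℝ → H →L[ℂ] H} {F : ℝ → H}

theorem IsContractionSemigroup.enorm_duhamel_sq_le (hS : IsContractionSemigroup S)
    (hF : IsBddMeas F) {a b : ℝ} (hab : a ≤ b) :
    ‖duhamel S F a b‖ₑ ^ (2 : ℝ) ≤ 2 * ‖∫ s in Ioc a b, inner ℂ (F s) (duhamel S F a s)‖ₑ := by
  obtain ⟨M, hM0, hM⟩ := hF.bdd
  have hc : Continuous (duhamel S F a) := hS.continuous_duhamel hF a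
  have hi : IntegrableOn (fun s => inner ℂ (F s) (duhamel S F a s)) (Ioc a b) := by
    refine Measure.integrableOn_of_bounded (M := M * (M * (b - a))) (by simp)
      (hF.meas.inner hc.stronglyMeasurable).aestronglyMeasurable ?_
    filter_upwards [ae_restrict_mem measurableSet_Ioc] with s hs
    refine (norm_inner_le_norm _ _).trans ?_
    gcongr
    · exact hM s
    · refine (hS.norm_integral_le hM _ hs.1.le).trans ?_
      gcongr
      exact hs.2
  have h := hS.energy_inequality hF hab
  rw [intervalIntegral.integral_const_mul, intervalIntegral.integral_of_le hab] at h
  have h2 : ∫ s in Ioc a b, (inner ℂ (F s) (duhamel S F a s)).re =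
      (∫ s in Ioc a b, inner ℂ (F s) (duhamel S F a s)).re := integral_re hi
  rw [h2] at h
  have h3 := h.trans (mul_le_mul_of_nonneg_left (Complex.re_le_norm _) zero_le_two)
  rw [← ofReal_norm, ← ofReal_norm, ENNReal.ofReal_rpow_of_nonneg (norm_nonneg _) zero_le_two,
    ← ENNReal.ofReal_ofNat 2, ← ENNReal.ofReal_mul zero_le_two]
  exact ENNReal.ofReal_le_ofReal (by exact_mod_cast h3)

theorem IsContractionSemigroup.integral_window_eq (hS : IsContractionSemigroup S)
    (hF : IsBddMeas F) {a b t : ℝ} (hab : a ≤ b) (hbt : b ≤ t) :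
    ∫ s in a..b, S (t - s) (F s) = S (t - b) (duhamel S F a b) := by
  have h := hS.duhamel_eq_add hF hab hbt
  rw [duhamel, ← intervalIntegral.integral_add_adjacent_intervals
    (hS.intervalIntegrable hF (by fun_prop) a b) (hS.intervalIntegrable hF (by fun_prop) b t)] at h
  exact add_right_cancel h

/-- For `s ≤ t - a` the semigroup law splits off `S(a)`, which contractivity then discards. What
remains is a Duhamel integral ending at `t - a`, within reach of the energy inequality. -/
theorem IsContractionSemigroup.windowForm_Ico_eq (hS : IsContractionSemigroup S)
    (hF : IsBddMeas F) (G : ℝ → H) {a b : ℝ} (ha : 0 ≤ a) (hab : a ≤ b) :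
    windowForm (Ico a b) S F G = ∫ t, inner ℂ (G t) (S a (duhamel S F (t - b) (t - a))) := by
  rw [hS.windowForm_Ico hF hab]
  congr 1
  ext t
  rw [hS.integral_window_eq hF (by linarith) (by linarith), sub_sub_cancel]

theorem IsContractionSemigroup.enorm_duhamel_sq_le_lintegral (hS : IsContractionSemigroup S)
    (hF : IsBddMeas F) {a b : ℝ} (hab : a ≤ b) :
    ‖duhamel S F a b‖ₑ ^ (2 : ℝ) ≤
      2 * ∫⁻ s' in Ioc a b, ∫⁻ s in Ioo a s', ‖inner ℂ (F s') (S (s' - s) (F s))‖ₑ := by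
  refine (hS.enorm_duhamel_sq_le hF hab).trans ?_
  gcongr
  refine (enorm_integral_le_lintegral_enorm _).trans ?_
  refine setLIntegral_mono_ae' measurableSet_Ioc (.of_forall fun s' hs' => ?_)
  have hi := hS.intervalIntegrable hF (τ := fun s => s' - s) (by fun_prop) a s'
  rw [duhamel, intervalIntegral.integral_of_le hs'.1.le, ← integral_inner hi.1]
  rw [integral_Ioc_eq_integral_Ioo]
  exact enorm_integral_le_lintegral_enorm _

end Energy

/-! ### Three estimates in a window `h ≤ t - s < 2h`. -/

section Window

variable {X : Type*} [MeasurableSpace X] {μ : Measure X}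
variable {α K : ℝ} {S : ℝ → Lp ℂ 2 μ →L[ℂ] Lp ℂ 2 μ} {F G : ℝ → Lp ℂ 2 μ} {A B : ℝ → ℝ≥0∞}
  {a₁ a₂ b₁ b₂ : ℝ≥0∞}

/-- Bounds of the `L¹` and `L²` norms of `F` by multiples of one weight. -/
structure IsWeighted (A : ℝ → ℝ≥0∞) (a₁ a₂ : ℝ≥0∞) (F : ℝ → Lp ℂ 2 μ) : Prop where
  meas : Measurable A
  one_le : ∀ s, eLpNorm (F s) 1 μ ≤ a₁ * A s
  two_le : ∀ s, eLpNorm (F s) 2 μ ≤ a₂ * A s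

theorem enorm_inner_le_eLpNorm_two (g f : Lp ℂ 2 μ) :
    ‖inner ℂ g f‖ₑ ≤ eLpNorm g 2 μ * eLpNorm f 2 μ := by
  rw [eLpNorm_lp_two, eLpNorm_lp_two, enorm_eq_nnnorm, enorm_eq_nnnorm, enorm_eq_nnnorm,
    ← ENNReal.coe_mul, ENNReal.coe_le_coe]
  exact nnnorm_inner_le_nnnorm g f

/-- The geometric mean, with weights `θ` and `1 - θ`, of the decay bound in `L¹` and the contraction
bound in `L²`; `θ` is chosen later to tune the power of `τ`. -/
theorem IsDispersive.enorm_inner_le_of_weighted (hS : IsDispersive α K S) (hK : 0 < K) {θ τ : ℝ}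
    (hθ0 : 0 ≤ θ) (hθ1 : θ ≤ 1) (hτ : 0 < τ) {f g : Lp ℂ 2 μ} {x y : ℝ≥0∞}
    (hf1 : eLpNorm f 1 μ ≤ a₁ * x) (hf2 : eLpNorm f 2 μ ≤ a₂ * x)
    (hg1 : eLpNorm g 1 μ ≤ a₁ * y) (hg2 : eLpNorm g 2 μ ≤ a₂ * y) :
    ‖inner ℂ g (S τ f)‖ₑ ≤ ENNReal.ofReal (K ^ θ) * (a₁ ^ θ * a₂ ^ (1 - θ)) ^ (2 : ℝ) *
      (x * y * ENNReal.ofReal (τ ^ (-(α * θ)))) := by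
  have hsplit : ∀ z : ℝ≥0∞, z = z ^ θ * z ^ (1 - θ) := fun z => by
    rw [← ENNReal.rpow_add_of_nonneg _ _ hθ0 (by linarith)]; simp
  have h1 : ‖inner ℂ g (S τ f)‖ₑ ≤ ENNReal.ofReal (K * τ ^ (-α)) * (a₁ * y * (a₁ * x)) :=
    (hS.decay τ hτ f g).trans (by gcongr)
  have h2 : ‖inner ℂ g (S τ f)‖ₑ ≤ a₂ * y * (a₂ * x) := by
    refine (enorm_inner_le_eLpNorm_two _ _).trans ?_
    gcongr
    refine le_trans ?_ hf2
    rw [eLpNorm_lp_two, eLpNorm_lp_two, enorm_le_iff_norm_le]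
    exact hS.norm_le _ _
  rw [hsplit ‖inner ℂ g (S τ f)‖ₑ]
  have hθ1' : 0 ≤ 1 - θ := by linarith
  refine (mul_le_mul' (ENNReal.rpow_le_rpow h1 hθ0) (ENNReal.rpow_le_rpow h2 hθ1')).trans
    (le_of_eq ?_)
  simp only [ENNReal.mul_rpow_of_nonneg _ _ hθ0, ENNReal.mul_rpow_of_nonneg _ _ hθ1', ENNReal.rpow_two]
  rw [ENNReal.ofReal_rpow_of_nonneg (by positivity) hθ0, Real.mul_rpow hK.le (by positivity),
    ← Real.rpow_mul hτ.le, ENNReal.ofReal_mul (by positivity), neg_mul]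
  have hx : x * y = x ^ θ * x ^ (1 - θ) * (y ^ θ * y ^ (1 - θ)) := by rw [← hsplit, ← hsplit]
  rw [hx]
  ring

theorem lintegral_indicator_Ico {h : ℝ} (c : ℝ≥0∞) :
    ∫⁻ x, (Ico h (2 * h)).indicator (fun _ => c) x = c * ENNReal.ofReal h := by
  rw [lintegral_indicator measurableSet_Ico, setLIntegral_const, Real.volume_Ico]
  congr 2; ring

theorem IsDispersive.enorm_windowForm_le_decay (hS : IsDispersive α K S) (hα : 0 < α) (hK : 0 < K)
    {h : ℝ} (hh : 0 < h) (hF : IsWeighted A a₁ a₂ F) (hG : IsWeighted B b₁ b₂ G) :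
    ‖windowForm (Ico h (2 * h)) S F G‖ₑ ≤ ENNReal.ofReal (K * h ^ (-α) * h) * (a₁ * b₁) *
      ((∫⁻ x, A x ^ (2 : ℝ)) ^ (1 / 2 : ℝ) * (∫⁻ x, B x ^ (2 : ℝ)) ^ (1 / 2 : ℝ)) := by
  have hk : Measurable ((Ico h (2 * h)).indicator
      fun _ : ℝ => ENNReal.ofReal (K * h ^ (-α)) * (a₁ * b₁)) :=
    measurable_const.indicator measurableSet_Ico
  refine (enorm_windowForm_le (f := A) (g := B) (fun s t hts => ?_) hF.meas hG.meas hk).trans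
    ((convolution_bilinear_le hk hF.meas hG.meas).trans (le_of_eq ?_))
  · rw [indicator_of_mem hts]
    refine (hS.decay _ (hh.trans_le hts.1) _ _).trans ?_
    calc _ ≤ ENNReal.ofReal (K * h ^ (-α)) * (b₁ * B t * (a₁ * A s)) := by
          gcongr ENNReal.ofReal (K * ?_) * (?_ * ?_)
          · exact Real.rpow_le_rpow_of_nonpos hh hts.1 (by linarith)
          · exact hG.one_le t
          · exact hF.one_le s
      _ = _ := by ring
  · rw [lintegral_indicator_Ico, ENNReal.ofReal_mul (p := K * h ^ (-α)) (by positivity)]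
    ring

/-- The energy inequality reduces the square to a double integral over the window. With `θ = 1/(2α)`
the kernel is `τ^{-1/2}`, integrable at zero, and only `τ ≤ h` occurs, with integral `2h^{1/2}`;
Young's inequality does the rest. The hypothesis `α ≥ 1/2` says that `θ ≤ 1`. -/
theorem IsDispersive.enorm_duhamel_sq_le_of_weighted (hS : IsDispersive α K S) (hα : 1 / 2 ≤ α) (hK : 0 < K)
    {h : ℝ} (hh : 0 < h) (hF : IsWeighted A a₁ a₂ F) (hFm : IsBddMeas F) (t : ℝ) :
    ‖duhamel S F (t - 2 * h) (t - h)‖ₑ ^ (2 : ℝ) ≤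
      ENNReal.ofReal (4 * K ^ (1 / (2 * α)) * h ^ (1 / 2 : ℝ)) *
        (a₁ ^ (1 / (2 * α)) * a₂ ^ (1 - 1 / (2 * α))) ^ (2 : ℝ) *
        ∫⁻ s in Ioc (t - 2 * h) (t - h), A s ^ (2 : ℝ) := by
  have hα0 : 0 < α := by linarith
  set θ := 1 / (2 * α) with hθ
  have hθ0 : 0 ≤ θ := by positivity
  have hθ1 : θ ≤ 1 := by rw [hθ, div_le_one (by linarith)]; linarith
  have hαθ : α * θ = 1 / 2 := by rw [hθ]; field_simp
  set c := ENNReal.ofReal (K ^ θ) * (a₁ ^ θ * a₂ ^ (1 - θ)) ^ (2 : ℝ) with hc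
  set a := t - 2 * h with ha
  set b := t - h with hb
  set φ : ℝ → ℝ≥0∞ := (Ioc a b).indicator A with hφ
  set k : ℝ → ℝ≥0∞ := (Iic h).indicator (powKernel (1 / 2)) with hk
  have hφm : Measurable φ := hF.meas.indicator measurableSet_Ioc
  have hkm : Measurable k := (measurable_powKernel _).indicator measurableSet_Iic
  have hmain : ∫⁻ s' in Ioc a b, ∫⁻ s in Ioo a s', ‖inner ℂ (F s') (S (s' - s) (F s))‖ₑ ≤
      c * ∫⁻ s, ∫⁻ s', φ s * φ s' * k (s' - s) := by
    rw [lintegral_lintegral_swap (by fun_prop), ← lintegral_const_mul _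
      (Measurable.lintegral_prod_left' (f := fun z : ℝ × ℝ => φ z.1 * φ z.2 * k (z.2 - z.1))
        (by fun_prop)),
      ← lintegral_indicator measurableSet_Ioc]
    refine lintegral_mono fun s' => ?_
    by_cases hs' : s' ∈ Ioc a b
    swap
    · rw [indicator_of_notMem hs']; exact zero_le
    rw [indicator_of_mem hs', ← lintegral_const_mul _ (by fun_prop),
      ← lintegral_indicator measurableSet_Ioo]
    refine lintegral_mono fun s => ?_
    by_cases hs : s ∈ Ioo a s'
    swap
    · rw [indicator_of_notMem hs]; exact zero_le
    rw [indicator_of_mem hs]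
    have hsb : s ∈ Ioc a b := ⟨hs.1, hs.2.le.trans hs'.2⟩
    simp only [hφ, hk, indicator_of_mem hs', indicator_of_mem hsb]
    rw [indicator_of_mem (show s' - s ∈ Iic h from by
      have := hs'.2; have := hs.1; simp only [mem_Iic]; linarith), powKernel,
      indicator_of_mem (show s' - s ∈ Ioi 0 from sub_pos.2 hs.2), ← hαθ]
    exact hS.enorm_inner_le_of_weighted hK hθ0 hθ1 (sub_pos.2 hs.2) (hF.one_le s) (hF.two_le s)
      (hF.one_le s') (hF.two_le s')
  have hφ2 : ∫⁻ s, φ s ^ (2 : ℝ) = ∫⁻ s in Ioc a b, A s ^ (2 : ℝ) := by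
    rw [← lintegral_indicator measurableSet_Ioc]
    refine lintegral_congr fun s => ?_
    by_cases hs : s ∈ Ioc a b
    · simp only [hφ, indicator_of_mem hs]
    · simp [hφ, indicator_of_notMem hs]
  have hkint : ∫⁻ x, k x = ENNReal.ofReal (2 * h ^ (1 / 2 : ℝ)) := by
    rw [hk, lintegral_indicator measurableSet_Iic, lintegral_powKernel_Iic (by norm_num) hh]
    congr 1; norm_num; ring
  refine (hS.enorm_duhamel_sq_le_lintegral hFm (by linarith)).trans ?_
  calc _ ≤ 2 * (c * ((∫⁻ x, k x) * ((∫⁻ x, φ x ^ (2 : ℝ)) ^ (1 / 2 : ℝ) *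
          (∫⁻ x, φ x ^ (2 : ℝ)) ^ (1 / 2 : ℝ)))) := by
        gcongr
        refine hmain.trans ?_
        gcongr
        exact convolution_bilinear_le hkm hφm hφm
    _ = 2 * (c * (ENNReal.ofReal (2 * h ^ (1 / 2 : ℝ)) * ∫⁻ s in Ioc a b, A s ^ (2 : ℝ))) := by
        rw [← ENNReal.rpow_add_of_nonneg _ _ (by norm_num) (by norm_num), hkint, hφ2]
        norm_num
    _ = _ := by
        rw [hc, show 4 * K ^ θ * h ^ (1 / 2 : ℝ) = 2 * (K ^ θ * (2 * h ^ (1 / 2 : ℝ))) by ring,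
          ENNReal.ofReal_mul (q := K ^ θ * (2 * h ^ (1 / 2 : ℝ))) zero_le_two,
          ENNReal.ofReal_mul (p := K ^ θ) (by positivity),
          ENNReal.ofReal_ofNat]
        ring

/-- Tonelli: each `s` belongs to the window for a set of `t` of length `h`. -/
theorem lintegral_window {h : ℝ} {φ : ℝ → ℝ≥0∞} (hφ : Measurable φ) :
    ∫⁻ t, ∫⁻ s in Ioc (t - 2 * h) (t - h), φ s = ENNReal.ofReal h * ∫⁻ s, φ s := by
  have h1 : ∀ t, ∫⁻ s in Ioc (t - 2 * h) (t - h), φ s =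
      ∫⁻ s, φ s * (Ico h (2 * h)).indicator (fun _ => (1 : ℝ≥0∞)) (t - s) := fun t => by
    rw [← lintegral_indicator measurableSet_Ioc]
    refine lintegral_congr fun s => ?_
    by_cases hs : s ∈ Ioc (t - 2 * h) (t - h)
    · rw [indicator_of_mem hs, indicator_of_mem, mul_one]
      exact ⟨by linarith [hs.2], by linarith [hs.1]⟩
    · rw [indicator_of_notMem hs, indicator_of_notMem, mul_zero]
      exact fun h' => hs ⟨by linarith [h'.2], by linarith [h'.1]⟩
  have hm : Measurable ((Ico h (2 * h)).indicator (fun _ : ℝ => (1 : ℝ≥0∞))) :=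
    measurable_const.indicator measurableSet_Ico
  simp only [h1]
  rw [lintegral_lintegral_swap (by fun_prop), mul_comm (ENNReal.ofReal h), ← lintegral_mul_const _ hφ]
  refine lintegral_congr fun s => ?_
  rw [lintegral_const_mul _ (by fun_prop),
    lintegral_sub_right_eq_self (fun t => (Ico h (2 * h)).indicator (fun _ => (1 : ℝ≥0∞)) t) s,
    lintegral_indicator_Ico, one_mul]

/-- Split off `S(h)`, bound the remaining Duhamel integral by energy and apply Cauchy-Schwarz in
`t`. The square root of the kernel integral gives `h^{1/4}` and the length of the window gives
`h^{1/2}`. Only the `L²` bound of `G` is used. -/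
theorem IsDispersive.enorm_windowForm_le_energy (hS : IsDispersive α K S) (hα : 1 / 2 ≤ α)
    (hK : 0 < K) {h : ℝ} (hh : 0 < h) (hF : IsWeighted A a₁ a₂ F) (hG : IsWeighted B b₁ b₂ G)
    (hFm : IsBddMeas F) :
    ‖windowForm (Ico h (2 * h)) S F G‖ₑ ≤
      ENNReal.ofReal (2 * K ^ (1 / (4 * α)) * h ^ (3 / 4 : ℝ)) *
        (a₁ ^ (1 / (2 * α)) * a₂ ^ (1 - 1 / (2 * α)) * b₂) *
      ((∫⁻ x, A x ^ (2 : ℝ)) ^ (1 / 2 : ℝ) * (∫⁻ x, B x ^ (2 : ℝ)) ^ (1 / 2 : ℝ)) := by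
  have hα0 : 0 < α := by linarith
  set d := a₁ ^ (1 / (2 * α)) * a₂ ^ (1 - 1 / (2 * α)) with hd
  set c := ENNReal.ofReal (4 * K ^ (1 / (2 * α)) * h ^ (1 / 2 : ℝ)) * d ^ (2 : ℝ) with hc
  set e : ℝ → ℝ≥0∞ := fun t => ∫⁻ s in Ioc (t - 2 * h) (t - h), A s ^ (2 : ℝ) with he
  have hA2 : Measurable fun s => A s ^ (2 : ℝ) := hF.meas.pow_const _
  have hem : Measurable e := by
    have h1 : e = fun t => ∫⁻ s, ({z : ℝ × ℝ | z.2 ∈ Ioc (z.1 - 2 * h) (z.1 - h)}.indicator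
        (fun z => A z.2 ^ (2 : ℝ)) (t, s)) := by
      ext t
      simp only [he]
      rw [← lintegral_indicator measurableSet_Ioc]
      rfl
    rw [h1]
    refine Measurable.lintegral_prod_right' ((hA2.comp measurable_snd).indicator ?_)
    exact (measurableSet_lt (f := fun z : ℝ × ℝ => z.1 - 2 * h) (by fun_prop) measurable_snd).inter
      (measurableSet_le (g := fun z : ℝ × ℝ => z.1 - h) measurable_snd (by fun_prop))
  rw [hS.windowForm_Ico_eq hFm G hh.le (by linarith)]
  have h2 : (2 : ℝ).HolderConjugate 2 := by rw [Real.holderConjugate_iff]; norm_num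
  calc _ ≤ ∫⁻ t, B t * (b₂ * (c * e t) ^ (1 / 2 : ℝ)) := by
        refine (enorm_integral_le_lintegral_enorm _).trans (lintegral_mono fun t => ?_)
        refine (enorm_inner_le_eLpNorm_two _ _).trans ?_
        rw [eLpNorm_lp_two (S h _), ← mul_assoc,
          mul_comm (B t)]
        gcongr
        · exact hG.two_le t
        · refine (enorm_le_iff_norm_le.2 (hS.norm_le _ _)).trans ?_
          rw [one_div, ENNReal.le_rpow_inv_iff two_pos]
          exact hS.enorm_duhamel_sq_le_of_weighted hα hK hh hF hFm t
    _ ≤ (∫⁻ t, B t ^ (2 : ℝ)) ^ (1 / 2 : ℝ) *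
        (∫⁻ t, (b₂ * (c * e t) ^ (1 / 2 : ℝ)) ^ (2 : ℝ)) ^ (1 / 2 : ℝ) :=
        ENNReal.lintegral_mul_le_Lp_mul_Lq _ h2 hG.meas.aemeasurable (by fun_prop)
    _ = (∫⁻ t, B t ^ (2 : ℝ)) ^ (1 / 2 : ℝ) *
        (b₂ ^ (2 : ℝ) * (c * (ENNReal.ofReal h * ∫⁻ t, A t ^ (2 : ℝ)))) ^ (1 / 2 : ℝ) := by
        rw [← lintegral_window hA2, ← lintegral_const_mul _ hem, ← lintegral_const_mul _ (by fun_prop)]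
        congr 2
        refine lintegral_congr fun t => ?_
        rw [ENNReal.mul_rpow_of_nonneg _ _ zero_le_two, ← ENNReal.rpow_mul]
        norm_num
    _ = _ := by
        have h12 : (0 : ℝ) ≤ 1 / 2 := by norm_num
        have hsq : ∀ x : ℝ≥0∞, (x ^ (2 : ℝ)) ^ (1 / 2 : ℝ) = x := fun x => by
          rw [← ENNReal.rpow_mul]; norm_num
        rw [hc]
        simp only [ENNReal.mul_rpow_of_nonneg _ _ h12, hsq]
        have hconst : ENNReal.ofReal (4 * K ^ (1 / (2 * α)) * h ^ (1 / 2 : ℝ)) ^ (1 / 2 : ℝ) *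
            ENNReal.ofReal h ^ (1 / 2 : ℝ) =
            ENNReal.ofReal (2 * K ^ (1 / (4 * α)) * h ^ (3 / 4 : ℝ)) := by
          rw [ENNReal.ofReal_rpow_of_nonneg (by positivity) h12,
            ENNReal.ofReal_rpow_of_nonneg hh.le h12, ← ENNReal.ofReal_mul (by positivity),
            Real.mul_rpow (by positivity) (by positivity), Real.mul_rpow (by positivity) (by positivity),
            ← Real.rpow_mul hK.le, ← Real.rpow_mul hh.le, mul_assoc, ← Real.rpow_add hh]
          congr 3
          · rw [show (4 : ℝ) = 2 ^ (2 : ℝ) by norm_num, ← Real.rpow_mul zero_le_two]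
            norm_num
          · congr 1; field_simp; norm_num
          · norm_num
        rw [← hconst]
        ring

theorem IsWeighted.reflect {T : ℝ} (hF : IsWeighted A a₁ a₂ F) :
    IsWeighted (fun t => A (T - t)) a₁ a₂ fun t => F (T - t) where
  meas := hF.meas.comp (by fun_prop)
  one_le s := hF.one_le _
  two_le s := hF.two_le _

/-- The transpose of the preceding bound under time reversal; now only the `L²` bound of `F` is
used. -/
theorem IsDispersive.enorm_windowForm_le_energy' (hS : IsDispersive α K S) (hα : 1 / 2 ≤ α)
    (hK : 0 < K) {h T : ℝ} (hh : 0 < h) (hF : IsWeighted A a₁ a₂ F) (hG : IsWeighted B b₁ b₂ G)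
    (hFm : IsBddSupp T F) (hGm : IsBddSupp T G) :
    ‖windowForm (Ico h (2 * h)) S F G‖ₑ ≤
      ENNReal.ofReal (2 * K ^ (1 / (4 * α)) * h ^ (3 / 4 : ℝ)) *
        (b₁ ^ (1 / (2 * α)) * b₂ ^ (1 - 1 / (2 * α)) * a₂) *
      ((∫⁻ x, A x ^ (2 : ℝ)) ^ (1 / 2 : ℝ) * (∫⁻ x, B x ^ (2 : ℝ)) ^ (1 / 2 : ℝ)) := by
  rw [← hS.windowForm_reflect measurableSet_Ico hFm hGm]
  refine (hS.adjoint.enorm_windowForm_le_energy hα hK hh hG.reflect hF.reflect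
    hGm.reflect.toIsBddMeas).trans (le_of_eq ?_)
  rw [lintegral_sub_left_eq_self (fun x => A x ^ (2 : ℝ)) T,
    lintegral_sub_left_eq_self (fun x => B x ^ (2 : ℝ)) T, mul_comm (_ ^ (1 / 2 : ℝ)) (_ ^ (1 / 2 : ℝ))]

end Window

/-! ### Decomposition of the form in time and in the sources. -/

section Sums

variable {H : Type*} [NormedAddCommGroup H] [InnerProductSpace ℂ H]
variable {S : ℝ → H →L[ℂ] H} {T : ℝ}

theorem IsContractionSemigroup.windowForm_eq_integral_prod (hS : IsContractionSemigroup S)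
    {W : Set ℝ} (hW : MeasurableSet W) {F G : ℝ → H} (hF : IsBddSupp T F) (hG : IsBddSupp T G) :
    windowForm W S F G = ∫ z : ℝ × ℝ,
      W.indicator (fun τ => inner ℂ (G z.1) (S τ (F z.2))) (z.1 - z.2) :=
  (integral_prod _ (hS.integrable_window hW hF hG)).symm

theorem IsContractionSemigroup.windowForm_sum (hS : IsContractionSemigroup S) {ι κ : Type*}
    {W : Set ℝ} (hW : MeasurableSet W) (s : Finset ι) (s' : Finset κ) {F : ι → ℝ → H}
    {G : κ → ℝ → H} (hF : ∀ k, IsBddSupp T (F k)) (hG : ∀ k, IsBddSupp T (G k))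
    (hFs : IsBddSupp T fun x => ∑ k ∈ s, F k x) (hGs : IsBddSupp T fun x => ∑ l ∈ s', G l x) :
    windowForm W S (fun x => ∑ k ∈ s, F k x) (fun x => ∑ l ∈ s', G l x) =
      ∑ k ∈ s, ∑ l ∈ s', windowForm W S (F k) (G l) := by
  rw [hS.windowForm_eq_integral_prod hW hFs hGs]
  simp only [fun k l => hS.windowForm_eq_integral_prod hW (hF k) (hG l)]
  rw [Finset.sum_congr rfl fun k _ => (integral_finsetSum s' fun l _ =>
      hS.integrable_window hW (hF k) (hG l)).symm,
    ← integral_finsetSum s fun k _ => integrable_finsetSum s' fun l _ =>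
      hS.integrable_window hW (hF k) (hG l)]
  refine integral_congr_ae (.of_forall fun z => ?_)
  by_cases hz : z.1 - z.2 ∈ W
  · simp only [indicator_of_mem hz, map_sum, inner_sum, sum_inner]
  · simp only [indicator_of_notMem hz, Finset.sum_const_zero]

theorem sum_indicator_dyadic (n : ℕ) (f : ℝ → ℂ) (x : ℝ) :
    ∑ j ∈ Finset.Ico (-n : ℤ) n, (Ico ((2 : ℝ) ^ j) (2 * 2 ^ j)).indicator f x =
      (Ico ((2 : ℝ) ^ (-n : ℤ)) (2 ^ (n : ℤ))).indicator f x := by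
  have h : ∀ m : ℕ, ∑ j ∈ Finset.Ico (-n : ℤ) (-n + m),
      (Ico ((2 : ℝ) ^ j) (2 * 2 ^ j)).indicator f x =
      (Ico ((2 : ℝ) ^ (-n : ℤ)) (2 ^ (-n + m : ℤ))).indicator f x := fun m => by
    induction m with
    | zero => simp
    | succ m ih =>
      have h1 : (2 : ℝ) ^ (-n : ℤ) ≤ 2 ^ (-n + m : ℤ) := zpow_le_zpow_right₀ one_le_two (by lia)
      have h2 : (2 : ℝ) ^ (-n + (m + 1 : ℕ) : ℤ) = 2 * 2 ^ (-n + m : ℤ) := by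
        rw [Nat.cast_succ, ← add_assoc, zpow_add_one₀ two_ne_zero, mul_comm]
      have h3 : (2 : ℝ) ^ (-n + m : ℤ) ≤ 2 * 2 ^ (-n + m : ℤ) := by
        have : (0 : ℝ) < 2 ^ (-n + m : ℤ) := by positivity
        linarith
      have h4 : Finset.Ico (-n : ℤ) (-n + (m + 1 : ℕ)) =
          insert (-n + m : ℤ) (Finset.Ico (-n : ℤ) (-n + m)) := by
        ext j; simp only [Finset.mem_Ico, Finset.mem_insert]; lia
      rw [h4, Finset.sum_insert (by simp), ih, h2, ← Ico_union_Ico_eq_Ico h1 h3,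
        indicator_union_of_disjoint (Ico_disjoint_Ico_same), add_comm]
  have := h (2 * n)
  rwa [show (-n + (2 * n : ℕ) : ℤ) = n by push_cast; ring] at this

theorem IsContractionSemigroup.windowForm_Ico_zpow (hS : IsContractionSemigroup S) (n : ℕ)
    {F G : ℝ → H} (hF : IsBddSupp T F) (hG : IsBddSupp T G) :
    windowForm (Ico ((2 : ℝ) ^ (-n : ℤ)) (2 ^ (n : ℤ))) S F G =
      ∑ j ∈ Finset.Ico (-n : ℤ) n, windowForm (Ico ((2 : ℝ) ^ j) (2 * 2 ^ j)) S F G := by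
  simp only [fun a b => hS.windowForm_eq_integral_prod (measurableSet_Ico (a := a) (b := b)) hF hG]
  rw [← integral_finsetSum _ fun j _ => hS.integrable_window measurableSet_Ico hF hG]
  exact integral_congr_ae (.of_forall fun z => (sum_indicator_dyadic n _ _).symm)

/-- Dominated convergence with the constant `N M` on `(0, T)²`. The same `n` exhausts the time
differences and sums the pieces, so each approximant is a finite triple sum. -/
theorem IsContractionSemigroup.tendsto_windowForm_Ico (hS : IsContractionSemigroup S)
    {F G : ℝ → H} {f g : ℕ → ℝ → H} {M N : ℝ} (hF : IsBddSupp T F) (hG : IsBddSupp T G)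
    (hf : ∀ n, IsBddSupp T (f n)) (hg : ∀ n, IsBddSupp T (g n)) (hM : ∀ n s, ‖f n s‖ ≤ M)
    (hN : ∀ n s, ‖g n s‖ ≤ N) (hfF : ∀ᵐ s, Tendsto (fun n => f n s) atTop (𝓝 (F s)))
    (hgG : ∀ᵐ s, Tendsto (fun n => g n s) atTop (𝓝 (G s))) :
    Tendsto (fun n : ℕ => windowForm (Ico ((2 : ℝ) ^ (-n : ℤ)) (2 ^ (n : ℤ))) S (f n) (g n)) atTop
      (𝓝 (windowForm (Ioi 0) S F G)) := by
  have hM0 : 0 ≤ M := (norm_nonneg _).trans (hM 0 0)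
  have hN0 : 0 ≤ N := (norm_nonneg _).trans (hN 0 0)
  rw [hS.windowForm_eq_integral_prod measurableSet_Ioi hF hG]
  simp only [fun n a b => hS.windowForm_eq_integral_prod (measurableSet_Ico (a := a) (b := b))
    (hf n) (hg n)]
  refine tendsto_integral_of_dominated_convergence
    ((Ioo 0 T ×ˢ Ioo 0 T).indicator fun _ => N * M)
    (fun n => (hS.integrable_window measurableSet_Ico (hf n) (hg n)).1) ?_
    (fun n => .of_forall fun z => ?_) ?_
  · refine (integrable_indicator_iff (measurableSet_Ioo.prod measurableSet_Ioo)).2 ?_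
    refine integrableOn_const ?_
    rw [Measure.volume_eq_prod, Measure.prod_prod]
    exact ENNReal.mul_ne_top (by simp) (by simp)
  · by_cases h1 : z.1 ∈ Ioo 0 T
    · by_cases h2 : z.2 ∈ Ioo 0 T
      · rw [indicator_of_mem (show z ∈ Ioo 0 T ×ˢ Ioo 0 T from ⟨h1, h2⟩)]
        refine (norm_indicator_le_norm_self _ _).trans ((norm_inner_le_norm _ _).trans ?_)
        gcongr
        · exact hN n _
        · exact (hS.norm_le _ _).trans (hM n _)
      · rw [(hf n).supp _ h2]
        simpa using indicator_nonneg (fun _ _ => mul_nonneg hN0 hM0) z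
    · rw [(hg n).supp _ h1]
      simpa using indicator_nonneg (fun _ _ => mul_nonneg hN0 hM0) z
  · have h1 : ∀ᵐ z : ℝ × ℝ, Tendsto (fun n => f n z.2) atTop (𝓝 (F z.2)) :=
      Measure.quasiMeasurePreserving_snd.ae hfF
    have h2 : ∀ᵐ z : ℝ × ℝ, Tendsto (fun n => g n z.1) atTop (𝓝 (G z.1)) :=
      Measure.quasiMeasurePreserving_fst.ae hgG
    filter_upwards [h1, h2] with z hz1 hz2
    by_cases hz : z.1 - z.2 ∈ Ioi 0
    · rw [indicator_of_mem hz]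
      have e1 : ∀ᶠ n : ℕ in atTop, (2 : ℝ) ^ (-n : ℤ) ≤ z.1 - z.2 := by
        have : Tendsto (fun n : ℕ => ((1 : ℝ) / 2) ^ n) atTop (𝓝 0) :=
          tendsto_pow_atTop_nhds_zero_of_lt_one (by norm_num) (by norm_num)
        filter_upwards [this.eventually_le_const hz] with n hn
        rw [zpow_neg, zpow_natCast, ← inv_pow]
        simpa using hn
      have e2 : ∀ᶠ n : ℕ in atTop, z.1 - z.2 < (2 : ℝ) ^ (n : ℤ) := by
        filter_upwards [(tendsto_pow_atTop_atTop_of_one_lt (one_lt_two (α := ℝ))).eventually_gt_atTop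
          (z.1 - z.2)] with n hn
        simpa using hn
      refine (hz2.inner (((S (z.1 - z.2)).continuous.tendsto _).comp hz1)).congr' ?_
      filter_upwards [e1, e2] with n h1 h2
      rw [indicator_of_mem (show z.1 - z.2 ∈ Ico _ _ from ⟨h1, h2⟩)]
      rfl
    · rw [indicator_of_notMem hz]
      refine tendsto_const_nhds.congr fun n => ?_
      rw [indicator_of_notMem]
      exact fun h => hz (lt_of_lt_of_le (by positivity) h.1)

end Sums

/-! ### Dyadic pieces of functions of time. -/

section Pieces

variable {X : Type*} [MeasurableSpace X] {μ : Measure X}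

theorem isWeighted_piece (p : ℝ) (k : ℤ) {F : ℝ → Lp ℂ 2 μ} (hF : StronglyMeasurable F) :
    IsWeighted (fun s => pieceWeight p k (F s)) (ENNReal.ofReal ((2 : ℝ) ^ (k * (1 - p))))
      (ENNReal.ofReal ((2 : ℝ) ^ (k * (1 - p / 2)))) fun s => piece p k (F s) where
  meas := measurable_pieceWeight p k hF
  one_le _ := eLpNorm_piece_one_le p k _
  two_le _ := eLpNorm_piece_two_le p k _

theorem isBddSupp_piece (p : ℝ) (k : ℤ) {T : ℝ} {F : ℝ → Lp ℂ 2 μ} (hF : IsBddSupp T F) :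
    IsBddSupp T fun s => piece p k (F s) where
  meas := stronglyMeasurable_piece p k hF.meas
  bdd := by
    obtain ⟨M, hM0, hM⟩ := hF.bdd
    exact ⟨4 * M, by positivity, fun s => (norm_piece_le p k _).trans (by gcongr; exact hM s)⟩
  supp s hs := by simpa [hF.supp s hs] using norm_piece_le p k (F s)

theorem isBddSupp_sum_piece (p : ℝ) (n : ℕ) {T : ℝ} {F : ℝ → Lp ℂ 2 μ} (hF : IsBddSupp T F) :
    IsBddSupp T fun s => ∑ k ∈ Finset.Ico (-n : ℤ) n, piece p k (F s) where
  meas := Finset.stronglyMeasurable_fun_sum _ fun k _ => stronglyMeasurable_piece p k hF.meas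
  bdd := by
    obtain ⟨M, hM0, hM⟩ := hF.bdd
    exact ⟨4 * M, by positivity, fun s => (norm_sum_piece_le p n _).trans (by gcongr; exact hM s)⟩
  supp s hs := by simpa [hF.supp s hs] using norm_sum_piece_le p n (F s)

end Pieces

/-! ### The endpoint `q = 2`. -/

section Endpoint

/-- Put `N = |x| + |y| = max(|x+y|, |x-y|)` and note that the smaller of `x + 2y` and `2x + y` is
`(3(x+y) - |x-y|)/2`. If `x + y < N/5`, then either `|x-y| = N`, and this minimum is below `(3N/5 -
N)/2 = -N/5`, or `x + y = -N`, and it is at most `-3N/2`. The constant `1/5` is where the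
alternatives balance. -/
theorem endpoint_exponent_cases (x y : ℝ) : (|x| + |y|) / 5 ≤ x + y ∨
    x + 2 * y ≤ -((|x| + |y|) / 5) ∨ 2 * x + y ≤ -((|x| + |y|) / 5) := by
  by_contra! h
  obtain ⟨h1, h2, h3⟩ := h
  rcases abs_cases x with ⟨hx, -⟩ | ⟨hx, -⟩ <;> rcases abs_cases y with ⟨hy, -⟩ | ⟨hy, -⟩ <;>
    rw [hx, hy] at h1 h2 h3 <;> linarith

/-- For fixed `k`, sum over `l` first, uniformly in `j`, and then over `j`; each is a two-sided
geometric sum with a displaced peak. -/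
theorem exists_tsum_tsum_geometric_le {ε c p : ℝ} (hε : 0 < ε) (hc : 0 < c) (hp : 0 < p) :
    ∃ W : NNReal, ∀ k : ℤ, ∑' l : ℤ, ∑' j : ℤ,
      ENNReal.ofReal ((2 : ℝ) ^ (-(ε * (|j * c + k * p| + |j * c + l * p|)))) ≤ W := by
  obtain ⟨V, hV⟩ := exists_tsum_geometric_le hε hc
  obtain ⟨U, hU⟩ := exists_tsum_geometric_le hε hp
  refine ⟨V * U, fun k => ?_⟩
  rw [ENNReal.tsum_comm]
  calc _ = ∑' j : ℤ, ENNReal.ofReal ((2 : ℝ) ^ (-(ε * |k * p + c * j|))) *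
        ∑' l : ℤ, ENNReal.ofReal ((2 : ℝ) ^ (-(ε * |j * c + p * l|))) := by
        refine tsum_congr fun j => ?_
        rw [← ENNReal.tsum_mul_left]
        refine tsum_congr fun l => ?_
        rw [ofReal_two_rpow_mul, add_comm ((k : ℝ) * p), mul_comm c, mul_comm p]
        congr 2; ring
    _ ≤ ∑' j : ℤ, ENNReal.ofReal ((2 : ℝ) ^ (-(ε * |k * p + c * j|))) * U := by
        gcongr; exact hU _
    _ ≤ _ := by
        rw [ENNReal.tsum_mul_right, ENNReal.coe_mul]
        gcongr; exact hV _

/-- In the variables `x = jα + kp` and `y = jα + lp`, the decay bound has exponent `-(α-1)/(2α) · (x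
+ y)`, and the two energy bounds have `(x + 2y)/(4α)` and `(2x + y)/(4α)`. One of the three is
always sufficiently negative; `ε` is a fifth of the smaller of the coefficients `(α-1)/(2α)` and
`1/(4α)`. Its positivity needs `α > 1`, which is why `α = 1` is excluded at the endpoint. -/
theorem enorm_windowForm_piece_le {X : Type*} [MeasurableSpace X] {μ : Measure X} {α K T : ℝ}
    (hα : 1 < α) (hK : 0 < K) {S : ℝ → Lp ℂ 2 μ →L[ℂ] Lp ℂ 2 μ} (hS : IsDispersive α K S)
    {F G : ℝ → Lp ℂ 2 μ} (hF : IsBddSupp T F) (hG : IsBddSupp T G) {p ε : ℝ}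
    (hp : p = 2 * α / (α + 1)) (hε : ε = min (1 / (20 * α)) ((α - 1) / (10 * α))) (j k l : ℤ) :
    ‖windowForm (Ico ((2 : ℝ) ^ j) (2 * 2 ^ j)) S (fun s => piece p k (F s))
        (fun s => piece p l (G s))‖ₑ ≤
      ENNReal.ofReal (K + 2 * K ^ (1 / (4 * α))) *
        ENNReal.ofReal ((2 : ℝ) ^ (-(ε * (|j * α + k * p| + |j * α + l * p|)))) *
        ((∫⁻ s, pieceWeight p k (F s) ^ (2 : ℝ)) ^ (1 / 2 : ℝ) *
          (∫⁻ s, pieceWeight p l (G s) ^ (2 : ℝ)) ^ (1 / 2 : ℝ)) := by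
  have hα0 : 0 < α := by linarith
  have hα1 : 0 < α + 1 := by linarith
  have hh : (0 : ℝ) < 2 ^ j := by positivity
  have hjr : (2 : ℝ) ^ j = (2 : ℝ) ^ (j : ℝ) := (Real.rpow_intCast 2 j).symm
  have e0 : 1 - p = -((α - 1) / (2 * α)) * p := by rw [hp]; field_simp; ring
  have e1 : 1 - p / 2 = 1 / (2 * α) * p := by rw [hp]; field_simp; ring
  set x : ℝ := j * α + k * p with hx
  set y : ℝ := j * α + l * p with hy
  have hxy : 0 ≤ |x| + |y| := by positivity
  have hε1 : ε ≤ 1 / (4 * α) / 5 := by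
    rw [hε]; refine (min_le_left _ _).trans (le_of_eq ?_); field_simp; norm_num
  have hε2 : ε ≤ (α - 1) / (2 * α) / 5 := by
    rw [hε]; refine (min_le_right _ _).trans (le_of_eq ?_); field_simp; ring
  have hwF := isWeighted_piece p k hF.meas
  have hwG := isWeighted_piece p l hG.meas
  have hbF := isBddSupp_piece p k hF
  have hbG := isBddSupp_piece p l hG
  have key : ∀ c e : ℝ, c ≤ K + 2 * K ^ (1 / (4 * α)) → 0 ≤ c → e ≤ -(ε * (|x| + |y|)) →
      ENNReal.ofReal c * ENNReal.ofReal ((2 : ℝ) ^ e) *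
        ((∫⁻ s, pieceWeight p k (F s) ^ (2 : ℝ)) ^ (1 / 2 : ℝ) *
          (∫⁻ s, pieceWeight p l (G s) ^ (2 : ℝ)) ^ (1 / 2 : ℝ)) ≤
      ENNReal.ofReal (K + 2 * K ^ (1 / (4 * α))) *
        ENNReal.ofReal ((2 : ℝ) ^ (-(ε * (|x| + |y|)))) *
        ((∫⁻ s, pieceWeight p k (F s) ^ (2 : ℝ)) ^ (1 / 2 : ℝ) *
          (∫⁻ s, pieceWeight p l (G s) ^ (2 : ℝ)) ^ (1 / 2 : ℝ)) := fun c e hc _ he => by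
    gcongr
    norm_num
  have hK4 : 0 < K ^ (1 / (4 * α)) := by positivity
  rcases endpoint_exponent_cases x y with h | h | h
  · refine le_trans (le_of_le_of_eq
      (hS.enorm_windowForm_le_decay hα0 hK hh hwF hwG) ?_) (key K
        (-((α - 1) / (2 * α)) * (x + y)) (by linarith) hK.le ?_)
    · rw [hjr, ← Real.rpow_mul two_pos.le, mul_assoc K, ← Real.rpow_add two_pos,
        ENNReal.ofReal_mul hK.le, ofReal_two_rpow_mul, mul_assoc (ENNReal.ofReal K),
        ofReal_two_rpow_mul, e0]
      congr 4
      rw [hx, hy]; field_simp; ring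
    · have h1 : (α - 1) / (2 * α) * ((|x| + |y|) / 5) ≤ (α - 1) / (2 * α) * (x + y) :=
        mul_le_mul_of_nonneg_left h (div_nonneg (by linarith) (by linarith))
      nlinarith
  · refine le_trans (le_of_le_of_eq
      (hS.enorm_windowForm_le_energy (by linarith) hK hh hwF hwG hbF.toIsBddMeas) ?_)
        (key (2 * K ^ (1 / (4 * α))) (1 / (4 * α) * (x + 2 * y)) (by linarith) (by positivity) ?_)
    · rw [hjr, ← Real.rpow_mul two_pos.le, ENNReal.ofReal_mul (by positivity),
        ofReal_two_rpow_rpow, ofReal_two_rpow_rpow, ofReal_two_rpow_mul, ofReal_two_rpow_mul,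
        mul_assoc (ENNReal.ofReal (2 * K ^ (1 / (4 * α)))), ofReal_two_rpow_mul, e0, e1]
      congr 4
      rw [hx, hy]; field_simp; ring
    · have h1 : 1 / (4 * α) * (x + 2 * y) ≤ 1 / (4 * α) * (-((|x| + |y|) / 5)) :=
        mul_le_mul_of_nonneg_left h (by positivity)
      nlinarith
  · refine le_trans (le_of_le_of_eq
      (hS.enorm_windowForm_le_energy' (by linarith) hK hh hwF hwG hbF hbG) ?_)
        (key (2 * K ^ (1 / (4 * α))) (1 / (4 * α) * (2 * x + y)) (by linarith) (by positivity) ?_)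
    · rw [hjr, ← Real.rpow_mul two_pos.le, ENNReal.ofReal_mul (by positivity),
        ofReal_two_rpow_rpow, ofReal_two_rpow_rpow, ofReal_two_rpow_mul, ofReal_two_rpow_mul,
        mul_assoc (ENNReal.ofReal (2 * K ^ (1 / (4 * α)))), ofReal_two_rpow_mul, e0, e1]
      congr 4
      rw [hx, hy]; field_simp; ring
    · have h1 : 1 / (4 * α) * (2 * x + y) ≤ 1 / (4 * α) * (-((|x| + |y|) / 5)) :=
        mul_le_mul_of_nonneg_left h (by positivity)
      nlinarith

theorem ae_eq_zero_of_lintegral_eLpNorm_eq_zero {X : Type*} [MeasurableSpace X] {μ : Measure X}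
    {F : ℝ → Lp ℂ 2 μ} (hF : StronglyMeasurable F) {P : ℝ≥0∞} (hP : P ≠ 0)
    (h : ∫⁻ s, eLpNorm (F s) P μ ^ (2 : ℝ) = 0) : ∀ᵐ s, F s = 0 := by
  rw [lintegral_eq_zero_iff ((measurable_eLpNorm_comp hF P).pow_const _)] at h
  filter_upwards [h] with s hs
  exact eq_zero_of_eLpNorm_eq_zero hP (by simpa using hs)

/-- The endpoint estimate of Keel and Tao. -/
theorem exists_enorm_windowForm_le_endpoint {α K : ℝ} (hα : 1 < α) (hK : 0 < K) : ∃ C : NNReal,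
    ∀ {X : Type u} [MeasurableSpace X] {μ : Measure X} {S : ℝ → Lp ℂ 2 μ →L[ℂ] Lp ℂ 2 μ},
      IsDispersive α K S → ∀ {T : ℝ} {F G : ℝ → Lp ℂ 2 μ}, IsBddSupp T F → IsBddSupp T G →
      ‖windowForm (Ioi 0) S F G‖ₑ ≤ C *
        ((∫⁻ s, eLpNorm (F s) (ENNReal.ofReal (2 * α / (α + 1))) μ ^ (2 : ℝ)) ^ (1 / 2 : ℝ) *
          (∫⁻ s, eLpNorm (G s) (ENNReal.ofReal (2 * α / (α + 1))) μ ^ (2 : ℝ)) ^ (1 / 2 : ℝ)) := by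
  have hα0 : 0 < α := by linarith
  set p := 2 * α / (α + 1) with hp
  have hp0 : 0 < p := by positivity
  set ε := min (1 / (20 * α)) ((α - 1) / (10 * α)) with hε
  have hε0 : 0 < ε := lt_min (by positivity) (div_pos (by linarith) (by positivity))
  obtain ⟨W, hW⟩ := exists_tsum_tsum_geometric_le hε0 hα0 hp0
  obtain ⟨D, hD⟩ := exists_tsum_pieceWeight_le.{u} hp0
  set C₀ := (K + 2 * K ^ (1 / (4 * α))).toNNReal with hC₀
  refine ⟨C₀ * (W * D) + 1, fun {X} _ {μ} {S} hS {T F G} hF hG => ?_⟩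
  set P := ENNReal.ofReal p with hP
  have hP0 : P ≠ 0 := by simpa [hP] using hp0
  have hwin := hS.windowForm_eq_integral_prod (measurableSet_Ioi (a := (0 : ℝ))) hF hG
  by_cases hF0 : ∫⁻ s, eLpNorm (F s) P μ ^ (2 : ℝ) = 0
  · have h : ∀ᵐ z : ℝ × ℝ, F z.2 = 0 := Measure.quasiMeasurePreserving_snd.ae
      (ae_eq_zero_of_lintegral_eLpNorm_eq_zero hF.meas hP0 hF0)
    rw [hwin, integral_eq_zero_of_ae]
    · simp
    · filter_upwards [h] with z hz
      simp [hz]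
  by_cases hG0 : ∫⁻ s, eLpNorm (G s) P μ ^ (2 : ℝ) = 0
  · have h : ∀ᵐ z : ℝ × ℝ, G z.1 = 0 := Measure.quasiMeasurePreserving_fst.ae
      (ae_eq_zero_of_lintegral_eLpNorm_eq_zero hG.meas hP0 hG0)
    rw [hwin, integral_eq_zero_of_ae]
    · simp
    · filter_upwards [h] with z hz
      simp [hz]
  have hpow0 : ∀ x : ℝ≥0∞, x ≠ 0 → x ^ (1 / 2 : ℝ) ≠ 0 := fun x hx => by simp [hx]
  by_cases hFt : ∫⁻ s, eLpNorm (F s) P μ ^ (2 : ℝ) = ∞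
  · rw [hFt, ENNReal.top_rpow_of_pos (by norm_num), ENNReal.top_mul (hpow0 _ hG0), ENNReal.mul_top]
    · exact le_top
    · simp
  by_cases hGt : ∫⁻ s, eLpNorm (G s) P μ ^ (2 : ℝ) = ∞
  · rw [hGt, ENNReal.top_rpow_of_pos (by norm_num), ENNReal.mul_top (hpow0 _ hF0), ENNReal.mul_top]
    · exact le_top
    · simp
  have hfin : ∀ {F : ℝ → Lp ℂ 2 μ}, StronglyMeasurable F →
      ∫⁻ s, eLpNorm (F s) P μ ^ (2 : ℝ) ≠ ∞ → ∀ᵐ s, Tendsto (fun n : ℕ =>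
        ∑ k ∈ Finset.Ico (-n : ℤ) n, piece p k (F s)) atTop (𝓝 (F s)) := fun hF h => by
    filter_upwards [ae_lt_top ((measurable_eLpNorm_comp hF P).pow_const _) h] with s hs
    exact tendsto_sum_piece hp0 (by simpa using hs.ne)
  obtain ⟨M, hM0, hM⟩ := hF.bdd
  obtain ⟨N, hN0, hN⟩ := hG.bdd
  have hlim := hS.tendsto_windowForm_Ico hF hG (fun n => isBddSupp_sum_piece p n hF)
    (fun n => isBddSupp_sum_piece p n hG)
    (fun n s => (norm_sum_piece_le p n _).trans (mul_le_mul_of_nonneg_left (hM s) (by norm_num)))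
    (fun n s => (norm_sum_piece_le p n _).trans (mul_le_mul_of_nonneg_left (hN s) (by norm_num)))
    (hfin hF.meas hFt) (hfin hG.meas hGt)
  set a : ℤ → ℝ≥0∞ := fun k => (∫⁻ s, pieceWeight p k (F s) ^ (2 : ℝ)) ^ (1 / 2 : ℝ) with ha
  set b : ℤ → ℝ≥0∞ := fun k => (∫⁻ s, pieceWeight p k (G s) ^ (2 : ℝ)) ^ (1 / 2 : ℝ) with hb
  -- After summation over the windows `j`, what is left is a symmetric kernel in the heights with
  -- bounded row sums, as Schur's test asks.
  set w : ℤ → ℤ → ℝ≥0∞ := fun k l => ∑' j : ℤ,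
    ENNReal.ofReal ((2 : ℝ) ^ (-(ε * (|j * α + k * p| + |j * α + l * p|)))) with hw
  have hsq : ∀ {F : ℝ → Lp ℂ 2 μ}, StronglyMeasurable F →
      (∑' k : ℤ, ((∫⁻ s, pieceWeight p k (F s) ^ (2 : ℝ)) ^ (1 / 2 : ℝ)) ^ (2 : ℝ)) ^ (1 / 2 : ℝ) ≤
      (D : ℝ≥0∞) ^ (1 / 2 : ℝ) * (∫⁻ s, eLpNorm (F s) P μ ^ (2 : ℝ)) ^ (1 / 2 : ℝ) := fun {F} hF => by
    rw [← ENNReal.mul_rpow_of_nonneg _ _ (by norm_num)]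
    gcongr
    rw [← lintegral_const_mul _ ((measurable_eLpNorm_comp hF P).pow_const _)]
    calc _ = ∑' k : ℤ, ∫⁻ s, pieceWeight p k (F s) ^ (2 : ℝ) := by
          refine tsum_congr fun k => ?_
          rw [← ENNReal.rpow_mul]; norm_num
      _ = ∫⁻ s, ∑' k : ℤ, pieceWeight p k (F s) ^ (2 : ℝ) :=
          (lintegral_tsum fun k => ((measurable_pieceWeight p k hF).pow_const _).aemeasurable).symm
      _ ≤ _ := lintegral_mono fun s => hD (F s)
  refine le_of_tendsto' hlim.enorm fun n => ?_
  rw [hS.windowForm_Ico_zpow n (isBddSupp_sum_piece p n hF) (isBddSupp_sum_piece p n hG)]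
  calc _ ≤ ∑ j ∈ Finset.Ico (-n : ℤ) n, ∑ k ∈ Finset.Ico (-n : ℤ) n, ∑ l ∈ Finset.Ico (-n : ℤ) n,
        C₀ * (ENNReal.ofReal ((2 : ℝ) ^ (-(ε * (|j * α + k * p| + |j * α + l * p|)))) *
          (a k * b l)) := by
        refine (enorm_sum_le _ _).trans (Finset.sum_le_sum fun j _ => ?_)
        rw [hS.windowForm_sum measurableSet_Ico _ _ (fun k => isBddSupp_piece p k hF)
          (fun k => isBddSupp_piece p k hG) (isBddSupp_sum_piece p n hF) (isBddSupp_sum_piece p n hG)]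
        refine (enorm_sum_le _ _).trans (Finset.sum_le_sum fun k _ => ?_)
        refine (enorm_sum_le _ _).trans (Finset.sum_le_sum fun l _ => ?_)
        rw [← mul_assoc]
        exact enorm_windowForm_piece_le hα hK hS hF hG hp hε j k l
    _ ≤ ∑' j : ℤ, ∑' k : ℤ, ∑' l : ℤ,
        C₀ * (ENNReal.ofReal ((2 : ℝ) ^ (-(ε * (|j * α + k * p| + |j * α + l * p|)))) *
          (a k * b l)) :=
        (Finset.sum_le_sum fun j _ => (Finset.sum_le_sum fun k _ => ENNReal.sum_le_tsum _).trans
          (ENNReal.sum_le_tsum _)).trans (ENNReal.sum_le_tsum _)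
    _ = C₀ * ∑' k : ℤ, ∑' l : ℤ, w k l * (a k * b l) := by
        simp only [ENNReal.tsum_mul_left]
        congr 1
        rw [ENNReal.tsum_comm]
        refine tsum_congr fun k => ?_
        rw [ENNReal.tsum_comm]
        refine tsum_congr fun l => ?_
        rw [ENNReal.tsum_mul_right]
    _ ≤ C₀ * (W * ((∑' k, a k ^ (2 : ℝ)) ^ (1 / 2 : ℝ) * (∑' l, b l ^ (2 : ℝ)) ^ (1 / 2 : ℝ))) := by
        gcongr
        refine tsum_tsum_schur_le hW (fun l => ?_) a b
        refine le_of_eq_of_le (tsum_congr fun k => tsum_congr fun j => ?_) (hW l)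
        rw [add_comm]
    _ ≤ C₀ * (W * (((D : ℝ≥0∞) ^ (1 / 2 : ℝ) *
          (∫⁻ s, eLpNorm (F s) P μ ^ (2 : ℝ)) ^ (1 / 2 : ℝ)) * ((D : ℝ≥0∞) ^ (1 / 2 : ℝ) *
          (∫⁻ s, eLpNorm (G s) P μ ^ (2 : ℝ)) ^ (1 / 2 : ℝ)))) := by
        gcongr
        · exact hsq hF.meas
        · exact hsq hG.meas
    _ = (C₀ * (W * D) : NNReal) * ((∫⁻ s, eLpNorm (F s) P μ ^ (2 : ℝ)) ^ (1 / 2 : ℝ) *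
          (∫⁻ s, eLpNorm (G s) P μ ^ (2 : ℝ)) ^ (1 / 2 : ℝ)) := by
        have hDD : (D : ℝ≥0∞) ^ (1 / 2 : ℝ) * (D : ℝ≥0∞) ^ (1 / 2 : ℝ) = D := by
          rw [← ENNReal.rpow_add_of_nonneg _ _ (by norm_num) (by norm_num)]; norm_num
        rw [ENNReal.coe_mul, ENNReal.coe_mul]
        nth_rewrite 3 [← hDD]
        ring
    _ ≤ _ := by
        gcongr
        exact le_self_add

end Endpoint

/-! ### Conjugate exponents. -/

section Exponents

theorem eq_ofReal_of_inv_toReal {x : ℝ≥0∞} {y : ℝ} (hx : x ≠ 0) (hy : 0 < y)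
    (h : (x⁻¹).toReal = y⁻¹) : x = ENNReal.ofReal y := by
  rw [← inv_inv x, ← ENNReal.ofReal_toReal (ENNReal.inv_ne_top.2 hx), h,
    ENNReal.ofReal_inv_of_pos hy, inv_inv]

theorem conjExponent_ne_zero {q : ℝ≥0∞} : q.conjExponent ≠ 0 := by
  simp [ENNReal.conjExponent]

theorem inv_conjExponent_toReal {q : ℝ≥0∞} (hq : 2 ≤ q) :
    (q.conjExponent⁻¹).toReal = 1 - (q⁻¹).toReal := by
  have hc : q.HolderConjugate q.conjExponent := .conjExponent (le_trans (by norm_num) hq)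
  have h := ENNReal.HolderConjugate.inv_add_inv_eq_one q q.conjExponent
  have h2 := congrArg ENNReal.toReal h
  rw [ENNReal.toReal_add (ENNReal.inv_ne_top.2 (lt_of_lt_of_le (by norm_num) hq).ne')
    (ENNReal.inv_ne_top.2 conjExponent_ne_zero), ENNReal.toReal_one] at h2
  linarith

theorem conjExponent_eq_ofReal {q : ℝ≥0∞} (hq : 2 ≤ q) {y : ℝ} (hy : 0 < y)
    (h : 1 - (q⁻¹).toReal = y⁻¹) : q.conjExponent = ENNReal.ofReal y :=
  eq_ofReal_of_inv_toReal conjExponent_ne_zero hy (by rw [inv_conjExponent_toReal hq, h])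

variable {X : Type*} [MeasurableSpace X] {μ : Measure X} {T : ℝ} {F : ℝ → Lp ℂ 2 μ}

theorem IsBddSupp.mixedNorm_ofReal (hF : IsBddSupp T F) {q : ℝ} (hq : 0 < q) (r : ℝ≥0∞) :
    mixedNorm (ENNReal.ofReal q) r (Ioo 0 T) F = (∫⁻ s, eLpNorm (F s) r μ ^ q) ^ (1 / q) := by
  rw [mixedNorm, eLpNorm_ennreal_eq (by simpa using hq) ENNReal.ofReal_ne_top,
    ENNReal.toReal_ofReal hq.le, ← lintegral_indicator measurableSet_Ioo]
  congr 1
  refine lintegral_congr fun s => ?_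
  by_cases hs : s ∈ Ioo 0 T
  · rw [indicator_of_mem hs]
  · rw [indicator_of_notMem hs, hF.supp s hs, eLpNorm_lp_zero, ENNReal.zero_rpow_of_pos hq]

end Exponents

/-! ### The retarded form on one dual admissible space. -/

section Diagonal

theorem IsDispersive.enorm_windowForm_le_top {X : Type*} [MeasurableSpace X] {μ : Measure X}
    {α K T : ℝ} {S : ℝ → Lp ℂ 2 μ →L[ℂ] Lp ℂ 2 μ} (hS : IsDispersive α K S) {F G : ℝ → Lp ℂ 2 μ}
    (hF : IsBddSupp T F) (hG : IsBddSupp T G) :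
    ‖windowForm (Ioi 0) S F G‖ₑ ≤
      mixedNorm (ENNReal.ofReal 1) 2 (Ioo 0 T) F * mixedNorm (ENNReal.ofReal 1) 2 (Ioo 0 T) G := by
  rw [hF.mixedNorm_ofReal one_pos, hG.mixedNorm_ofReal one_pos]
  have hFm := measurable_eLpNorm_comp hF.meas 2
  have hGm := measurable_eLpNorm_comp hG.meas 2
  refine (enorm_windowForm_le (f := fun s => eLpNorm (F s) 2 μ) (g := fun s => eLpNorm (G s) 2 μ)
    (k := fun _ => 1) (fun s t _ => ?_) hFm hGm measurable_const).trans (le_of_eq ?_)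
  · rw [mul_one, mul_comm]
    refine (enorm_inner_le_eLpNorm_two _ _).trans ?_
    gcongr 1
    rw [eLpNorm_lp_two, eLpNorm_lp_two]
    exact enorm_le_iff_norm_le.2 (hS.norm_le _ _)
  · simp only [mul_one, ENNReal.rpow_one, div_one]
    rw [← lintegral_mul_const _ hFm]
    exact lintegral_congr fun s => lintegral_const_mul _ hGm

theorem enorm_windowForm_le_of_powKernel {X : Type*} [MeasurableSpace X] {μ : Measure X} {l : ℝ}
    (hl : 0 < l) (hl1 : l < 1) {S : ℝ → Lp ℂ 2 μ →L[ℂ] Lp ℂ 2 μ} {P C : ℝ≥0∞}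
    (hS : ∀ τ, 0 < τ → ∀ f g : Lp ℂ 2 μ, ‖inner ℂ g (S τ f)‖ₑ ≤
      C * ENNReal.ofReal (τ ^ (-l)) * (eLpNorm g P μ * eLpNorm f P μ))
    {T : ℝ} {F G : ℝ → Lp ℂ 2 μ} (hF : IsBddSupp T F) (hG : IsBddSupp T G) :
    ‖windowForm (Ioi 0) S F G‖ₑ ≤ C * (2 * ENNReal.ofReal (1 / (1 - l) + 1)) *
      (mixedNorm (ENNReal.ofReal (2 / (2 - l))) P (Ioo 0 T) F *
        mixedNorm (ENNReal.ofReal (2 / (2 - l))) P (Ioo 0 T) G) := by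
  have hl2 : 0 < 2 / (2 - l) := div_pos two_pos (by linarith)
  rw [hF.mixedNorm_ofReal hl2, hG.mixedNorm_ofReal hl2, mul_assoc]
  have hFm := measurable_eLpNorm_comp hF.meas P
  have hGm := measurable_eLpNorm_comp hG.meas P
  have hk := measurable_powKernel l
  refine (enorm_windowForm_le (f := fun s => C * eLpNorm (F s) P μ)
    (g := fun s => eLpNorm (G s) P μ) (k := powKernel l) (fun s t hts => ?_) (hFm.const_mul _) hGm
    hk).trans ?_
  · rw [powKernel, indicator_of_mem hts]
    exact (hS _ hts _ _).trans (le_of_eq (by ring))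
  · have key : ∀ f g : ℝ → ℝ≥0∞, Measurable f → Measurable g →
        ∫⁻ s, ∫⁻ t, C * f s * g t * powKernel l (t - s) =
          C * ∫⁻ s, ∫⁻ t, f s * g t * powKernel l (t - s) := fun f g hf hg => by
      rw [← lintegral_const_mul _ (Measurable.lintegral_prod_right' (f := fun z : ℝ × ℝ =>
            f z.1 * g z.2 * powKernel l (z.2 - z.1)) (by fun_prop))]
      refine lintegral_congr fun s => ?_
      rw [← lintegral_const_mul _ (by fun_prop)]
      exact lintegral_congr fun t => by ring
    rw [key _ _ hFm hGm]
    gcongr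
    exact powKernel_bilinear_le hl hl1 hFm hGm

/-- The retarded estimate for one admissible pair, in bilinear form. -/
theorem exists_enorm_windowForm_le {α K : ℝ} (hα : 0 < α) (hK : 0 < K) {q r : ℝ≥0∞}
    (h : Admissible α q r) : ∃ C : NNReal,
    ∀ {X : Type u} [MeasurableSpace X] {μ : Measure X} {S : ℝ → Lp ℂ 2 μ →L[ℂ] Lp ℂ 2 μ},
      IsDispersive α K S → ∀ {T : ℝ} {F G : ℝ → Lp ℂ 2 μ}, IsBddSupp T F → IsBddSupp T G →
      ‖windowForm (Ioi 0) S F G‖ₑ ≤ C *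
        (mixedNorm q.conjExponent r.conjExponent (Ioo 0 T) F *
          mixedNorm q.conjExponent r.conjExponent (Ioo 0 T) G) := by
  obtain ⟨hq2, hr2, hne, hqr⟩ := h
  have hr0 : r ≠ 0 := (lt_of_lt_of_le (by norm_num) hr2).ne'
  rcases eq_or_ne q ∞ with rfl | hqt
  · refine ⟨1, fun {X} _ {μ} {S} hS {T F G} hF hG => ?_⟩
    obtain rfl : r = 2 := Admissible.eq_two hα ⟨hq2, hr2, hne, hqr⟩
    rw [conjExponent_eq_ofReal hq2 one_pos (by simp), ENNReal.coe_one, one_mul,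
      conjExponent_eq_ofReal hr2 two_pos (by simp; norm_num), ENNReal.ofReal_ofNat]
    exact hS.enorm_windowForm_le_top hF hG
  have hri : r ≠ ∞ → 0 < (r⁻¹).toReal := fun hrt =>
    ENNReal.toReal_pos (ENNReal.inv_ne_zero.2 hrt) (ENNReal.inv_ne_top.2 hr0)
  -- At `q = 2` the exclusion of `(2, ∞, 1)` forces `r < ∞`, hence `α > 1`, and the conjugate of `r`
  -- is `2α/(α+1)`: the case of Keel and Tao.
  rcases hq2.eq_or_lt with rfl | hq2'
  · have hrt : r ≠ ∞ := by
      rintro rfl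
      refine hne ?_
      simp at hqr
      rw [show α = 1 by linarith]
    have hr := hri hrt
    have h2 : ((2 : ℝ≥0∞)⁻¹).toReal = 1 / 2 := by simp
    rw [h2] at hqr
    have hα1 : 1 < α := by nlinarith
    obtain ⟨C, hC⟩ := exists_enorm_windowForm_le_endpoint.{u} hα1 hK
    refine ⟨C, fun {X} _ {μ} {S} hS {T F G} hF hG => ?_⟩
    rw [conjExponent_eq_ofReal hq2 two_pos (by rw [h2]; norm_num),
      conjExponent_eq_ofReal hr2 (y := 2 * α / (α + 1)) (by positivity), hF.mixedNorm_ofReal two_pos,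
      hG.mixedNorm_ofReal two_pos]
    · exact hC hS hF hG
    · rw [inv_div]; field_simp; linarith
  have hq0 : q ≠ 0 := (lt_trans (by norm_num) hq2').ne'
  have hqi : 0 < (q⁻¹).toReal :=
    ENNReal.toReal_pos (ENNReal.inv_ne_zero.2 hqt) (ENNReal.inv_ne_top.2 hq0)
  have hqi2 : (q⁻¹).toReal < 1 / 2 := by
    have : q⁻¹ < 2⁻¹ := ENNReal.inv_lt_inv.2 hq2'
    have := (ENNReal.toReal_lt_toReal (ENNReal.inv_ne_top.2 hq0) (by simp)).2 this
    simpa using this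
  -- The exponent of the interpolated kernel; the Hardy-Littlewood-Sobolev exponent `2/(2-l)` is
  -- then the conjugate of `q`, and `l < 1` because `q > 2`.
  set l := 2 * (q⁻¹).toReal with hl
  have hl0 : 0 < l := by positivity
  have hl1 : l < 1 := by linarith
  have hq' : q.conjExponent = ENNReal.ofReal (2 / (2 - l)) := by
    refine conjExponent_eq_ofReal hq2 (div_pos two_pos (by linarith)) ?_
    rw [inv_div, hl]; ring
  rw [hq']
  rcases eq_or_ne r ∞ with rfl | hrt
  · refine ⟨(K.toNNReal * (2 * (1 / (1 - l) + 1).toNNReal)),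
      fun {X} _ {μ} {S} hS {T F G} hF hG => ?_⟩
    have hαl : α = l := by
      simp only [ENNReal.inv_top, ENNReal.toReal_zero] at hqr; linarith
    rw [conjExponent_eq_ofReal hr2 one_pos (by simp), ENNReal.ofReal_one]
    refine (enorm_windowForm_le_of_powKernel hl0 hl1 (P := 1) (C := ENNReal.ofReal K)
      (fun τ hτ f g => ?_) hF hG).trans (le_of_eq ?_)
    · rw [← ENNReal.ofReal_mul hK.le, ← hαl]
      exact hS.decay τ hτ f g
    · simp [ENNReal.ofReal]
  · have hr := hri hrt
    set p := (1 - (r⁻¹).toReal)⁻¹ with hp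
    have hrh : (r⁻¹).toReal < 1 / 2 := by
      by_contra! hcon
      nlinarith
    have hp1 : 1 < p := (one_lt_inv₀ (by linarith)).2 (by linarith)
    have hp2 : p < 2 := by
      rw [hp, inv_lt_comm₀ (by linarith) two_pos]; linarith
    -- Interpolation raises the decay `τ^{-α}` to this power, and admissibility turns `α(1 - 2/r)`
    -- into `2/q = l`.
    have hpe : 2 / p - 1 = 1 - 2 * (r⁻¹).toReal := by rw [hp, div_inv_eq_mul]; ring
    obtain ⟨C, hC⟩ := exists_enorm_inner_le_interpolation.{u} hp1 hp2
    refine ⟨C * (K ^ (2 / p - 1)).toNNReal * (2 * (1 / (1 - l) + 1).toNNReal),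
      fun {X} _ {μ} {S} hS {T F G} hF hG => ?_⟩
    rw [conjExponent_eq_ofReal hr2 (y := p) (by linarith) (by rw [hp, inv_inv])]
    refine (enorm_windowForm_le_of_powKernel hl0 hl1 (P := ENNReal.ofReal p) (C := C * ENNReal.ofReal (K ^ (2 / p - 1)))
      (fun τ hτ f g => ?_) hF hG).trans (le_of_eq ?_)
    · refine (hC (S τ) (K * τ ^ (-α)) (by positivity) (hS.decay τ hτ) (hS.norm_le τ) f g).trans
        (le_of_eq ?_)
      rw [Real.mul_rpow hK.le (by positivity), ← Real.rpow_mul hτ.le,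
        ENNReal.ofReal_mul (by positivity), ← mul_assoc (C : ℝ≥0∞)]
      congr 4
      rw [hpe, hl, hqr]; ring
    · simp [ENNReal.ofReal]

end Diagonal

/-! ### Mixed norms under restriction and time reversal. -/

section MixedNorm

variable {X : Type*} [MeasurableSpace X] {μ : Measure X} {q r : ℝ≥0∞} {I J : Set ℝ}
  {F G : ℝ → Lp ℂ 2 μ} {T : ℝ}

theorem mixedNorm_congr (hI : MeasurableSet I) (h : ∀ s ∈ I, F s = G s) :
    mixedNorm q r I F = mixedNorm q r I G :=
  eLpNorm_congr_ae ((ae_restrict_iff' hI).2 (.of_forall fun s hs => by simp only [h s hs]))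

theorem mixedNorm_mono (h : I ⊆ J) : mixedNorm q r I F ≤ mixedNorm q r J F :=
  eLpNorm_mono_measure _ (Measure.restrict_mono h le_rfl)

theorem mixedNorm_reflect (hF : StronglyMeasurable F) :
    mixedNorm q r (Ioo 0 T) (fun s => F (T - s)) = mixedNorm q r (Ioo 0 T) F := by
  have h : MeasurePreserving (fun s => T - s) (volume.restrict (Ioo 0 T))
      (volume.restrict (Ioo 0 T)) := by
    have := (Measure.measurePreserving_sub_left (volume : Measure ℝ) T).restrict_preimage
      (measurableSet_Ioo (a := 0) (b := T))
    simpa using this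
  exact eLpNorm_comp_measurePreserving (measurable_eLpNorm_comp hF r).aestronglyMeasurable h

end MixedNorm

/-! ### Duhamel integrals on a bounded interval. -/

section Duhamel

variable {H : Type*} [NormedAddCommGroup H] [InnerProductSpace ℂ H] {T : ℝ} {F : ℝ → H}
  {S : ℝ → H →L[ℂ] H}

theorem IsBddMeas.isBddSupp_indicator {H : Type*} [NormedAddCommGroup H] {F : ℝ → H}
    (hF : IsBddMeas F) (T : ℝ) : IsBddSupp T ((Ioo 0 T).indicator F) where
  meas := hF.meas.indicator measurableSet_Ioo
  bdd := hF.bdd.imp fun _ hM => ⟨hM.1, fun s => (norm_indicator_le_norm_self _ _).trans (hM.2 s)⟩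
  supp _ hs := indicator_of_notMem hs _

theorem duhamel_indicator {t : ℝ} (ht : t ∈ Icc 0 T) :
    duhamel S ((Ioo 0 T).indicator F) 0 t = duhamel S F 0 t := by
  rw [duhamel, duhamel, intervalIntegral.integral_of_le ht.1, intervalIntegral.integral_of_le ht.1,
    integral_Ioc_eq_integral_Ioo, integral_Ioc_eq_integral_Ioo]
  refine setIntegral_congr_fun measurableSet_Ioo fun s hs => ?_
  simp only [indicator_of_mem (show s ∈ Ioo 0 T from ⟨hs.1, hs.2.trans_le ht.2⟩)]

/-- The Duhamel integral may grow linearly in time; freezing it outside `[0, T]` produces a bounded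
function on the whole line, so that the duality lemma applies and the function can serve as a new
source. -/
theorem IsContractionSemigroup.isBddMeas_duhamel_clamp [CompleteSpace H]
    (hS : IsContractionSemigroup S) (hF : IsBddMeas F) (hT : 0 ≤ T) :
    IsBddMeas fun t => duhamel S F 0 (max 0 (min t T)) where
  meas := ((hS.continuous_duhamel hF 0).comp (by fun_prop)).stronglyMeasurable
  bdd := by
    obtain ⟨M, hM0, hM⟩ := hF.bdd
    refine ⟨M * T, by positivity, fun t => (hS.norm_integral_le hM _ (le_max_left _ _)).trans ?_⟩
    gcongr
    rw [sub_zero]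
    exact max_le hT (min_le_right _ _)

theorem clamp_eq_self {t : ℝ} (ht : t ∈ Ioo 0 T) : max 0 (min t T) = t := by
  rw [min_eq_left ht.2.le, max_eq_right ht.1.le]

/-- The pairing equals `⟨∫ S(t)*G(t) dt, x⟩`, and this integral is the adjoint Duhamel integral at
time `T` of the reversed source. It dualizes the homogeneous estimate into an `L²` bound at a single
time. -/
theorem IsContractionSemigroup.integral_inner_apply [CompleteSpace H]
    (hS : IsContractionSemigroup S) {G : ℝ → H} (hG : IsBddMeas G) (hT : 0 ≤ T) (x : H) :
    ∫ t in Ioo 0 T, inner ℂ (G t) (S t x) =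
      inner ℂ (duhamel (fun t => ContinuousLinearMap.adjoint (S t)) (fun t => G (T - t)) 0 T) x := by
  have hi := hS.adjoint.intervalIntegrable hG (τ := fun s => s) measurable_id 0 T
  have h1 : duhamel (fun t => ContinuousLinearMap.adjoint (S t)) (fun t => G (T - t)) 0 T =
      ∫ t in Ioc 0 T, ContinuousLinearMap.adjoint (S t) (G t) := by
    rw [duhamel, intervalIntegral.integral_comp_sub_left
      (fun s => ContinuousLinearMap.adjoint (S s) (G s)), sub_self, sub_zero,
      intervalIntegral.integral_of_le hT]
  rw [h1, ← inner_conj_symm, ← integral_inner hi.1, ← integral_conj, integral_Ioc_eq_integral_Ioo]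
  refine setIntegral_congr_fun measurableSet_Ioo fun s _ => ?_
  simp only [inner_conj_symm, ContinuousLinearMap.adjoint_inner_left]

end Duhamel

/-! ### Strichartz estimates for bounded sources. -/

section Strichartz

variable {α K : ℝ}

theorem enorm_le_of_sq_le {x m : ℝ≥0∞} {C : NNReal} (h : x ^ (2 : ℝ) ≤ 2 * (C * (m * m))) :
    x ≤ (2 * C + 1 : NNReal) * m := by
  rw [← ENNReal.rpow_le_rpow_iff two_pos, ENNReal.mul_rpow_of_nonneg _ _ zero_le_two]
  refine h.trans ?_
  rw [ENNReal.rpow_two, ENNReal.rpow_two, ← sq, ← mul_assoc]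
  gcongr
  rw [← ENNReal.coe_pow, ← ENNReal.coe_ofNat, ← ENNReal.coe_mul, ENNReal.coe_le_coe]
  nlinarith [sq_nonneg (C : ℝ), C.2]

/-- The Duhamel integral in `L^∞(L²)`. -/
theorem exists_enorm_duhamel_le (hα : 0 < α) (hK : 0 < K) {q r : ℝ≥0∞} (h : Admissible α q r) :
    ∃ C : NNReal, ∀ {X : Type u} [MeasurableSpace X] {μ : Measure X}
      {S : ℝ → Lp ℂ 2 μ →L[ℂ] Lp ℂ 2 μ}, IsDispersive α K S →
      ∀ {T : ℝ} {F : ℝ → Lp ℂ 2 μ}, IsBddMeas F → ∀ t ∈ Icc 0 T,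
      ‖duhamel S F 0 t‖ₑ ≤ C * mixedNorm q.conjExponent r.conjExponent (Ioo 0 T) F := by
  obtain ⟨C, hC⟩ := exists_enorm_windowForm_le.{u} hα hK h
  refine ⟨2 * C + 1, fun {X} _ {μ} {S} hS {T F} hF t ht => ?_⟩
  have hFt := hF.isBddSupp_indicator t
  have h1 : mixedNorm q.conjExponent r.conjExponent (Ioo 0 t) ((Ioo 0 t).indicator F) ≤
      mixedNorm q.conjExponent r.conjExponent (Ioo 0 T) F := by
    rw [mixedNorm_congr (G := F) measurableSet_Ioo fun s hs => indicator_of_mem hs F]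
    exact mixedNorm_mono (Ioo_subset_Ioo_right ht.2)
  refine le_trans (enorm_le_of_sq_le ?_) (mul_le_mul_right h1 _)
  have h2 := hS.enorm_duhamel_sq_le hFt.toIsBddMeas ht.1
  rw [duhamel_indicator ⟨ht.1, le_rfl⟩, integral_Ioc_eq_integral_Ioo] at h2
  refine h2.trans ?_
  rw [← hS.windowForm_Ioi hFt hFt]
  gcongr
  exact hC hS hFt hFt

/-- The homogeneous estimate. -/
theorem exists_mixedNorm_apply_le (hα : 0 < α) (hK : 0 < K) {q r : ℝ≥0∞} (h : Admissible α q r) :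
    ∃ C : NNReal, ∀ {X : Type u} [MeasurableSpace X] {μ : Measure X}
      {S : ℝ → Lp ℂ 2 μ →L[ℂ] Lp ℂ 2 μ}, IsDispersive α K S →
      ∀ {T : ℝ}, 0 < T → ∀ φ : Lp ℂ 2 μ, mixedNorm q r (Ioo 0 T) (fun t => S t φ) ≤ C * ‖φ‖ₑ := by
  rcases eq_or_ne q ∞ with rfl | hq
  · refine ⟨1, fun {X} _ {μ} {S} hS {T} hT φ => ?_⟩
    rw [h.eq_two hα, ENNReal.coe_one, one_mul]
    exact mixedNorm_top_two_le measurableSet_Ioo fun s _ => enorm_le_iff_norm_le.2 (hS.norm_le _ _)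
  obtain ⟨C, hC⟩ := exists_enorm_duhamel_le.{u} hα hK h
  refine ⟨C, fun {X} _ {μ} {S} hS {T} hT φ => ?_⟩
  -- Duality reduces the claim to the `L²` bound for Duhamel integrals of the adjoint semigroup,
  -- which is dispersive with the same constants.
  refine mixedNorm_le_of_pairing h.1 hq h.2.1 measurableSet_Ioo (by simp)
    ⟨(hS.continuous_apply φ).stronglyMeasurable, ‖φ‖, norm_nonneg _, fun s => hS.norm_le s φ⟩
    fun G hG hG0 => ?_
  rw [hS.integral_inner_apply hG hT.le]
  have hGs : IsBddSupp T G := ⟨hG, hG0⟩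
  calc _ ≤ ‖duhamel (fun t => ContinuousLinearMap.adjoint (S t)) (fun t => G (T - t)) 0 T‖ₑ *
        ‖φ‖ₑ := by
        rw [← eLpNorm_lp_two, ← eLpNorm_lp_two]
        exact enorm_inner_le_eLpNorm_two _ _
    _ ≤ C * mixedNorm q.conjExponent r.conjExponent (Ioo 0 T) (fun t => G (T - t)) * ‖φ‖ₑ := by
        gcongr
        exact hC hS.adjoint hGs.reflect.toIsBddMeas T ⟨hT.le, le_rfl⟩
    _ = _ := by rw [mixedNorm_reflect hG.meas]; ring

theorem IsDispersive.enorm_integral_inner_duhamel {X : Type*} [MeasurableSpace X] {μ : Measure X}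
    {S : ℝ → Lp ℂ 2 μ →L[ℂ] Lp ℂ 2 μ} (hS : IsDispersive α K S) {T : ℝ} {F G : ℝ → Lp ℂ 2 μ}
    (hF : IsBddMeas F) (hG : IsBddMeas G) (hG0 : ∀ s ∉ Ioo 0 T, G s = 0) :
    ∫ t in Ioo 0 T, inner ℂ (G t) (duhamel S F 0 (max 0 (min t T))) =
      windowForm (Ioi 0) S ((Ioo 0 T).indicator F) G := by
  rw [hS.windowForm_Ioi (hF.isBddSupp_indicator T) ⟨hG, hG0⟩]
  refine setIntegral_congr_fun measurableSet_Ioo fun t ht => ?_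
  simp only [clamp_eq_self ht, duhamel_indicator (Ioo_subset_Icc_self ht)]

/-- The retarded estimate for one admissible pair. -/
theorem exists_mixedNorm_duhamel_le_diagonal (hα : 0 < α) (hK : 0 < K) {q r : ℝ≥0∞}
    (h : Admissible α q r) :
    ∃ C : NNReal, ∀ {X : Type u} [MeasurableSpace X] {μ : Measure X}
      {S : ℝ → Lp ℂ 2 μ →L[ℂ] Lp ℂ 2 μ}, IsDispersive α K S →
      ∀ {T : ℝ}, 0 < T → ∀ {F : ℝ → Lp ℂ 2 μ}, IsBddMeas F →
      mixedNorm q r (Ioo 0 T) (duhamel S F 0) ≤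
        C * mixedNorm q.conjExponent r.conjExponent (Ioo 0 T) F := by
  rcases eq_or_ne q ∞ with rfl | hq
  · obtain ⟨C, hC⟩ := exists_enorm_duhamel_le.{u} hα hK h
    refine ⟨C, fun {X} _ {μ} {S} hS {T} hT {F} hF => ?_⟩
    obtain rfl := h.eq_two hα
    exact mixedNorm_top_two_le measurableSet_Ioo fun s hs => hC hS hF s (Ioo_subset_Icc_self hs)
  obtain ⟨C, hC⟩ := exists_enorm_windowForm_le.{u} hα hK h
  refine ⟨C, fun {X} _ {μ} {S} hS {T} hT {F} hF => ?_⟩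
  rw [mixedNorm_congr (G := fun t => duhamel S F 0 (max 0 (min t T))) measurableSet_Ioo
    fun s hs => by rw [clamp_eq_self hs]]
  refine mixedNorm_le_of_pairing h.1 hq h.2.1 measurableSet_Ioo (by simp)
    (hS.isBddMeas_duhamel_clamp hF hT.le) fun G hG hG0 => ?_
  rw [hS.enorm_integral_inner_duhamel hF hG hG0, mul_assoc]
  rw [mixedNorm_congr (F := F) (G := (Ioo 0 T).indicator F) measurableSet_Ioo
    fun s hs => (indicator_of_mem hs F).symm]
  exact hC hS (hF.isBddSupp_indicator T) ⟨hG, hG0⟩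

/-- The same dual norm of the source bounds the Duhamel integral in `L^∞(L²)` and in the admissible
space of the source's own pair; interpolation reaches the larger time exponents, and only those. -/
theorem exists_mixedNorm_duhamel_le_of_le (hα : 0 < α) (hK : 0 < K) {q r qt rt : ℝ≥0∞}
    (h : Admissible α q r) (ht : Admissible α qt rt) (hle : qt ≤ q) :
    ∃ C : NNReal, ∀ {X : Type u} [MeasurableSpace X] {μ : Measure X}
      {S : ℝ → Lp ℂ 2 μ →L[ℂ] Lp ℂ 2 μ}, IsDispersive α K S →
      ∀ {T : ℝ}, 0 < T → ∀ {F : ℝ → Lp ℂ 2 μ}, IsBddMeas F →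
      mixedNorm q r (Ioo 0 T) (duhamel S F 0) ≤
        C * mixedNorm qt.conjExponent rt.conjExponent (Ioo 0 T) F := by
  obtain ⟨C, hC⟩ := exists_enorm_duhamel_le.{u} hα hK ht
  obtain ⟨D, hD⟩ := exists_mixedNorm_duhamel_le_diagonal.{u} hα hK ht
  refine ⟨max C D, fun {X} _ {μ} {S} hS {T} hT {F} hF => ?_⟩
  refine mixedNorm_le_of_le hα ht h hle measurableSet_Ioo (fun s hs => ?_) ?_
  · refine (hC hS hF s (Ioo_subset_Icc_self hs)).trans ?_
    gcongr
    exact le_max_left _ _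
  · refine (hD hS hT hF).trans ?_
    gcongr
    exact le_max_right _ _

/-- The retarded estimates of Strichartz type. -/
theorem exists_mixedNorm_duhamel_le (hα : 0 < α) (hK : 0 < K) {q r qt rt : ℝ≥0∞}
    (h : Admissible α q r) (ht : Admissible α qt rt) :
    ∃ C : NNReal, ∀ {X : Type u} [MeasurableSpace X] {μ : Measure X}
      {S : ℝ → Lp ℂ 2 μ →L[ℂ] Lp ℂ 2 μ}, IsDispersive α K S →
      ∀ {T : ℝ}, 0 < T → ∀ {F : ℝ → Lp ℂ 2 μ}, IsBddMeas F →
      mixedNorm q r (Ioo 0 T) (duhamel S F 0) ≤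
        C * mixedNorm qt.conjExponent rt.conjExponent (Ioo 0 T) F := by
  rcases le_or_gt qt q with hle | hlt
  · exact exists_mixedNorm_duhamel_le_of_le.{u} hα hK h ht hle
  -- For `q < qt` transpose: pair with `G`, reverse time and move the semigroup to the other side.
  -- The case already settled, with the pairs exchanged, bounds the adjoint Duhamel integral of the
  -- reversed `G`.
  obtain ⟨C, hC⟩ := exists_mixedNorm_duhamel_le_of_le.{u} hα hK ht h hlt.le
  refine ⟨C, fun {X} _ {μ} {S} hS {T} hT {F} hF => ?_⟩
  rw [mixedNorm_congr (G := fun t => duhamel S F 0 (max 0 (min t T))) measurableSet_Ioo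
    fun s hs => by rw [clamp_eq_self hs]]
  refine mixedNorm_le_of_pairing h.1 hlt.ne_top h.2.1 measurableSet_Ioo (by simp)
    (hS.isBddMeas_duhamel_clamp hF hT.le) fun G hG hG0 => ?_
  have hGs : IsBddSupp T G := ⟨hG, hG0⟩
  have hFs := hF.isBddSupp_indicator T
  have hFm : mixedNorm qt.conjExponent rt.conjExponent (Ioo 0 T) F =
      mixedNorm qt.conjExponent rt.conjExponent (Ioo 0 T) fun s => (Ioo 0 T).indicator F (T - s) := by
    rw [mixedNorm_reflect hFs.meas]
    exact mixedNorm_congr measurableSet_Ioo fun s hs => (indicator_of_mem hs F).symm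
  rw [hS.enorm_integral_inner_duhamel hF hG hG0, ← hS.windowForm_reflect measurableSet_Ioi hFs hGs,
    hS.adjoint.windowForm_Ioi hGs.reflect hFs.reflect, hFm]
  have _ : qt.conjExponent.HolderConjugate qt :=
    (ENNReal.HolderConjugate.conjExponent (le_trans (by norm_num) ht.1)).symm
  have _ : rt.conjExponent.HolderConjugate rt :=
    (ENNReal.HolderConjugate.conjExponent (le_trans (by norm_num) ht.2.1)).symm
  refine (enorm_integral_le_lintegral_enorm _).trans ((lintegral_enorm_inner_le_mixedNorm
    (q := qt) (r := rt) (q' := qt.conjExponent) (r' := rt.conjExponent) hFs.reflect.meas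
    (hS.adjoint.continuous_duhamel hGs.reflect.toIsBddMeas 0).stronglyMeasurable).trans ?_)
  rw [mul_comm (C : ℝ≥0∞), mul_assoc]
  gcongr
  refine (hC hS.adjoint hT hGs.reflect.toIsBddMeas).trans ?_
  rw [mixedNorm_reflect hG.meas]

end Strichartz

/-! ### Passage to the limit in mixed norms. -/

section Limits

variable {X : Type*} [MeasurableSpace X] {μ : Measure X} {q r : ℝ≥0∞} {I : Set ℝ} {T : ℝ}

theorem _root_.LowerSemicontinuous.le_liminf_of_tendsto {Y : Type*} [TopologicalSpace Y]
    {f : Y → ℝ≥0∞} (hf : LowerSemicontinuous f) {w : ℕ → Y} {v : Y}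
    (h : Tendsto w atTop (𝓝 v)) : f v ≤ liminf (fun n => f (w n)) atTop :=
  (lowerSemicontinuousAt_iff_le_liminf.1 (hf v)).trans (liminf_le_liminf_of_le h)

/-- Lower semicontinuity of the spatial norm at each time, followed by Fatou in time when `q` is
finite, or by a countable union of null sets when it is not. -/
theorem mixedNorm_le_of_tendsto (hq : q ≠ 0) (hI : MeasurableSet I)
    {w : ℕ → ℝ → Lp ℂ 2 μ} {v : ℝ → Lp ℂ 2 μ} (hw : ∀ n, StronglyMeasurable (w n))
    (hlim : ∀ t ∈ I, Tendsto (fun n => w n t) atTop (𝓝 (v t))) {D : ℝ≥0∞}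
    (hD : ∀ n, mixedNorm q r I (w n) ≤ D) : mixedNorm q r I v ≤ D := by
  rcases eq_or_ne q ∞ with rfl | hqt
  · have hae : ∀ᵐ t ∂volume.restrict I, ∀ n, eLpNorm (w n t) r μ ≤ D := by
      refine ae_all_iff.2 fun n => ?_
      have h := hD n
      rw [mixedNorm, eLpNorm_ennreal_top] at h
      filter_upwards [ENNReal.ae_le_essSup fun t => eLpNorm (w n t) r μ] with t ht
      exact ht.trans h
    rw [mixedNorm, eLpNorm_ennreal_top]
    refine essSup_le_of_ae_le _ ?_
    filter_upwards [hae, ae_restrict_mem hI] with t ht htI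
    refine ((lowerSemicontinuous_eLpNorm r).le_liminf_of_tendsto (hlim t htI)).trans ?_
    exact liminf_le_of_le (by isBoundedDefault) fun b hb =>
      (hb.exists.choose_spec).trans (ht _)
  have hq0 : 0 < q.toReal := ENNReal.toReal_pos hq hqt
  have hlsc : LowerSemicontinuous fun v : Lp ℂ 2 μ => eLpNorm v r μ ^ q.toReal :=
    (ENNReal.continuous_rpow_const).comp_lowerSemicontinuous (lowerSemicontinuous_eLpNorm r)
      (ENNReal.monotone_rpow_of_nonneg hq0.le)
  rw [mixedNorm, ← ENNReal.rpow_le_rpow_iff hq0, eLpNorm_ennreal_rpow hq hqt]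
  calc _ ≤ ∫⁻ t in I, liminf (fun n => eLpNorm (w n t) r μ ^ q.toReal) atTop :=
        setLIntegral_mono_ae' hI (.of_forall fun t ht => hlsc.le_liminf_of_tendsto (hlim t ht))
    _ ≤ liminf (fun n => ∫⁻ t in I, eLpNorm (w n t) r μ ^ q.toReal) atTop :=
        lintegral_liminf_le fun n => (measurable_eLpNorm_comp (hw n) r).pow_const _
    _ ≤ D ^ q.toReal := by
        refine liminf_le_of_le (by isBoundedDefault) fun b hb => ?_
        refine (hb.exists.choose_spec).trans ?_
        rw [← eLpNorm_ennreal_rpow hq hqt]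
        exact ENNReal.rpow_le_rpow (hD _) hq0.le

theorem mixedNorm_sub_le (hq : 1 ≤ q) (hr : 1 ≤ r) {u v : ℝ → Lp ℂ 2 μ}
    (hu : StronglyMeasurable u) (hv : StronglyMeasurable v) :
    mixedNorm q r I (fun t => u t - v t) ≤ mixedNorm q r I u + mixedNorm q r I v := by
  refine le_trans (eLpNorm_mono_enorm (g := fun t => eLpNorm (u t) r μ + eLpNorm (v t) r μ)
    fun t => ?_) ?_
  · simp only [enorm_eq_self]
    rw [eLpNorm_congr_ae (Lp.coeFn_sub (u t) (v t))]
    exact eLpNorm_sub_le (Lp.aestronglyMeasurable _) (Lp.aestronglyMeasurable _) hr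
  · exact eLpNorm_add_le (measurable_eLpNorm_comp hu r).aestronglyMeasurable
      (measurable_eLpNorm_comp hv r).aestronglyMeasurable hq

theorem mixedNorm_mono_enorm {u v : ℝ → Lp ℂ 2 μ} (hI : MeasurableSet I)
    (h : ∀ t ∈ I, eLpNorm (u t) r μ ≤ eLpNorm (v t) r μ) : mixedNorm q r I u ≤ mixedNorm q r I v :=
  eLpNorm_mono_enorm_ae ((ae_restrict_iff' hI).2 (.of_forall fun t ht => by simpa using h t ht))

theorem eLpNorm_indicator_le (E : Set ℝ) (f : ℝ → Lp ℂ 2 μ) (s : ℝ) :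
    eLpNorm (E.indicator f s : Lp ℂ 2 μ) r μ ≤ eLpNorm (f s) r μ := by
  by_cases hs : s ∈ E
  · rw [indicator_of_mem hs]
  · rw [indicator_of_notMem hs, eLpNorm_lp_zero]; exact zero_le

/-- Dominated convergence in time, which needs a finite time exponent. It will be applied to
conjugates of exponents at least two. -/
theorem tendsto_mixedNorm_indicator_compl (hq : q ≠ 0) (hqt : q ≠ ∞) (hI : MeasurableSet I)
    {f : ℝ → Lp ℂ 2 μ} (hf : StronglyMeasurable f) (hm : mixedNorm q r I f ≠ ∞)
    {E : ℕ → Set ℝ} (hE : ∀ n, MeasurableSet (E n)) (hmono : Monotone E)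
    (hcover : ∀ s ∈ I, ∃ n, s ∈ E n) :
    Tendsto (fun n => mixedNorm q r I ((E n)ᶜ.indicator f)) atTop (𝓝 0) := by
  have hq0 : 0 < q.toReal := ENNReal.toReal_pos hq hqt
  have hp : ∀ u : ℝ → Lp ℂ 2 μ, mixedNorm q r I u =
      (∫⁻ t in I, eLpNorm (u t) r μ ^ q.toReal) ^ (1 / q.toReal) := fun u =>
    eLpNorm_ennreal_eq hq hqt _
  have h0 : ∫⁻ t in I, eLpNorm (f t) r μ ^ q.toReal ≠ ∞ := by
    rw [← eLpNorm_ennreal_rpow hq hqt]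
    exact ENNReal.rpow_ne_top_of_nonneg hq0.le hm
  have h1 : Tendsto (fun n => ∫⁻ t in I, eLpNorm ((E n)ᶜ.indicator f t : Lp ℂ 2 μ) r μ ^ q.toReal) atTop
      (𝓝 (∫⁻ _ in I, 0)) := by
    refine tendsto_lintegral_of_dominated_convergence _
      (fun n => (measurable_eLpNorm_comp (hf.indicator (hE n).compl) r).pow_const _)
      (fun n => .of_forall fun t => ENNReal.rpow_le_rpow (eLpNorm_indicator_le _ f t) hq0.le) h0 ?_
    filter_upwards [ae_restrict_mem hI] with t ht
    obtain ⟨n, hn⟩ := hcover t ht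
    refine tendsto_const_nhds.congr' ?_
    filter_upwards [eventually_ge_atTop n] with m hm
    rw [indicator_of_notMem (notMem_compl_iff.2 (hmono hm hn)), eLpNorm_lp_zero, ENNReal.zero_rpow_of_pos hq0]
  simp only [hp]
  have h2 := (ENNReal.continuous_rpow_const (y := 1 / q.toReal)).continuousAt.tendsto.comp h1
  simpa [Function.comp_def, hq0] using h2

end Limits

/-! ### Duhamel integrals of unbounded sources as weak integrals. -/

section WeakIntegral

variable {X : Type u} [MeasurableSpace X] {μ : Measure X} {q r : ℝ≥0∞} {T α K : ℝ}
  {S : ℝ → Lp ℂ 2 μ →L[ℂ] Lp ℂ 2 μ} {f : ℝ → Lp ℂ 2 μ}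

theorem duhamel_sub {H : Type*} [NormedAddCommGroup H] [InnerProductSpace ℂ H] {S : ℝ → H →L[ℂ] H}
    (hS : IsContractionSemigroup S) {F G : ℝ → H} (hF : IsBddMeas F) (hG : IsBddMeas G) (a t : ℝ) :
    duhamel S (fun s => F s - G s) a t = duhamel S F a t - duhamel S G a t := by
  unfold duhamel
  rw [← intervalIntegral.integral_sub (hS.intervalIntegrable hF (by fun_prop) a t)
    (hS.intervalIntegrable hG (by fun_prop) a t)]
  simp only [map_sub]

theorem IsContractionSemigroup.inner_duhamel {H : Type*} [NormedAddCommGroup H]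
    [InnerProductSpace ℂ H] [CompleteSpace H] {S : ℝ → H →L[ℂ] H} (hS : IsContractionSemigroup S)
    {F : ℝ → H} (hF : IsBddMeas F) {t : ℝ} (ht : 0 ≤ t) (x : H) :
    inner ℂ x (duhamel S F 0 t) = ∫ s in Ioo 0 t, inner ℂ x (S (t - s) (F s)) := by
  have hin := hS.intervalIntegrable hF (τ := fun s => t - s) (by fun_prop) 0 t
  rw [duhamel, intervalIntegral.integral_of_le ht, ← integral_inner hin.1,
    integral_Ioc_eq_integral_Ioo]

theorem conjExponent_ne_top {q : ℝ≥0∞} (hq : 2 ≤ q) : q.conjExponent ≠ ∞ := by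
  have h : ¬ q ≤ 1 := not_le.2 (lt_of_lt_of_le (by norm_num) hq)
  simp [ENNReal.conjExponent, tsub_eq_zero_iff_le, h]

theorem IsBddMeas.sub {H : Type*} [NormedAddCommGroup H] {F G : ℝ → H} (hF : IsBddMeas F)
    (hG : IsBddMeas G) : IsBddMeas fun s => F s - G s where
  meas := hF.meas.sub hG.meas
  bdd := by
    obtain ⟨M, hM0, hM⟩ := hF.bdd
    obtain ⟨N, hN0, hN⟩ := hG.bdd
    exact ⟨M + N, by positivity, fun s => (norm_sub_le _ _).trans (add_le_add (hM s) (hN s))⟩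

/-- Move the operator to `x`: the curve `S(t-s)*x` lies in `L^q(L^r)` by the homogeneous estimate
for the adjoint, and Hölder pairs it with `f`. This is why the integral is defined weakly:
`S(t-s)f(s)` itself need not be norm integrable in `L²`. -/
theorem IsDispersive.integrableOn_inner (hS : IsDispersive α K S) (hα : 0 < α) (hK : 0 < K)
    (h : Admissible α q r) (hf : StronglyMeasurable f)
    (hm : mixedNorm q.conjExponent r.conjExponent (Ioo 0 T) f < ∞) {t : ℝ} (ht : t ∈ Ioo 0 T)
    (x : Lp ℂ 2 μ) : IntegrableOn (fun s => inner ℂ x (S (t - s) (f s))) (Ioo 0 t) := by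
  obtain ⟨C, hC⟩ := exists_mixedNorm_apply_le.{u} hα hK h
  have _ : q.conjExponent.HolderConjugate q :=
    (ENNReal.HolderConjugate.conjExponent (le_trans (by norm_num) h.1)).symm
  have _ : r.conjExponent.HolderConjugate r :=
    (ENNReal.HolderConjugate.conjExponent (le_trans (by norm_num) h.2.1)).symm
  set y : ℝ → Lp ℂ 2 μ := fun s => ContinuousLinearMap.adjoint (S s) x with hy
  have hym : StronglyMeasurable y := (hS.adjoint.continuous_apply x).stronglyMeasurable
  have hyt : StronglyMeasurable fun s => y (t - s) := hym.comp_measurable (by fun_prop)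
  refine ⟨(stronglyMeasurable_const.inner (hS.stronglyMeasurable_apply (by fun_prop)
    hf)).aestronglyMeasurable, ?_⟩
  have h1 : ∫⁻ s in Ioo 0 t, ‖inner ℂ (f s) (y (t - s))‖ₑ < ∞ := by
    refine (lintegral_enorm_inner_le_mixedNorm (q := q) (r := r) (q' := q.conjExponent)
      (r' := r.conjExponent) hf hyt).trans_lt ?_
    rw [mixedNorm_reflect hym]
    refine ENNReal.mul_lt_top ((mixedNorm_mono (Ioo_subset_Ioo_right ht.2.le)).trans_lt hm) ?_
    exact (hC hS.adjoint ht.1 x).trans_lt (ENNReal.mul_lt_top ENNReal.coe_lt_top (by simp))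
  refine lt_of_le_of_lt (le_of_eq ?_) h1
  refine lintegral_congr fun s => ?_
  rw [hy, ContinuousLinearMap.adjoint_inner_right, ← inner_conj_symm, RCLike.enorm_conj]

/-- The Duhamel integral as a weak integral, by truncation. -/
theorem IsDispersive.exists_isDuhamelIntegral (hS : IsDispersive α K S) (hα : 0 < α) (hK : 0 < K)
    (h : Admissible α q r) (hf : StronglyMeasurable f)
    (hm : mixedNorm q.conjExponent r.conjExponent (Ioo 0 T) f < ∞)
    {E : ℕ → Set ℝ} (hE : ∀ n, MeasurableSet (E n)) (hmono : Monotone E)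
    (hcover : ∀ s ∈ Ioo 0 T, ∃ n, s ∈ E n) (hb : ∀ n, IsBddMeas ((E n).indicator f)) :
    ∃ u : ℝ → Lp ℂ 2 μ, ∀ t ∈ Ioo 0 T,
      Tendsto (fun n => duhamel S ((E n).indicator f) 0 t) atTop (𝓝 (u t)) ∧
        IsDuhamelIntegral S f t (u t) := by
  obtain ⟨C, hC⟩ := exists_enorm_duhamel_le.{u} hα hK h
  have hδ := tendsto_mixedNorm_indicator_compl (q := q.conjExponent) (r := r.conjExponent)
    conjExponent_ne_zero (conjExponent_ne_top h.1) measurableSet_Ioo hf hm.ne hE hmono hcover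
  set δ : ℕ → ℝ≥0∞ := fun n => mixedNorm q.conjExponent r.conjExponent (Ioo 0 T)
    ((E n)ᶜ.indicator f) with hδd
  have hex : ∀ t, ∃ w, t ∈ Ioo 0 T →
      Tendsto (fun n => duhamel S ((E n).indicator f) 0 t) atTop (𝓝 w) := fun t => by
    by_cases ht : t ∈ Ioo 0 T
    swap
    · exact ⟨0, fun h => absurd h ht⟩
    -- For `n, m ≥ N` the truncations differ only off `E N`, so the `L^∞(L²)` Strichartz estimate
    -- bounds the difference by the norm of the tail of `f`.
    have hc : CauchySeq fun n => duhamel S ((E n).indicator f) 0 t := by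
      refine EMetric.cauchySeq_iff_le_tendsto_0.2 ⟨fun n => C * δ n, fun n m N hn hm => ?_, ?_⟩
      · rw [edist_eq_enorm_sub, ← duhamel_sub hS.toIsContractionSemigroup (hb n) (hb m)]
        refine (hC hS ((hb n).sub (hb m)) t (Ioo_subset_Icc_self ht)).trans ?_
        refine mul_le_mul_right (mixedNorm_mono_enorm measurableSet_Ioo fun s _ => ?_) _
        by_cases hs : s ∈ E N
        · rw [indicator_of_mem (hmono hn hs), indicator_of_mem (hmono hm hs), sub_self,
            eLpNorm_lp_zero]
          exact zero_le
        · rw [indicator_of_mem (show s ∈ (E N)ᶜ from hs)]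
          by_cases h1 : s ∈ E n <;> by_cases h2 : s ∈ E m
          · simp only [indicator_of_mem h1, indicator_of_mem h2, sub_self, eLpNorm_lp_zero]
            exact zero_le
          · simp only [indicator_of_mem h1, indicator_of_notMem h2, sub_zero, le_refl]
          · simp only [indicator_of_notMem h1, indicator_of_mem h2, zero_sub]
            have := eLpNorm_lp_smul (-1) (f s) r.conjExponent
            rw [neg_one_smul] at this
            rw [this]; simp
          · simp only [indicator_of_notMem h1, indicator_of_notMem h2, sub_self, eLpNorm_lp_zero]
            exact zero_le
      · simpa using ENNReal.Tendsto.const_mul hδ (Or.inr ENNReal.coe_ne_top)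
    obtain ⟨w, hw⟩ := cauchySeq_tendsto_of_complete hc
    exact ⟨w, fun _ => hw⟩
  choose u hu using hex
  refine ⟨u, fun t ht => ⟨hu t ht, fun x => ?_⟩⟩
  have hi := hS.integrableOn_inner hα hK h hf hm ht x
  refine ⟨hi, ?_⟩
  have h1 : Tendsto (fun n => inner ℂ x (duhamel S ((E n).indicator f) 0 t)) atTop
      (𝓝 (inner ℂ x (u t))) := tendsto_const_nhds.inner (hu t ht)
  refine tendsto_nhds_unique ?_ h1
  have h2 : ∀ n, inner ℂ x (duhamel S ((E n).indicator f) 0 t) =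
      ∫ s in Ioo 0 t, (E n).indicator (fun s => inner ℂ x (S (t - s) (f s))) s := fun n => by
    rw [hS.inner_duhamel (hb n) ht.1.le]
    refine setIntegral_congr_fun measurableSet_Ioo fun s _ => ?_
    by_cases hs : s ∈ E n
    · simp only [indicator_of_mem hs]
    · simp only [indicator_of_notMem hs, map_zero, inner_zero_right]
  simp only [h2]
  refine tendsto_integral_of_dominated_convergence
    (fun s => ‖inner ℂ x (S (t - s) (f s))‖) (fun n => hi.1.indicator (hE n)) hi.norm
    (fun n => .of_forall fun s => norm_indicator_le_norm_self _ _) ?_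
  filter_upwards [ae_restrict_mem measurableSet_Ioo] with s hs
  obtain ⟨n, hn⟩ := hcover s ⟨hs.1, hs.2.trans ht.2⟩
  refine tendsto_const_nhds.congr' ?_
  filter_upwards [eventually_ge_atTop n] with m hm
  rw [indicator_of_mem (hmono hm hn)]

end WeakIntegral

/-! ### The difference of two Duhamel integrals. -/

section Comparison

theorem exists_graph_of_mem_sub_graph {H : Type*} [NormedAddCommGroup H] [InnerProductSpace ℂ H]
    {A B : H →ₗ.[ℂ] H} {x y : H} (h : (x, y) ∈ (A - B).graph) :
    ∃ a b, (x, a) ∈ A.graph ∧ (x, b) ∈ B.graph ∧ a - b = y := by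
  obtain ⟨hx, hy⟩ := mem_graph_iff_exists.1 h
  exact ⟨A ⟨x, hx.1⟩, B ⟨x, hx.2⟩, mem_graph_iff_exists.2 ⟨hx.1, rfl⟩,
    mem_graph_iff_exists.2 ⟨hx.2, rfl⟩, hy⟩

variable {H : Type*} [NormedAddCommGroup H] [InnerProductSpace ℂ H] [CompleteSpace H] {T : ℝ}
  {SA SB : ℝ → H →L[ℂ] H} {f g : ℝ → H}

/-- The difference of two Duhamel integrals, one semigroup being compared with the other. -/
theorem duhamel_sub_duhamel (hSA : IsContractionSemigroup SA) (hSB : IsContractionSemigroup SB)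
    (hf : IsBddMeas f) (hg : IsBddMeas g) {t : ℝ} (ht : 0 ≤ t)
    (h : ∀ᵐ s ∂volume.restrict (Ioo 0 t), ∀ τ, 0 ≤ τ →
      SA τ (f s) - SB τ (f s) = ∫ σ in (0)..τ, SA (τ - σ) (SB σ (g s))) :
    duhamel SA f 0 t - duhamel SB f 0 t = duhamel SA (duhamel SB g 0) 0 t := by
  obtain ⟨M, hM0, hM⟩ := hg.bdd
  have hiA := hSA.intervalIntegrable hf (τ := fun s => t - s) (by fun_prop) 0 t
  have hiB := hSB.intervalIntegrable hf (τ := fun s => t - s) (by fun_prop) 0 t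
  -- The integrand on the triangle `s < ρ < t`, after the substitution `ρ = s + σ`. Integrating in
  -- `ρ` first gives the difference of the semigroups applied to `f`; integrating in `s` first gives
  -- the iterated Duhamel integral.
  set Φ : ℝ → ℝ → H := fun s ρ => (Ioi s).indicator (fun ρ => SA (t - ρ) (SB (ρ - s) (g s))) ρ
    with hΦ
  have hmeas : StronglyMeasurable (Function.uncurry Φ) := by
    have h1 : StronglyMeasurable fun z : ℝ × ℝ => SA (t - z.2) (SB (z.2 - z.1) (g z.1)) :=
      hSA.stronglyMeasurable_apply (by fun_prop)
        (hSB.stronglyMeasurable_apply (by fun_prop) (hg.meas.comp_measurable measurable_fst))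
    exact h1.indicator (s := {z : ℝ × ℝ | z.1 < z.2}) (measurableSet_lt measurable_fst measurable_snd)
  have hint : Integrable (Function.uncurry Φ)
      ((volume.restrict (Ioo 0 t)).prod (volume.restrict (Ioo 0 t))) := by
    refine Integrable.mono' (integrable_const M) hmeas.aestronglyMeasurable (.of_forall fun z => ?_)
    refine (norm_indicator_le_norm_self (fun ρ => SA (t - ρ) (SB (ρ - z.1) (g z.1))) z.2).trans
      ((hSA.norm_le _ _).trans ((hSB.norm_le _ _).trans (hM _)))
  have e1 : duhamel SA f 0 t - duhamel SB f 0 t = ∫ s in Ioo 0 t, ∫ ρ in Ioo 0 t, Φ s ρ := by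
    rw [duhamel, duhamel, ← intervalIntegral.integral_sub hiA hiB,
      intervalIntegral.integral_of_le ht, integral_Ioc_eq_integral_Ioo]
    refine integral_congr_ae ?_
    filter_upwards [h, ae_restrict_mem measurableSet_Ioo] with s hs hst
    have h1 := intervalIntegral.integral_comp_sub_right (a := s) (b := t)
      (fun σ => SA (t - s - σ) (SB σ (g s))) s
    simp only [sub_self, sub_sub_sub_cancel_right] at h1
    rw [hs (t - s) (by linarith [hst.2]), ← h1, intervalIntegral.integral_of_le hst.2.le,
      integral_Ioc_eq_integral_Ioo, setIntegral_indicator measurableSet_Ioi]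
    congr 2
    ext ρ
    exact ⟨fun h => ⟨⟨hst.1.trans h.1, h.2⟩, h.1⟩, fun h => ⟨h.2, h.1.2⟩⟩
  have e2 : duhamel SA (duhamel SB g 0) 0 t = ∫ ρ in Ioo 0 t, ∫ s in Ioo 0 t, Φ s ρ := by
    rw [duhamel, intervalIntegral.integral_of_le ht, integral_Ioc_eq_integral_Ioo]
    refine setIntegral_congr_fun measurableSet_Ioo fun ρ hρ => ?_
    have hi := hSB.intervalIntegrable hg (τ := fun s => ρ - s) (by fun_prop) 0 ρ
    have h1 : ∀ s, Φ s ρ = (Iio ρ).indicator (fun s => SA (t - ρ) (SB (ρ - s) (g s))) s := fun s => by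
      by_cases hs : s < ρ
      · rw [hΦ, indicator_of_mem (show s ∈ Iio ρ from hs)]
        exact indicator_of_mem (show ρ ∈ Ioi s from hs) _
      · rw [hΦ, indicator_of_notMem (show s ∉ Iio ρ from hs)]
        exact indicator_of_notMem (show ρ ∉ Ioi s from hs) _
    have h2 : Ioo 0 t ∩ Iio ρ = Ioo 0 ρ := by
      ext s
      exact ⟨fun h => ⟨h.1.1, h.2⟩, fun h => ⟨⟨h.1, h.2.trans hρ.2⟩, h.2⟩⟩
    simp only [h1]
    rw [setIntegral_indicator measurableSet_Iio, h2, duhamel,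
      intervalIntegral.integral_of_le hρ.1.le, ← ContinuousLinearMap.integral_comp_comm _ hi.1,
      integral_Ioc_eq_integral_Ioo]
  rw [e1, e2, integral_integral_swap hint]

end Comparison

/-! ### Assembly of the estimates. -/

section Main

variable {α K T : ℝ}

theorem admissible_top_two (α : ℝ) : Admissible α ∞ 2 :=
  ⟨le_top, le_rfl, by simp, by simp⟩

/-- The dual space of the pair `(∞, 2)` is `L¹(L²)`, and Hölder in time over an interval of length
`T` produces the factor `|I|` of the theorem. -/
theorem mixedNorm_conjExponent_top_two_le {X : Type*} [MeasurableSpace X] {μ : Measure X}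
    {W : ℝ → Lp ℂ 2 μ} {D : ℝ≥0∞} (hD : ∀ s ∈ Ioo 0 T, ‖W s‖ₑ ≤ D) :
    mixedNorm (ENNReal.conjExponent ∞) (ENNReal.conjExponent 2) (Ioo 0 T) W ≤
      ENNReal.ofReal T * D := by
  rw [conjExponent_eq_ofReal le_top one_pos (by simp), conjExponent_eq_ofReal le_rfl two_pos
    (by simp; norm_num), ENNReal.ofReal_one, ENNReal.ofReal_ofNat, mixedNorm, eLpNorm_ennreal_one]
  calc _ ≤ ∫⁻ _ in Ioo 0 T, D :=
        setLIntegral_mono_ae' measurableSet_Ioo (.of_forall fun s hs => by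
          rw [eLpNorm_lp_two]; exact hD s hs)
    _ = _ := by rw [setLIntegral_const, Real.volume_Ioo, sub_zero, mul_comm]

theorem isDispersive_of_isMDissipative {X : Type*} [MeasurableSpace X] {μ : Measure X} (hK : 0 < K)
    {A : Lp ℂ 2 μ →ₗ.[ℂ] Lp ℂ 2 μ} {S : ℝ → Lp ℂ 2 μ →L[ℂ] Lp ℂ 2 μ} (hA : IsMDissipative A)
    (hS : IsSemigroupGeneratedBy S A) (he : EnergyEstimate K S) (hd : DecayEstimate α K S) :
    IsDispersive α K (fun t => S (max t 0)) ∧ IsGenerator (fun t => S (max t 0)) A := by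
  obtain ⟨h1, h2⟩ := hA.isContractionSemigroup hS he
  exact ⟨isDispersive_of_decayEstimate hK hS.1.map_zero h1 hd, h2⟩

theorem IsDuhamelIntegral.congr {H : Type*} [NormedAddCommGroup H] [InnerProductSpace ℂ H]
    {S S' : ℝ → H →L[ℂ] H} {f f' : ℝ → H} {t : ℝ} {w : H} (h : IsDuhamelIntegral S f t w)
    (hS : ∀ τ, 0 ≤ τ → S τ = S' τ) (hf : f =ᵐ[volume.restrict (Ioo 0 t)] f') :
    IsDuhamelIntegral S' f' t w := fun x => by
  have hc : (fun s => inner ℂ x (S (t - s) (f s))) =ᵐ[volume.restrict (Ioo 0 t)]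
      fun s => inner ℂ x (S' (t - s) (f' s)) := by
    filter_upwards [hf, ae_restrict_mem measurableSet_Ioo] with s hs hst
    rw [hS _ (by linarith [hst.2]), hs]
  exact ⟨(integrable_congr hc).1 (h x).1, (integral_congr_ae hc).symm.trans (h x).2⟩

/-- One bound is the homogeneous estimate for each semigroup; the other treats `SB s ψ` as a source
in `L¹(L²)`, of norm at most `T‖ψ‖` by contractivity. -/
theorem exists_mixedNorm_sub_apply_le (hα : 0 < α) (hK : 0 < K) {q r : ℝ≥0∞}
    (h : Admissible α q r) : ∃ C : NNReal, ∀ {X : Type u} [MeasurableSpace X] {μ : Measure X}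
      {SA SB : ℝ → Lp ℂ 2 μ →L[ℂ] Lp ℂ 2 μ}, IsDispersive α K SA → IsDispersive α K SB →
      ∀ {T : ℝ}, 0 < T → ∀ φ ψ : Lp ℂ 2 μ,
      (∀ t, 0 ≤ t → SA t φ - SB t φ = ∫ s in (0)..t, SA (t - s) (SB s ψ)) →
      mixedNorm q r (Ioo 0 T) (fun t => SA t φ - SB t φ) ≤
        C * min ‖φ‖ₑ (ENNReal.ofReal T * ‖ψ‖ₑ) := by
  have hq1 : 1 ≤ q := le_trans (by norm_num) h.1
  have hr1 : 1 ≤ r := le_trans (by norm_num) h.2.1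
  obtain ⟨C, hC⟩ := exists_mixedNorm_apply_le.{u} hα hK h
  obtain ⟨D, hD⟩ := exists_mixedNorm_duhamel_le.{u} hα hK h (admissible_top_two α)
  refine ⟨max (C + C) D, fun {X} _ {μ} {SA SB} hSA hSB {T} hT φ ψ hφ => ?_⟩
  rw [mul_min]
  refine le_min ?_ ?_
  · refine (mixedNorm_sub_le hq1 hr1 (hSA.continuous_apply φ).stronglyMeasurable
      (hSB.continuous_apply φ).stronglyMeasurable).trans ?_
    refine (add_le_add (hC hSA hT φ) (hC hSB hT φ)).trans ?_
    rw [← add_mul, ← ENNReal.coe_add]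
    gcongr
    exact le_max_left _ _
  · have hW : IsBddMeas fun s => SB s ψ :=
      ⟨(hSB.continuous_apply ψ).stronglyMeasurable, ‖ψ‖, norm_nonneg _, fun s => hSB.norm_le s ψ⟩
    rw [mixedNorm_congr (G := duhamel SA (fun s => SB s ψ) 0) measurableSet_Ioo
      fun s hs => hφ s hs.1.le]
    refine (hD hSA hT hW).trans ?_
    refine mul_le_mul' (ENNReal.coe_le_coe.2 (le_max_right _ _))
      (mixedNorm_conjExponent_top_two_le fun s _ => enorm_le_iff_norm_le.2 (hSB.norm_le s ψ))

/-- The comparison of the Duhamel integrals of a bounded source. -/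
theorem exists_mixedNorm_duhamel_sub_le (hα : 0 < α) (hK : 0 < K) {q r qt rt : ℝ≥0∞}
    (h : Admissible α q r) (ht : Admissible α qt rt) :
    ∃ C : NNReal, ∀ {X : Type u} [MeasurableSpace X] {μ : Measure X}
      {SA SB : ℝ → Lp ℂ 2 μ →L[ℂ] Lp ℂ 2 μ}, IsDispersive α K SA → IsDispersive α K SB →
      ∀ {T : ℝ}, 0 < T → ∀ {f g : ℝ → Lp ℂ 2 μ}, IsBddMeas f → IsBddMeas g →
      (∀ᵐ s ∂volume.restrict (Ioo 0 T), ∀ τ, 0 ≤ τ →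
        SA τ (f s) - SB τ (f s) = ∫ σ in (0)..τ, SA (τ - σ) (SB σ (g s))) →
      mixedNorm q r (Ioo 0 T) (fun t => duhamel SA f 0 t - duhamel SB f 0 t) ≤
        C * min (mixedNorm qt.conjExponent rt.conjExponent (Ioo 0 T) f)
          (ENNReal.ofReal T * mixedNorm qt.conjExponent rt.conjExponent (Ioo 0 T) g) := by
  have hq1 : 1 ≤ q := le_trans (by norm_num) h.1
  have hr1 : 1 ≤ r := le_trans (by norm_num) h.2.1
  obtain ⟨C, hC⟩ := exists_mixedNorm_duhamel_le.{u} hα hK h ht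
  obtain ⟨D, hD⟩ := exists_mixedNorm_duhamel_le.{u} hα hK h (admissible_top_two α)
  obtain ⟨E, hE⟩ := exists_enorm_duhamel_le.{u} hα hK ht
  refine ⟨max (C + C) (D * E), fun {X} _ {μ} {SA SB} hSA hSB {T} hT {f g} hf hg hfg => ?_⟩
  rw [mul_min]
  refine le_min ?_ ?_
  · refine (mixedNorm_sub_le hq1 hr1 (hSA.continuous_duhamel hf 0).stronglyMeasurable
      (hSB.continuous_duhamel hf 0).stronglyMeasurable).trans ?_
    refine (add_le_add (hC hSA hT hf) (hC hSB hT hf)).trans ?_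
    rw [← add_mul, ← ENNReal.coe_add]
    gcongr
    exact le_max_left _ _
  -- The inner Duhamel integral as a source: bounded in `L²` on `(0, T)` by the dual norm of `g`,
  -- hence in `L¹(L²)` with a factor `T`. The constants of the two successive estimates multiply.
  · set W : ℝ → Lp ℂ 2 μ := fun t => duhamel SB g 0 (max 0 (min t T)) with hWd
    have hW : IsBddMeas W := hSB.isBddMeas_duhamel_clamp hg hT.le
    rw [mixedNorm_congr (G := duhamel SA W 0) measurableSet_Ioo fun t ht => ?_]
    swap
    · rw [duhamel_sub_duhamel hSA.toIsContractionSemigroup hSB.toIsContractionSemigroup hf hg ht.1.le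
        (ae_restrict_of_ae_restrict_of_subset (Ioo_subset_Ioo_right ht.2.le) hfg)]
      refine intervalIntegral.integral_congr fun s hs => ?_
      rw [uIcc_of_le ht.1.le] at hs
      simp only [hWd]
      rw [min_eq_left (hs.2.trans ht.2.le), max_eq_right hs.1]
    refine (hD hSA hT hW).trans ?_
    calc _ ≤ (D : ℝ≥0∞) * (ENNReal.ofReal T *
          (E * mixedNorm qt.conjExponent rt.conjExponent (Ioo 0 T) g)) := by
          gcongr
          refine mixedNorm_conjExponent_top_two_le fun s hs => ?_
          simp only [hWd]
          rw [clamp_eq_self hs]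
          exact hE hSB hg s (Ioo_subset_Icc_self hs)
      _ = (D * E : NNReal) * (ENNReal.ofReal T *
          mixedNorm qt.conjExponent rt.conjExponent (Ioo 0 T) g) := by
          rw [ENNReal.coe_mul]; ring
      _ ≤ _ := by
          gcongr
          exact le_max_right _ _

/-- Both sources are cut to the times where `f` and `g` are simultaneously at most `n` in norm. The
relation between them is pointwise in time and linear, so it survives; the truncated norms are no
larger, and the bound passes to the limit. -/
theorem exists_isDuhamelIntegral_sub_le (hα : 0 < α) (hK : 0 < K) {q r qt rt : ℝ≥0∞}
    (h : Admissible α q r) (ht : Admissible α qt rt) :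
    ∃ C : NNReal, ∀ {X : Type u} [MeasurableSpace X] {μ : Measure X}
      {SA SB : ℝ → Lp ℂ 2 μ →L[ℂ] Lp ℂ 2 μ}, IsDispersive α K SA → IsDispersive α K SB →
      ∀ {T : ℝ}, 0 < T → ∀ {f g : ℝ → Lp ℂ 2 μ}, StronglyMeasurable f → StronglyMeasurable g →
      (∀ᵐ s ∂volume.restrict (Ioo 0 T), ∀ τ, 0 ≤ τ →
        SA τ (f s) - SB τ (f s) = ∫ σ in (0)..τ, SA (τ - σ) (SB σ (g s))) →
      mixedNorm qt.conjExponent rt.conjExponent (Ioo 0 T) f < ∞ →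
      ∃ u v : ℝ → Lp ℂ 2 μ, (∀ t ∈ Ioo 0 T, IsDuhamelIntegral SA f t (u t)) ∧
        (∀ t ∈ Ioo 0 T, IsDuhamelIntegral SB f t (v t)) ∧
        AEStronglyMeasurable u (volume.restrict (Ioo 0 T)) ∧
        AEStronglyMeasurable v (volume.restrict (Ioo 0 T)) ∧
        mixedNorm q r (Ioo 0 T) (fun t => u t - v t) ≤
          C * min (mixedNorm qt.conjExponent rt.conjExponent (Ioo 0 T) f)
            (ENNReal.ofReal T * mixedNorm qt.conjExponent rt.conjExponent (Ioo 0 T) g) := by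
  obtain ⟨C, hC⟩ := exists_mixedNorm_duhamel_sub_le.{u} hα hK h ht
  refine ⟨C, fun {X} _ {μ} {SA SB} hSA hSB {T} hT {f g} hf hg hfg hm => ?_⟩
  set E : ℕ → Set ℝ := fun n => {s | ‖f s‖ ≤ n} ∩ {s | ‖g s‖ ≤ n} with hEd
  have hE : ∀ n, MeasurableSet (E n) := fun n =>
    (measurableSet_le hf.norm.measurable measurable_const).inter
      (measurableSet_le hg.norm.measurable measurable_const)
  have hmono : Monotone E := fun m n hmn s hs => by
    have hc : (m : ℝ) ≤ n := by exact_mod_cast hmn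
    exact ⟨le_trans hs.1 hc, le_trans hs.2 hc⟩
  have hcover : ∀ s ∈ Ioo 0 T, ∃ n, s ∈ E n := fun s _ => by
    obtain ⟨n, hn⟩ := exists_nat_ge (max ‖f s‖ ‖g s‖)
    exact ⟨n, (le_max_left _ _).trans hn, (le_max_right _ _).trans hn⟩
  have hbf : ∀ n, IsBddMeas ((E n).indicator f) := fun n =>
    ⟨hf.indicator (hE n), n, n.cast_nonneg, fun s => by
      by_cases hs : s ∈ E n
      · rw [indicator_of_mem hs]; exact hs.1
      · rw [indicator_of_notMem hs, norm_zero]; exact n.cast_nonneg⟩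
  have hbg : ∀ n, IsBddMeas ((E n).indicator g) := fun n =>
    ⟨hg.indicator (hE n), n, n.cast_nonneg, fun s => by
      by_cases hs : s ∈ E n
      · rw [indicator_of_mem hs]; exact hs.2
      · rw [indicator_of_notMem hs, norm_zero]; exact n.cast_nonneg⟩
  obtain ⟨u, hu⟩ := hSA.exists_isDuhamelIntegral hα hK ht hf hm hE hmono hcover hbf
  obtain ⟨v, hv⟩ := hSB.exists_isDuhamelIntegral hα hK ht hf hm hE hmono hcover hbf
  have hcA := fun n => hSA.continuous_duhamel (hbf n) 0
  have hcB := fun n => hSB.continuous_duhamel (hbf n) 0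
  refine ⟨u, v, fun t ht => (hu t ht).2, fun t ht => (hv t ht).2,
    aestronglyMeasurable_of_tendsto_ae atTop (fun n => (hcA n).aestronglyMeasurable)
      ((ae_restrict_iff' measurableSet_Ioo).2 (.of_forall fun t ht => (hu t ht).1)),
    aestronglyMeasurable_of_tendsto_ae atTop (fun n => (hcB n).aestronglyMeasurable)
      ((ae_restrict_iff' measurableSet_Ioo).2 (.of_forall fun t ht => (hv t ht).1)),
    mixedNorm_le_of_tendsto (lt_of_lt_of_le (by norm_num) h.1).ne' measurableSet_Ioo
      (fun n => ((hcA n).sub (hcB n)).stronglyMeasurable)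
      (fun t ht => (hu t ht).1.sub (hv t ht).1) fun n => ?_⟩
  refine (hC hSA hSB hT (hbf n) (hbg n) ?_).trans ?_
  · filter_upwards [hfg] with s hs τ hτ
    by_cases hsE : s ∈ E n
    · simp only [indicator_of_mem hsE]
      exact hs τ hτ
    · simp only [indicator_of_notMem hsE, map_zero, sub_self, intervalIntegral.integral_zero]
  · gcongr
    · exact mixedNorm_mono_enorm measurableSet_Ioo fun s _ => eLpNorm_indicator_le _ f s
    · exact mixedNorm_mono_enorm measurableSet_Ioo fun s _ => eLpNorm_indicator_le _ g s

end Main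
end DispersiveSemigroups

theorem mainTheorem4 (α K : ℝ) (hα : 0 < α) (hK : 0 < K) :
    (∀ q r : ℝ≥0∞, Admissible α q r →
      ∃ C : ℝ, 0 < C ∧
        ∀ (X : Type u) [MeasurableSpace X] (μ : Measure X)
          (A B : Lp ℂ 2 μ →ₗ.[ℂ] Lp ℂ 2 μ) (SA SB : ℝ → Lp ℂ 2 μ →L[ℂ] Lp ℂ 2 μ),
          IsMDissipative A → IsMDissipative B →
          DomainEmbeds A B →
          opProd A B = opProd B A →
          IsSemigroupGeneratedBy SA A →
          IsSemigroupGeneratedBy SB B →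
          EnergyEstimate K SA → EnergyEstimate K SB →
          DecayEstimate α K SA → DecayEstimate α K SB →
          ∀ T : ℝ, 0 < T → ∀ φ : (A - B).domain,
            mixedNorm q r (Ioo 0 T)
                (fun t => SA t (φ : Lp ℂ 2 μ) - SB t (φ : Lp ℂ 2 μ)) ≤
              ENNReal.ofReal (C * min ‖(φ : Lp ℂ 2 μ)‖ (T * ‖(A - B) φ‖))) ∧
    (∀ q r qt rt : ℝ≥0∞, Admissible α q r →
      Admissible α qt rt →
      ∃ C : ℝ, 0 < C ∧
        ∀ (X : Type u) [MeasurableSpace X] (μ : Measure X)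
          (A B : Lp ℂ 2 μ →ₗ.[ℂ] Lp ℂ 2 μ) (SA SB : ℝ → Lp ℂ 2 μ →L[ℂ] Lp ℂ 2 μ),
          IsMDissipative A → IsMDissipative B →
          DomainEmbeds A B →
          opProd A B = opProd B A →
          IsSemigroupGeneratedBy SA A →
          IsSemigroupGeneratedBy SB B →
          EnergyEstimate K SA → EnergyEstimate K SB →
          DecayEstimate α K SA → DecayEstimate α K SB →
          ∀ T : ℝ, 0 < T → ∀ f g : ℝ → Lp ℂ 2 μ,
            AEStronglyMeasurable f (volume.restrict (Ioo 0 T)) →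
            AEStronglyMeasurable g (volume.restrict (Ioo 0 T)) →
            (∀ᵐ s ∂(volume.restrict (Ioo 0 T)), (f s, g s) ∈ (A - B).graph) →
            mixedNorm (ENNReal.conjExponent qt) (ENNReal.conjExponent rt) (Ioo 0 T) f < ∞ →
            mixedNorm (ENNReal.conjExponent qt) (ENNReal.conjExponent rt) (Ioo 0 T) g < ∞ →
            ∃ u v : ℝ → Lp ℂ 2 μ,
              (∀ t ∈ Ioo 0 T, IsDuhamelIntegral SA f t (u t)) ∧
              (∀ t ∈ Ioo 0 T, IsDuhamelIntegral SB f t (v t)) ∧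
              AEStronglyMeasurable u (volume.restrict (Ioo 0 T)) ∧
              AEStronglyMeasurable v (volume.restrict (Ioo 0 T)) ∧
              mixedNorm q r (Ioo 0 T) (fun t => u t - v t) ≤
                ENNReal.ofReal C *
                  min (mixedNorm (ENNReal.conjExponent qt) (ENNReal.conjExponent rt) (Ioo 0 T) f)
                    (ENNReal.ofReal T *
                      mixedNorm (ENNReal.conjExponent qt) (ENNReal.conjExponent rt)
                        (Ioo 0 T) g)) := by
  refine ⟨fun q r h => ?_, fun q r qt rt h ht => ?_⟩
  · obtain ⟨C, hC⟩ := exists_mixedNorm_sub_apply_le.{u} hα hK h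
    -- The estimates provide a nonnegative constant; one is added to make it strictly positive.
    refine ⟨C + 1, by positivity, fun X _ μ A B SA SB hA hB hAB hcomm hSA hSB heA heB hdA hdB T hT φ => ?_⟩
    obtain ⟨hA1, hA2⟩ := isDispersive_of_isMDissipative hK hA hSA heA hdA
    obtain ⟨hB1, hB2⟩ := isDispersive_of_isMDissipative hK hB hSB heB hdB
    obtain ⟨a, b, ha, hb, hab⟩ := exists_graph_of_mem_sub_graph ((A - B).mem_graph φ)
    have h1 := hC hA1 hB1 hT (φ : Lp ℂ 2 μ) ((A - B) φ) fun t ht => by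
      rw [← hab]
      exact sub_eq_integral_of_comm hA hB hAB.choose hcomm hA1.toIsContractionSemigroup
        hB1.toIsContractionSemigroup hA2 hB2 ha hb ht
    rw [mixedNorm_congr (G := fun t => SA (max t 0) (φ : Lp ℂ 2 μ) - SB (max t 0) (φ : Lp ℂ 2 μ))
      measurableSet_Ioo fun t ht => by rw [max_eq_left ht.1.le]]
    refine h1.trans ?_
    rw [ENNReal.ofReal_mul (by positivity), ENNReal.ofReal_mono.map_min, ENNReal.ofReal_mul hT.le,
      ofReal_norm, ofReal_norm]
    gcongr
    exact ENNReal.ofReal_coe_nnreal.ge.trans (ENNReal.ofReal_le_ofReal (by linarith))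
  · obtain ⟨C, hC⟩ := exists_isDuhamelIntegral_sub_le.{u} hα hK h ht
    refine ⟨C + 1, by positivity, fun X _ μ A B SA SB hA hB hAB hcomm hSA hSB heA heB hdA hdB T hT
      f g hf hg hfg hmf _ => ?_⟩
    obtain ⟨hA1, hA2⟩ := isDispersive_of_isMDissipative hK hA hSA heA hdA
    obtain ⟨hB1, hB2⟩ := isDispersive_of_isMDissipative hK hB hSB heB hdB
    -- Strongly measurable representatives replace `f` and `g`; the mixed norms, the graph relation
    -- almost everywhere and the weak integrals do not see null sets of times.
    have hmf' : mixedNorm qt.conjExponent rt.conjExponent (Ioo 0 T) f =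
        mixedNorm qt.conjExponent rt.conjExponent (Ioo 0 T) (hf.mk f) :=
      eLpNorm_congr_ae (hf.ae_eq_mk.fun_comp fun v : Lp ℂ 2 μ => eLpNorm v rt.conjExponent μ)
    have hmg' : mixedNorm qt.conjExponent rt.conjExponent (Ioo 0 T) g =
        mixedNorm qt.conjExponent rt.conjExponent (Ioo 0 T) (hg.mk g) :=
      eLpNorm_congr_ae (hg.ae_eq_mk.fun_comp fun v : Lp ℂ 2 μ => eLpNorm v rt.conjExponent μ)
    rw [hmf'] at hmf
    obtain ⟨u, v, hu, hv, hum, hvm, huv⟩ := hC hA1 hB1 hT hf.stronglyMeasurable_mk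
      hg.stronglyMeasurable_mk (by
        filter_upwards [hfg, hf.ae_eq_mk, hg.ae_eq_mk] with s hs hfs hgs τ hτ
        obtain ⟨a, b, ha, hb, hab⟩ := exists_graph_of_mem_sub_graph hs
        rw [← hfs, ← hgs, ← hab]
        exact sub_eq_integral_of_comm hA hB hAB.choose hcomm hA1.toIsContractionSemigroup
          hB1.toIsContractionSemigroup hA2 hB2 ha hb hτ) hmf
    have hae : ∀ t ∈ Ioo 0 T, hf.mk f =ᵐ[volume.restrict (Ioo 0 t)] f := fun t ht =>
      ae_restrict_of_ae_restrict_of_subset (Ioo_subset_Ioo_right ht.2.le) hf.ae_eq_mk.symm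
    refine ⟨u, v, fun t ht => (hu t ht).congr (fun τ hτ => by rw [max_eq_left hτ]) (hae t ht),
      fun t ht => (hv t ht).congr (fun τ hτ => by rw [max_eq_left hτ]) (hae t ht), hum, hvm,
      huv.trans ?_⟩
    rw [hmf', hmg']
    gcongr
    exact ENNReal.ofReal_coe_nnreal.ge.trans (ENNReal.ofReal_le_ofReal (by linarith))
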